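/- Let $k$ be a field; all modules are finitely generated. Let $\hat{\mathcal C}$ be the category of complete local commutative Noetherian $k$-algebras with residue field $k$, with continuous $k$-algebra homomorphisms inducing the identity on $k$ as morphisms. For a finite dimensional $k$-algebra $A$, a left $A$-module $X$ and $R$ in $\hat{\mathcal C}$, a lift of $X$ over $R$ is a pair $(M,\phi)$ of a left $R\otimes_k A$-module $M$ that is free over $R$ and an isomorphism of $A$-modules $\phi: k\otimes_R M\to X$; two lifts $(M,\phi)$, $(M',\phi')$ are isomorphic if there is an $R\otimes_kA$-module isomorphism $g:M\to M'$ with $\phi'\circ(\mathrm{id}_k\otimes g)=\phi$; a morphism $\theta:R\to R'$ sends $(M,\phi)$ to $(R'\otimes_{R,\theta}M,\phi_\theta)$, where $\phi_\theta$ is the composite $k\otimes_{R'}(R'\otimes_{R,\theta}M)\cong k\otimes_RM\xrightarrow{\phi}X$. An object $R(A,X)$ of $\hat{\mathcal C}$ is a versal deformation ring of $X$ if there is a lift $U$ of $X$ over $R(A,X)$ such that every lift of $X$ over every $R$ in $\hat{\mathcal C}$ is isomorphic to the image of $U$ under some morphism $R(A,X)\to R$, and this morphism is unique when $R=k[\epsilon]$,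 $\epsilon^2=0$. The algebra $A$ is Gorenstein if it has finite injective dimension as a left and as a right module over itself. A left $A$-module $X$ is Gorenstein-projective if there is an acyclic complex $P^\bullet$ of projective left $A$-modules such that $\mathrm{Hom}_A(P^\bullet,A)$ is acyclic and $X\cong\mathrm{coker}(P^0\to P^1)$. Theorem. Let $\Lambda$ and $\Gamma$ be finite dimensional $k$-algebras and $B$ a finite dimensional $\Lambda$-$\Gamma$-bimodule on which $k$ acts centrally, and assume that the triangular matrix algebra $\Sigma=\begin{pmatrix}\Lambda&B\\0&\Gamma\end{pmatrix}$ is Gorenstein, that $B$ is projective as a left $\Lambda$-module and that $\Gamma$ has finite global dimension. Let $V$ be a left $\Lambda$-module, $W$ a left $\Gamma$-module and $f:B\otimes_\Gamma W\to V$ a $\Lambda$-module homomorphism, and let $\begin{pmatrix}V\\W\end{pmatrix}_f$ be the left $\Sigma$-module $V\oplus W$ on which $\begin{pmatrix}\lambda&b\\0&\gamma\end{pmatrix}$ acts by $(v,w)\mapsto(\lambda v+f(b\otimes w),\gamma w)$. If $\begin{pmatrix}V\\W\end{pmatrix}_f$ is a Gorenstein-projective $\Sigma$-module, then the $\Sigma$-module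 $\begin{pmatrix}V\\W\end{pmatrix}_f$ and the $\Lambda$-module $V$ have versal deformation rings $R\left(\Sigma,\begin{pmatrix}V\\W\end{pmatrix}_f\right)$ and $R(\Lambda,V)$, and any two such rings are isomorphic in $\hat{\mathcal C}$. -/

import Mathlib

open scoped TensorProduct

universe u

/-! ### The category of complete local commutative Noetherian `k`-algebras with residue field `k` -/

/-- An object of the category `Ĉ`: a complete local commutative Noetherian `k`-algebra whose
residue field is `k` (through the structure map). -/
structure CLNAlg (k : Type u) [Field k] where
  carrier : Type u
  [commRing : CommRing carrier]
  [algebra : Algebra k carrier]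
  [isLocalRing : IsLocalRing carrier]
  [isNoetherianRing : IsNoetherianRing carrier]
  [isAdicComplete : IsAdicComplete (IsLocalRing.maximalIdeal carrier) carrier]
  residue_bijective :
    Function.Bijective (algebraMap k (IsLocalRing.ResidueField carrier))

namespace CLNAlg

instance (k : Type u) [Field k] : CoeSort (CLNAlg k) (Type u) := ⟨CLNAlg.carrier⟩

attribute [instance] commRing algebra isLocalRing isNoetherianRing isAdicComplete

/-- Morphisms of `Ĉ`: `k`-algebra homomorphisms that are continuous for the topologies given by
the maximal ideals, i.e. local. Being `k`-linear, such a map induces the identity on the residue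
field `k`. -/
@[ext]
structure Hom {k : Type u} [Field k] (R S : CLNAlg k) where
  toAlgHom : R →ₐ[k] S
  isLocalHom : IsLocalHom (toAlgHom : (R : Type u) →+* S)

instance (k : Type u) [Field k] : CategoryTheory.Category (CLNAlg k) where
  Hom := Hom
  id R := ⟨AlgHom.id k R, ⟨fun _ h => h⟩⟩
  comp f g := ⟨g.toAlgHom.comp f.toAlgHom,
    ⟨fun a h => f.isLocalHom.map_nonunit a (g.isLocalHom.map_nonunit _ h)⟩⟩

/-- The ring of dual numbers `k[ε]`, `ε ^ 2 = 0`, as an object of `Ĉ`. -/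
noncomputable def dualNumber (k : Type u) [Field k] : CLNAlg k where
  carrier := DualNumber k
  isNoetherianRing := by
    have : Module.Finite k (DualNumber k) := inferInstanceAs (Module.Finite k (k × k))
    exact isNoetherian_of_tower k inferInstance
  isAdicComplete := by
    have h2 : (IsLocalRing.maximalIdeal (DualNumber k)) ^ 2 = ⊥ := by
      rw [DualNumber.maximalIdeal_eq_span_singleton_eps, Ideal.span_singleton_pow, pow_two,
        DualNumber.eps_mul_eps]
      simp
    refine { haus' := fun x hx => ?_, prec' := fun f hf => ⟨f 2, fun n => ?_⟩ }
    · have := hx 2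
      rw [h2] at this
      simpa [SModEq.bot] using this
    · rcases le_total n 2 with h | h
      · exact hf h
      · have := hf h
        rw [h2] at this
        have h' : f 2 = f n := by simpa [SModEq.bot] using this
        exact h' ▸ SModEq.rfl
  residue_bijective := by
    refine ⟨(algebraMap k _).injective, fun y => ?_⟩
    obtain ⟨x, rfl⟩ := IsLocalRing.residue_surjective y
    refine ⟨x.fst, ?_⟩
    change IsLocalRing.residue (DualNumber k) (algebraMap k (DualNumber k) x.fst) = _
    rw [← sub_eq_zero, ← map_sub, IsLocalRing.residue_eq_zero_iff,
      DualNumber.maximalIdeal_eq_span_singleton_eps, Ideal.mem_span_singleton,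
      ← DualNumber.fst_eq_zero_iff_eps_dvd]
    simp [TrivSqZeroExt.algebraMap_eq_inl]

end CLNAlg

/-! ### Lifts, deformations and versal deformation rings -/

/-- A lift of the left `A`-module `V` over the local `k`-algebra `R` with residue field `κ`:
a finitely generated left module over `R ⊗[k] A` that is free over `R`, together with an
isomorphism of `A`-modules `κ ⊗[R] M ≃ V`. The `R ⊗[k] A`-module structure is recorded as an
`R`-module structure together with the commuting action of `A`, i.e. the ring homomorphism
`A → End_R M` that agrees with the `R`-module structure on `k`. -/
structure Lift (k : Type u) [Field k] (A : Type u) [Ring A] [Algebra k A]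
    (V : Type u) [AddCommGroup V] [Module A V]
    (R : Type u) [CommRing R] [Algebra k R] [IsLocalRing R] where
  carrier : Type u
  [addCommGroup : AddCommGroup carrier]
  [module : Module R carrier]
  [free : Module.Free R carrier]
  [finite : Module.Finite R carrier]
  action : A →+* Module.End R carrier
  action_algebraMap : ∀ (c : k) (m : carrier),
    action (algebraMap k A c) m = algebraMap k R c • m
  reduction : IsLocalRing.ResidueField R ⊗[R] carrier ≃+ V
  reduction_action : ∀ (a : A) (x : IsLocalRing.ResidueField R ⊗[R] carrier),
    reduction ((action a).baseChange (IsLocalRing.ResidueField R) x) = a • reduction x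

namespace Lift

attribute [instance] addCommGroup module free finite

section

variable {k : Type u} [Field k] {A : Type u} [Ring A] [Algebra k A]
  {V : Type u} [AddCommGroup V] [Module A V]
  {R : Type u} [CommRing R] [Algebra k R] [IsLocalRing R]

/-- Two lifts are isomorphic (define the same deformation) if there is an isomorphism of
`R ⊗[k] A`-modules between them that is compatible with the isomorphisms to `V`. -/
def Isomorphic (L L' : Lift k A V R) : Prop :=
  ∃ f : L.carrier ≃ₗ[R] L'.carrier,
    (∀ (a : A) (m : L.carrier), f (L.action a m) = L'.action a (f m)) ∧
    ∀ x : IsLocalRing.ResidueField R ⊗[R] L.carrier,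
      L'.reduction (f.toLinearMap.baseChange (IsLocalRing.ResidueField R) x) = L.reduction x

variable (S : Type u) [CommRing S] [Algebra k S] [IsLocalRing S]

/-- For a local extension `S` of `R` with the same residue field `k`, the residue fields of `R`
and `S` agree. -/
noncomputable def residueEquiv (R : Type u) [CommRing R] [Algebra k R] [IsLocalRing R]
    [Algebra R S] [IsScalarTower k R S] [IsLocalHom (algebraMap R S)]
    (hS : Function.Bijective (algebraMap k (IsLocalRing.ResidueField S))) :
    IsLocalRing.ResidueField R ≃ₗ[R] IsLocalRing.ResidueField S :=
  LinearEquiv.ofBijective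
    (IsScalarTower.toAlgHom R (IsLocalRing.ResidueField R)
      (IsLocalRing.ResidueField S)).toLinearMap
    ⟨(algebraMap (IsLocalRing.ResidueField R) (IsLocalRing.ResidueField S)).injective, fun y => by
      obtain ⟨c, rfl⟩ := hS.2 y
      exact ⟨algebraMap k _ c, (IsScalarTower.algebraMap_apply k (IsLocalRing.ResidueField R)
        (IsLocalRing.ResidueField S) c).symm⟩⟩

/-- The isomorphism `κ(S) ⊗[S] (S ⊗[R] M) ≃ κ(R) ⊗[R] M`. -/
noncomputable def cancelResidue (M : Type u) [AddCommGroup M] [Module R M]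
    [Algebra R S] [IsScalarTower k R S] [IsLocalHom (algebraMap R S)]
    (hS : Function.Bijective (algebraMap k (IsLocalRing.ResidueField S))) :
    IsLocalRing.ResidueField S ⊗[S] (S ⊗[R] M) ≃+ IsLocalRing.ResidueField R ⊗[R] M :=
  (TensorProduct.AlgebraTensorModule.cancelBaseChange R S S
    (IsLocalRing.ResidueField S) M).toAddEquiv.trans
    (TensorProduct.congr (residueEquiv (k := k) S R hS).symm (LinearEquiv.refl R M)).toAddEquiv

/-- The lift `(S ⊗[R] M, φ')` of `V` over `S` obtained from a lift `(M, φ)` over `R`, where `φ'` is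
the composite `κ(S) ⊗[S] (S ⊗[R] M) ≃ κ(R) ⊗[R] M ≃ V`. -/
noncomputable def baseChange (L : Lift k A V R)
    [Algebra R S] [IsScalarTower k R S] [IsLocalHom (algebraMap R S)]
    (hS : Function.Bijective (algebraMap k (IsLocalRing.ResidueField S))) :
    Lift k A V S where
  carrier := S ⊗[R] L.carrier
  action := ((Module.End.baseChangeHom R S L.carrier : _ →ₐ[R] _) : _ →+* _).comp L.action
  action_algebraMap c m := by
    induction m using TensorProduct.induction_on with
    | zero => simp
    | add x y hx hy => rw [map_add, hx, hy, smul_add]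
    | tmul s m =>
      change s ⊗ₜ[R] (L.action (algebraMap k A c) m) = algebraMap k S c • (s ⊗ₜ[R] m)
      rw [L.action_algebraMap, TensorProduct.tmul_smul, IsScalarTower.algebraMap_apply k R S]
      exact (algebraMap_smul S _ _).symm
  reduction := (cancelResidue (k := k) S L.carrier hS).trans L.reduction
  reduction_action a x := by
    induction x using TensorProduct.induction_on with
    | zero => simp
    | add x y hx hy => rw [map_add, map_add, hx, hy, map_add, smul_add]
    | tmul t y =>
      induction y using TensorProduct.induction_on with
      | zero => simp
      | add x y hx hy =>
        rw [TensorProduct.tmul_add, map_add, map_add, hx, hy, map_add, smul_add]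
      | tmul s m =>
        simp only [AddEquiv.trans_apply]
        rw [← L.reduction_action]
        rfl

end

/-- The value on the lift `L` of the deformation functor at a morphism of `Ĉ`. -/
noncomputable def map {k : Type u} [Field k] {A : Type u} [Ring A] [Algebra k A]
    {V : Type u} [AddCommGroup V] [Module A V] {R S : CLNAlg k} (θ : R ⟶ S)
    (L : Lift k A V R) : Lift k A V S :=
  letI : Algebra R S := θ.toAlgHom.toRingHom.toAlgebra
  haveI : IsScalarTower k R S := IsScalarTower.of_algebraMap_eq fun c => (θ.toAlgHom.commutes c).symm
  haveI : IsLocalHom (algebraMap R S) := θ.isLocalHom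
  L.baseChange S S.residue_bijective

end Lift

/-- `U` is a versal deformation of `V` over `R`: every lift over every `S` in `Ĉ` is, up to
isomorphism, the image of `U` under some morphism `R ⟶ S`, and that morphism is unique when
`S = k[ε]`. -/
def IsVersalDeformation {k : Type u} [Field k] {A : Type u} [Ring A] [Algebra k A]
    {V : Type u} [AddCommGroup V] [Module A V] {R : CLNAlg k} (U : Lift k A V R) : Prop :=
  (∀ (S : CLNAlg k) (L : Lift k A V S), ∃ θ : R ⟶ S, (U.map θ).Isomorphic L) ∧
  ∀ (L : Lift k A V (CLNAlg.dualNumber k)) (θ θ' : R ⟶ CLNAlg.dualNumber k),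
    (U.map θ).Isomorphic L → (U.map θ').Isomorphic L → θ = θ'

/-- `R` is a versal deformation ring of the left `A`-module `V`. -/
def IsVersalDeformationRing (k : Type u) [Field k] (A : Type u) [Ring A] [Algebra k A]
    (V : Type u) [AddCommGroup V] [Module A V] (R : CLNAlg k) : Prop :=
  ∃ U : Lift k A V R, IsVersalDeformation U

/-! ### Homological conditions -/

/-- The ring `A` has finite injective dimension as a left and as a right module over itself. -/
def IsGorensteinAlg (A : Type u) [Ring A] : Prop :=
  (∃ n : ℕ, CategoryTheory.HasInjectiveDimensionLE (ModuleCat.of.{u} A A) n) ∧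
  ∃ n : ℕ, CategoryTheory.HasInjectiveDimensionLE (ModuleCat.of.{u} Aᵐᵒᵖ A) n

/-- The ring `A` has finite (left) global dimension. -/
def HasFiniteGlobalDim (A : Type u) [Ring A] : Prop :=
  ∃ n : ℕ, ∀ M : ModuleCat.{u} A, CategoryTheory.HasProjectiveDimensionLE M n

/-- A left `A`-module `V` is (finitely generated) Gorenstein-projective if there is an acyclic
complex `P` of finitely generated projective left `A`-modules such that `Hom_A(P, A)` is also
acyclic and `V` is isomorphic to the cokernel of the differential of `P` in degree `0`. -/
def IsGorensteinProjective (A : Type u) [Ring A] (V : Type u) [AddCommGroup V] [Module A V] :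
    Prop :=
  ∃ (P : ℤ → ModuleCat.{u} A) (d : ∀ i, P i →ₗ[A] P (i + 1)),
    (∀ i, Module.Finite A (P i)) ∧
    (∀ i, Module.Projective A (P i)) ∧
    (∀ i, Function.Exact (d i) (d (i + 1))) ∧
    (∀ i, Function.Exact (fun h : P (i + 1 + 1) →ₗ[A] A => h ∘ₗ d (i + 1))
      (fun g : P (i + 1) →ₗ[A] A => g ∘ₗ d i)) ∧
    Nonempty ((P (0 + 1) ⧸ LinearMap.range (d 0)) ≃ₗ[A] V)

/-! ### Triangular matrix algebras and their modules -/

/-- The set of triangular matrices `[[a, b], [0, c]]` with `a ∈ A`, `b ∈ B`, `c ∈ C`. -/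
@[ext]
structure TriMat (A B C : Type u) where
  a : A
  b : B
  c : C

namespace TriMat

section

variable {A B C : Type u} [Ring A] [Ring C] [AddCommGroup B]

instance : Zero (TriMat A B C) := ⟨⟨0, 0, 0⟩⟩
instance : One (TriMat A B C) := ⟨⟨1, 0, 1⟩⟩
instance : Add (TriMat A B C) := ⟨fun x y => ⟨x.a + y.a, x.b + y.b, x.c + y.c⟩⟩
instance : Neg (TriMat A B C) := ⟨fun x => ⟨-x.a, -x.b, -x.c⟩⟩

@[simp] theorem zero_a : (0 : TriMat A B C).a = 0 := rfl
@[simp] theorem zero_b : (0 : TriMat A B C).b = 0 := rfl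
@[simp] theorem zero_c : (0 : TriMat A B C).c = 0 := rfl
@[simp] theorem one_a : (1 : TriMat A B C).a = 1 := rfl
@[simp] theorem one_b : (1 : TriMat A B C).b = 0 := rfl
@[simp] theorem one_c : (1 : TriMat A B C).c = 1 := rfl
@[simp] theorem add_a (x y : TriMat A B C) : (x + y).a = x.a + y.a := rfl
@[simp] theorem add_b (x y : TriMat A B C) : (x + y).b = x.b + y.b := rfl
@[simp] theorem add_c (x y : TriMat A B C) : (x + y).c = x.c + y.c := rfl
@[simp] theorem neg_a (x : TriMat A B C) : (-x).a = -x.a := rfl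
@[simp] theorem neg_b (x : TriMat A B C) : (-x).b = -x.b := rfl
@[simp] theorem neg_c (x : TriMat A B C) : (-x).c = -x.c := rfl
variable [Module A B] [Module Cᵐᵒᵖ B]

instance : Mul (TriMat A B C) :=
  ⟨fun x y => ⟨x.a * y.a, x.a • y.b + MulOpposite.op y.c • x.b, x.c * y.c⟩⟩

@[simp] theorem mul_a (x y : TriMat A B C) : (x * y).a = x.a * y.a := rfl
@[simp] theorem mul_b (x y : TriMat A B C) :
    (x * y).b = x.a • y.b + MulOpposite.op y.c • x.b := rfl
@[simp] theorem mul_c (x y : TriMat A B C) : (x * y).c = x.c * y.c := rfl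

/-- The ring of triangular matrices, with the usual product of `2 × 2` matrices. -/
instance [SMulCommClass A Cᵐᵒᵖ B] : Ring (TriMat A B C) where
  add_assoc x y z := by ext <;> simp [add_assoc]
  zero_add x := by ext <;> simp
  add_zero x := by ext <;> simp
  add_comm x y := by ext <;> simp [add_comm]
  neg_add_cancel x := by ext <;> simp
  nsmul := nsmulRec
  zsmul := zsmulRec
  left_distrib x y z := by
    ext
    · simp [mul_add]
    · simp only [mul_b, add_b, add_c, smul_add, MulOpposite.op_add, add_smul]; abel
    · simp [mul_add]
  right_distrib x y z := by
    ext
    · simp [add_mul]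
    · simp only [mul_b, add_b, add_a, smul_add, add_smul]; abel
    · simp [add_mul]
  zero_mul x := by ext <;> simp
  mul_zero x := by ext <;> simp
  mul_assoc x y z := by
    ext
    · simp [mul_assoc]
    · simp only [mul_a, mul_b, mul_c, smul_add, MulOpposite.op_mul, mul_smul,
        smul_comm (x.a) (MulOpposite.op z.c) y.b]
      abel
    · simp [mul_assoc]
  one_mul x := by ext <;> simp
  mul_one x := by ext <;> simp

/-- The `k`-algebra structure on triangular matrices: an element of `k` goes to the corresponding
scalar matrix. It uses that `k` acts on `B` in the same way through `A` and through `C`. -/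
instance {k : Type u} [Field k] [Algebra k A] [Algebra k C] [Module k B]
    [IsScalarTower k A B] [IsScalarTower k Cᵐᵒᵖ B] [SMulCommClass A Cᵐᵒᵖ B] :
    Algebra k (TriMat A B C) where
  smul r x := ⟨r • x.a, r • x.b, r • x.c⟩
  algebraMap :=
    { toFun := fun r => ⟨algebraMap k A r, 0, algebraMap k C r⟩
      map_one' := by ext <;> simp
      map_mul' := fun r s => by ext <;> simp
      map_zero' := by ext <;> simp
      map_add' := fun r s => by ext <;> simp }
  commutes' r x := by
    ext
    · exact Algebra.commutes r x.a
    · change algebraMap k A r • x.b + MulOpposite.op x.c • (0 : B) =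
        x.a • (0 : B) + algebraMap k Cᵐᵒᵖ r • x.b
      rw [smul_zero, smul_zero, add_zero, zero_add, algebraMap_smul, algebraMap_smul]
    · exact Algebra.commutes r x.c
  smul_def' r x := by
    ext
    · exact Algebra.smul_def r x.a
    · change r • x.b = algebraMap k A r • x.b + MulOpposite.op x.c • (0 : B)
      rw [smul_zero, add_zero, algebraMap_smul]
    · exact Algebra.smul_def r x.c

end

end TriMat

/-- The datum of an `A`-module homomorphism `f : B ⊗_C W → V`, given through the universal property
of the tensor product over the (possibly noncommutative) ring `C`: a biadditive map
`(b, w) ↦ f (b ⊗ w)` that is `C`-balanced and `A`-linear in `b`. -/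
structure TriModHom (A B C : Type u) [Ring A] [Ring C] [AddCommGroup B] [Module A B]
    [Module Cᵐᵒᵖ B] (V W : Type u) [AddCommGroup V] [Module A V]
    [AddCommGroup W] [Module C W] where
  toFun : B →+ W →+ V
  map_smul : ∀ (a : A) (b : B) (w : W), toFun (a • b) w = a • toFun b w
  balanced : ∀ (b : B) (c : C) (w : W), toFun (MulOpposite.op c • b) w = toFun b (c • w)

/-- The underlying group `V × W` of the left module `(V, W)_f` over the triangular matrix
algebra. -/
@[nolint unusedArguments]
def TriMod {A B C : Type u} [Ring A] [Ring C] [AddCommGroup B] [Module A B]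
    [Module Cᵐᵒᵖ B] {V W : Type u} [AddCommGroup V] [Module A V]
    [AddCommGroup W] [Module C W] (_f : TriModHom A B C V W) : Type u :=
  V × W

namespace TriMod

section

variable {A B C : Type u} [Ring A] [Ring C] [AddCommGroup B] [Module A B]
    [Module Cᵐᵒᵖ B] {V W : Type u} [AddCommGroup V] [Module A V]
    [AddCommGroup W] [Module C W] (f : TriModHom A B C V W)

instance : AddCommGroup (TriMod f) := inferInstanceAs (AddCommGroup (V × W))

/-- The matrix `[[a, b], [0, c]]` sends the column `(v, w)` to `(a v + f (b ⊗ w), c w)`. -/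
instance [SMulCommClass A Cᵐᵒᵖ B] : Module (TriMat A B C) (TriMod f) where
  smul x p := ((x.a • p.1 + f.toFun x.b p.2, x.c • p.2) : V × W)
  one_smul p := Prod.ext
    (show (1 : A) • p.1 + f.toFun 0 p.2 = p.1 by simp)
    (show (1 : C) • p.2 = p.2 by simp)
  mul_smul x y p := Prod.ext
    (show (x.a * y.a) • p.1 + f.toFun (x.a • y.b + MulOpposite.op y.c • x.b) p.2 =
        x.a • (y.a • p.1 + f.toFun y.b p.2) + f.toFun x.b (y.c • p.2) by
      rw [map_add, AddMonoidHom.add_apply, f.map_smul, f.balanced, smul_add, mul_smul, add_assoc])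
    (show (x.c * y.c) • p.2 = x.c • y.c • p.2 from mul_smul _ _ _)
  smul_zero x := Prod.ext
    (show x.a • (0 : V) + f.toFun x.b (0 : W) = 0 by simp)
    (show x.c • (0 : W) = 0 by simp)
  smul_add x p q := Prod.ext
    (show x.a • (p.1 + q.1) + f.toFun x.b (p.2 + q.2) =
        (x.a • p.1 + f.toFun x.b p.2) + (x.a • q.1 + f.toFun x.b q.2) by
      rw [smul_add, map_add]; abel)
    (show x.c • (p.2 + q.2) = x.c • p.2 + x.c • q.2 from smul_add _ _ _)
  add_smul x y p := Prod.ext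
    (show (x.a + y.a) • p.1 + f.toFun (x.b + y.b) p.2 =
        (x.a • p.1 + f.toFun x.b p.2) + (y.a • p.1 + f.toFun y.b p.2) by
      rw [add_smul, map_add, AddMonoidHom.add_apply]; abel)
    (show (x.c + y.c) • p.2 = x.c • p.2 + y.c • p.2 from add_smul _ _ _)
  zero_smul p := Prod.ext
    (show (0 : A) • p.1 + f.toFun 0 p.2 = 0 by simp)
    (show (0 : C) • p.2 = 0 by simp)

end

end TriMod

/-! Over every `S` in `Ĉ`, taking the upper corner `e₁L` of a lift `L` of `(V, W)_f` is a bijection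
onto the isomorphism classes of lifts of `V`, compatible with base change. So both modules have the
same deformation functor, hence the same versal ring.

Let `P` be a totally acyclic complex with cokernel `(V, W)_f`. Its lower corner `e₂P` is an exact
complex of projective `Γ`-modules. It is contractible because `Γ` has finite global dimension, so
`W` is projective. As `B` is projective over `Λ`, the upper corner `e₁P` is an exact complex of
projective `Λ`-modules. The contractibility of `e₂P` transfers the exactness of `Hom_Σ(P, Σ)` to
`Hom_Λ(e₁P, Λ)`. It follows that `Ext¹(V, Λ) = 0`, and that every homomorphism `B ⊗ W → V` is `f`
followed by a sum of maps `φ_j(·) v_j` with `φ_j : V → Λ`. These facts form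
`IsGorensteinProjective.triMod`; nothing else is used about Gorenstein-projectivity.

Now let `M` be a lift of `V` over `S`. The module `B ⊗ W` is projective, so `f` lifts to `F : B ⊗ W
→ M`, and `F` extended to `S ⊗ W` gives a lift of `(V, W)_f` with corner `M`. For uniqueness, the
lower corner of any other such lift is again `S ⊗ W`, so only the choice of `F` matters. Put `T =
Hom_Λ(B ⊗ W, M)`. The vanishing of `Ext¹(V, Λ)` lifts the `φ_j` to maps `M → S ⊗ Λ`
(`DerivationsInner.exists_lift`), whence `T = End(M) ∘ F + m T`, and Nakayama gives `T = End(M) ∘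
F`. For a second lifting `F'`, the difference `F' - F` lies in `m T = m End(M) ∘ F`, so `F' = (1 +
e) ∘ F` with `e` in `m End(M)` (`DerivationsInner.exists_endomorphism`). This yields
`Lift.exists_model`, from which the transfer of versality is formal.

Two general facts complete the proof. A versal ring is unique, because an endomorphism of it that
fixes all tangent vectors is bijective. It exists for every finite dimensional module: matrix
representations lifting a given one can be conjugated into a linear slice transverse to the
conjugation orbit, and the equations of a representation on that slice define the ring. -/

open IsLocalRing CategoryTheory

/-! ### Augmentations and local homomorphisms. -/

namespace CLNAlg

variable {k : Type u} [Field k]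

/-- The augmentation `R → k` of an object of `Ĉ`. -/
noncomputable def aug (R : CLNAlg k) : R →ₐ[k] k :=
  ((AlgEquiv.ofBijective (Algebra.ofId k (ResidueField R)) R.residue_bijective).symm :
    ResidueField R →ₐ[k] k).comp (IsScalarTower.toAlgHom k R (ResidueField R))

theorem algebraMap_aug (R : CLNAlg k) (r : R) :
    algebraMap k (ResidueField R) (R.aug r) = residue R r :=
  (AlgEquiv.ofBijective (Algebra.ofId k (ResidueField R)) R.residue_bijective).apply_symm_apply _

theorem aug_eq_zero_iff (R : CLNAlg k) {r : R} : R.aug r = 0 ↔ r ∈ maximalIdeal R := by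
  rw [← residue_eq_zero_iff, ← algebraMap_aug]
  simp

@[simp]
theorem aug_algebraMap (R : CLNAlg k) (c : k) : R.aug (algebraMap k R c) = c :=
  R.aug.commutes c

theorem sub_aug_mem (R : CLNAlg k) (r : R) :
    r - algebraMap k R (R.aug r) ∈ maximalIdeal R := by
  rw [← aug_eq_zero_iff]
  simp

theorem hom_mem {R S : CLNAlg k} (θ : R ⟶ S) {r : R} (h : r ∈ maximalIdeal R) :
    θ.toAlgHom r ∈ maximalIdeal S := by
  rw [mem_maximalIdeal, mem_nonunits_iff] at h ⊢
  exact fun h' => h (θ.isLocalHom.map_nonunit r h')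

theorem hom_mem_pow {R S : CLNAlg k} (θ : R ⟶ S) (n : ℕ) {r : R}
    (h : r ∈ maximalIdeal R ^ n) : θ.toAlgHom r ∈ maximalIdeal S ^ n := by
  have : (maximalIdeal R).map (θ.toAlgHom : (R : Type u) →+* S) ≤ maximalIdeal S :=
    Ideal.map_le_iff_le_comap.2 fun x hx => hom_mem θ hx
  have h' := Ideal.mem_map_of_mem (θ.toAlgHom : (R : Type u) →+* S) h
  rw [Ideal.map_pow] at h'
  exact Ideal.pow_right_mono this n h'

@[simp]
theorem aug_hom {R S : CLNAlg k} (θ : R ⟶ S) (r : R) : S.aug (θ.toAlgHom r) = R.aug r := by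
  have h := (aug_eq_zero_iff S).2 (hom_mem θ (R.sub_aug_mem r))
  rw [map_sub, map_sub, AlgHom.commutes, aug_algebraMap, sub_eq_zero] at h
  exact h

/-- A `k`-algebra homomorphism compatible with the augmentations is a morphism of `Ĉ`. -/
def homOfAug {R S : CLNAlg k} (φ : R →ₐ[k] S) (h : ∀ r, S.aug (φ r) = R.aug r) : R ⟶ S :=
  show Hom R S from ⟨φ, ⟨fun a ha => by
    by_contra h'
    have h1 : R.aug a = 0 := R.aug_eq_zero_iff.2 h'
    rw [← h, aug_eq_zero_iff] at h1
    exact h1 ha⟩⟩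

@[simp]
theorem comp_toAlgHom_apply {R S T : CLNAlg k} (θ : R ⟶ S) (θ' : S ⟶ T) (r : R) :
    Hom.toAlgHom (CategoryTheory.CategoryStruct.comp θ θ') r = θ'.toAlgHom (θ.toAlgHom r) := rfl

theorem hom_ext {R S : CLNAlg k} {θ θ' : R ⟶ S} (h : ∀ r, θ.toAlgHom r = θ'.toAlgHom r) :
    θ = θ' :=
  Hom.ext (AlgHom.ext h)

end CLNAlg

/-! ### Successive approximation, Nakayama's lemma and reductions modulo the maximal ideal. -/

/-- A map on `ι → S` that contracts the `I`-adic distance on a residue class modulo `I` has a fixed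
point in that class. -/
theorem IsAdicComplete.exists_fixedPoint {S : Type*} [CommRing S] (I : Ideal S)
    [IsAdicComplete I S] {ι : Type*} (x₀ : ι → S) (G : (ι → S) → ι → S)
    (hG0 : ∀ x, (∀ i, x i - x₀ i ∈ I) → ∀ i, G x i - x₀ i ∈ I)
    (hG : ∀ n x y, (∀ i, x i - x₀ i ∈ I) → (∀ i, y i - x₀ i ∈ I) → (∀ i, x i - y i ∈ I ^ n) →
      ∀ i, G x i - G y i ∈ I ^ (n + 1)) :
    ∃ x, (∀ i, x i - x₀ i ∈ I) ∧ G x = x := by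
  set f : ℕ → ι → S := fun n => G^[n] x₀ with hf
  have hs : ∀ n, f (n + 1) = G (f n) := fun n => Function.iterate_succ_apply' G n x₀
  have h0 : ∀ n i, f n i - x₀ i ∈ I := by
    intro n
    induction n with
    | zero => intro i; simp [hf]
    | succ n ih => rw [hs]; exact hG0 _ ih
  -- The exponent is `n` and not `n + 1` so that the induction starts with `I ^ 0 = ⊤`, where
  -- nothing has to be shown.
  have h1 : ∀ n i, f (n + 1) i - f n i ∈ I ^ n := by
    intro n
    induction n with
    | zero => intro i; simp
    | succ n ih =>
      intro i
      rw [hs (n + 1)]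
      conv in f (n + 1) i => rw [hs n]
      exact hG n _ _ (h0 _) (h0 _) ih i
  have h2 : ∀ i {a b : ℕ}, a ≤ b → f a i ≡ f b i [SMOD (I ^ a • ⊤ : Submodule S S)] := by
    intro i a b hab
    rw [smul_eq_mul, Ideal.mul_top]
    induction b, hab using Nat.le_induction with
    | base => exact SModEq.rfl
    | succ b hab ih =>
      refine ih.trans (SModEq.symm ?_)
      rw [SModEq.sub_mem]
      exact Ideal.pow_le_pow_right hab (h1 b i)
  choose L hL using fun i => IsPrecomplete.prec (I := I) (M := S) inferInstance
    (f := fun n => f n i) (fun {a b} h => h2 i h)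
  have hL' : ∀ n i, L i - f n i ∈ I ^ n := by
    intro n i
    have := (hL i n).symm
    rwa [smul_eq_mul, Ideal.mul_top, SModEq.sub_mem] at this
  have hL0 : ∀ i, L i - x₀ i ∈ I := by
    intro i
    have := I.add_mem (by simpa using hL' 1 i) (h0 1 i)
    simpa using this
  refine ⟨L, hL0, funext fun i => ?_⟩
  refine (IsHausdorff.eq_iff_smodEq (I := I)).2 fun n => ?_
  rw [smul_eq_mul, Ideal.mul_top, SModEq.sub_mem]
  have e1 := hG n _ _ hL0 (h0 n) (hL' n) i
  have e2 := hL' (n + 1) i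
  rw [hs] at e2
  have := (I ^ (n + 1)).sub_mem e1 e2
  refine Ideal.pow_le_pow_right n.le_succ ?_
  convert this using 1
  ring

/-- Nakayama's lemma: submodule version. -/
theorem IsLocalRing.eq_top_of_sup_smul_top {R M : Type*} [CommRing R] [IsLocalRing R]
    [AddCommGroup M] [Module R M] [Module.Finite R M] (N : Submodule R M)
    (h : N ⊔ maximalIdeal R • (⊤ : Submodule R M) = ⊤) : N = ⊤ :=
  top_le_iff.1 (Submodule.le_of_le_smul_of_le_jacobson_bot Module.Finite.fg_top
    (maximalIdeal_le_jacobson _) h.ge)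

/-- A map `π : M → V` from a module over an object `R` of `Ĉ` to a `k`-vector space that identifies
`V` with `k ⊗[R] M`. -/
structure CLNAlg.IsReduction {k : Type u} [Field k] (R : CLNAlg k) {M V : Type*} [AddCommGroup M]
    [Module R M] [AddCommGroup V] [Module k V] (π : M →+ V) : Prop where
  map_smul : ∀ (r : R) (m : M), π (r • m) = R.aug r • π m
  surjective : Function.Surjective π
  mem_of_eq_zero : ∀ m, π m = 0 → m ∈ maximalIdeal R • (⊤ : Submodule R M)

namespace CLNAlg.IsReduction

section

variable {k : Type u} [Field k] {R : CLNAlg k} {M M' V : Type*} [AddCommGroup M]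
    [Module R M] [AddCommGroup M'] [Module R M'] [AddCommGroup V] [Module k V] {π : M →+ V}
    {π' : M' →+ V}

theorem eq_zero_iff (h : R.IsReduction π) {m : M} :
    π m = 0 ↔ m ∈ maximalIdeal R • (⊤ : Submodule R M) := by
  refine ⟨h.mem_of_eq_zero m, fun hm => ?_⟩
  induction hm using Submodule.smul_induction_on' with
  | smul r hr n _ => rw [h.map_smul, R.aug_eq_zero_iff.2 hr, zero_smul]
  | add x _ y _ hx hy => rw [map_add, hx, hy, add_zero]

/-- The image of `g` meets every class modulo `m M'`, because `π` is already surjective; Nakayama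
does the rest. -/
theorem surjective_of_comp (h : R.IsReduction π) (h' : R.IsReduction π') [Module.Finite R M']
    (g : M →ₗ[R] M') (hg : ∀ m, π' (g m) = π m) : Function.Surjective g := by
  rw [← LinearMap.range_eq_top]
  refine IsLocalRing.eq_top_of_sup_smul_top _ (top_le_iff.1 fun x _ => ?_)
  obtain ⟨m, hm⟩ := h.surjective (π' x)
  rw [← add_sub_cancel (g m) x]
  refine Submodule.add_mem_sup ⟨m, rfl⟩ (h'.mem_of_eq_zero _ ?_)
  rw [map_sub, hg, hm, sub_self]

/-- A linear map between finitely generated modules, the target being free, is bijective if it is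
compatible with the reductions to the same vector space. -/
theorem bijective_of_comp (h : R.IsReduction π) (h' : R.IsReduction π') [Module.Finite R M]
    [Module.Finite R M'] [Module.Free R M'] (g : M →ₗ[R] M') (hg : ∀ m, π' (g m) = π m) :
    Function.Bijective g := by
  have hs := h.surjective_of_comp h' g hg
  -- A section `s` of `g` is compatible with the reductions too, so it is surjective by the same
  -- argument, and `g` is injective.
  obtain ⟨s, hs'⟩ := g.exists_rightInverse_of_surjective (LinearMap.range_eq_top.2 hs)
  have hs'' : ∀ x, g (s x) = x := fun x => LinearMap.congr_fun hs' x
  have := h'.surjective_of_comp h s fun m => by rw [← hg, hs'']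
  refine ⟨fun x y hxy => ?_, hs⟩
  obtain ⟨x, rfl⟩ := this x
  obtain ⟨y, rfl⟩ := this y
  rw [hs'', hs''] at hxy
  rw [hxy]

end

section

variable {k : Type u} [Field k] {R : CLNAlg k} {M V : Type u} [AddCommGroup M]
    [Module R M] [AddCommGroup V] [Module k V] {π : M →+ V}

/-- A reduction as a linear map for the action of `R` through the augmentation. -/
def toLinearMap (h : R.IsReduction π) :
    letI : Module R V := Module.compHom V (R.aug : R →+* k)
    M →ₗ[R] V :=
  letI : Module R V := Module.compHom V (R.aug : R →+* k)
  { π with map_smul' := h.map_smul }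

/-- The isomorphism `M / m M ≃ V` given by a reduction. -/
noncomputable def quotEquiv (h : R.IsReduction π) :
    (M ⧸ (maximalIdeal R • (⊤ : Submodule R M))) ≃+ V :=
  letI : Module R V := Module.compHom V (R.aug : R →+* k)
  ((Submodule.quotEquivOfEq _ (LinearMap.ker h.toLinearMap)
      (by ext m; exact h.eq_zero_iff.symm)).trans
    (h.toLinearMap.quotKerEquivOfSurjective h.surjective)).toAddEquiv

/-- The isomorphism `κ ⊗[R] M ≃ V` given by a reduction. -/
noncomputable def equiv (h : R.IsReduction π) : ResidueField R ⊗[R] M ≃+ V :=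
  (TensorProduct.quotTensorEquivQuotSMul M (maximalIdeal R)).toAddEquiv.trans h.quotEquiv

theorem equiv_tmul (h : R.IsReduction π) (r : R) (m : M) :
    h.equiv (residue R r ⊗ₜ m) = R.aug r • π m := by
  rw [← h.map_smul]
  exact congrArg h.quotEquiv
    (TensorProduct.quotTensorEquivQuotSMul_mk_tmul (maximalIdeal R) r m)

end

end CLNAlg.IsReduction

/-! ### Lifts and maps of lifts over a change of base ring. -/

namespace Lift

section reduction

variable {k : Type u} [Field k] {A : Type u} [Ring A] [Algebra k A]
  {V : Type u} [AddCommGroup V] [Module A V] {R : CLNAlg k}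

/-- The reduction map `M → κ ⊗ M ≃ V` of a lift. -/
noncomputable def proj (L : Lift k A V R) : L.carrier →+ V :=
  (L.reduction : ResidueField R ⊗[R] L.carrier →+ V).comp
    (TensorProduct.mk R (ResidueField R) L.carrier 1).toAddMonoidHom

theorem proj_apply (L : Lift k A V R) (m : L.carrier) :
    L.proj m = L.reduction (1 ⊗ₜ m) := rfl

theorem proj_action (L : Lift k A V R) (a : A) (m : L.carrier) :
    L.proj (L.action a m) = a • L.proj m :=
  L.reduction_action a (1 ⊗ₜ m)

theorem residue_tmul (L : Lift k A V R) (r : R) (m : L.carrier) :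
    residue R r ⊗ₜ[R] m = 1 ⊗ₜ[R] (r • m) := by
  rw [← TensorProduct.smul_tmul]
  congr 1
  rw [Algebra.smul_def, mul_one]
  rfl

theorem proj_surjective (L : Lift k A V R) : Function.Surjective L.proj := by
  intro v
  obtain ⟨x, rfl⟩ := L.reduction.surjective v
  induction x using TensorProduct.induction_on with
  | zero => exact ⟨0, by simp⟩
  | add x y hx hy =>
    obtain ⟨a, ha⟩ := hx
    obtain ⟨b, hb⟩ := hy
    exact ⟨a + b, by rw [map_add, map_add, ha, hb]⟩
  | tmul t m =>
    obtain ⟨r, rfl⟩ := residue_surjective t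
    exact ⟨r • m, by rw [residue_tmul, proj_apply]⟩

theorem proj_eq_zero_iff (L : Lift k A V R) {m : L.carrier} :
    L.proj m = 0 ↔ m ∈ maximalIdeal R • (⊤ : Submodule R L.carrier) := by
  rw [proj_apply, AddEquivClass.map_eq_zero_iff, ← Submodule.Quotient.mk_eq_zero,
    ← TensorProduct.quotTensorEquivQuotSMul_mk_one_tmul]
  exact (TensorProduct.quotTensorEquivQuotSMul L.carrier (maximalIdeal R)).map_eq_zero_iff.symm

/-- Two lifts are isomorphic if and only if there is an isomorphism of modules compatible with
the reduction maps. -/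
theorem isomorphic_iff {L L' : Lift k A V R} : L.Isomorphic L' ↔
    ∃ f : L.carrier ≃ₗ[R] L'.carrier, (∀ a m, f (L.action a m) = L'.action a (f m)) ∧
      ∀ m, L'.proj (f m) = L.proj m := by
  refine exists_congr fun f => and_congr_right fun _ => ⟨fun h m => h (1 ⊗ₜ m), fun h x => ?_⟩
  induction x using TensorProduct.induction_on with
  | zero => simp
  | add x y hx hy => rw [map_add, map_add, map_add, hx, hy]
  | tmul t m =>
    obtain ⟨r, rfl⟩ := residue_surjective t
    rw [residue_tmul, ← proj_apply, ← h]
    rfl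

theorem Isomorphic.symm {L L' : Lift k A V R} (h : L.Isomorphic L') : L'.Isomorphic L := by
  obtain ⟨f, h1, h2⟩ := isomorphic_iff.1 h
  refine isomorphic_iff.2 ⟨f.symm, fun a m => ?_, fun m => ?_⟩
  · rw [LinearEquiv.symm_apply_eq, h1, LinearEquiv.apply_symm_apply]
  · rw [← h2, LinearEquiv.apply_symm_apply]

theorem Isomorphic.trans {L L' L'' : Lift k A V R} (h : L.Isomorphic L')
    (h' : L'.Isomorphic L'') : L.Isomorphic L'' := by
  obtain ⟨f, h1, h2⟩ := isomorphic_iff.1 h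
  obtain ⟨g, h3, h4⟩ := isomorphic_iff.1 h'
  exact isomorphic_iff.2 ⟨f.trans g, fun a m => by simp [h1, h3], fun m => by simp [h2, h4]⟩

variable [Module k V] [IsScalarTower k A V]

theorem proj_smul (L : Lift k A V R) (r : R) (m : L.carrier) :
    L.proj (r • m) = R.aug r • L.proj m := by
  have h1 : L.proj (r • m) = L.proj (algebraMap k R (R.aug r) • m) := by
    rw [proj_apply, proj_apply, ← L.residue_tmul, ← L.residue_tmul, ← R.algebraMap_aug r]
    rw [IsScalarTower.algebraMap_apply k R (ResidueField R)]
    rfl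
  rw [h1, ← L.action_algebraMap, proj_action, algebraMap_smul]

theorem isReduction (L : Lift k A V R) : R.IsReduction L.proj where
  map_smul := L.proj_smul
  surjective := L.proj_surjective
  mem_of_eq_zero _ h := L.proj_eq_zero_iff.1 h

theorem isomorphic_of_hom {L L' : Lift k A V R} (f : L.carrier →ₗ[R] L'.carrier)
    (h1 : ∀ a m, f (L.action a m) = L'.action a (f m)) (h2 : ∀ m, L'.proj (f m) = L.proj m) :
    L.Isomorphic L' :=
  isomorphic_iff.2 ⟨LinearEquiv.ofBijective f
    (L.isReduction.bijective_of_comp L'.isReduction f h2), h1, h2⟩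

/-- The lift given by a free module with an action of `A` and a reduction map. -/
noncomputable abbrev ofProj {M : Type u} [AddCommGroup M] [Module R M] [Module.Free R M]
    [Module.Finite R M] (action : A →+* Module.End R M)
    (action_algebraMap : ∀ (c : k) (m : M), action (algebraMap k A c) m = algebraMap k R c • m)
    (π : M →+ V) (hπ : R.IsReduction π) (hπ' : ∀ a m, π (action a m) = a • π m) :
    Lift k A V R where
  carrier := M
  action := action
  action_algebraMap := action_algebraMap
  reduction := hπ.equiv
  reduction_action a x := by
    induction x using TensorProduct.induction_on with
    | zero => simp
    | add x y hx hy => rw [map_add, map_add, hx, hy, map_add, smul_add]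
    | tmul t m =>
      obtain ⟨r, rfl⟩ := residue_surjective t
      rw [LinearMap.baseChange_tmul, hπ.equiv_tmul, hπ.equiv_tmul, hπ', ← algebraMap_smul A,
        ← algebraMap_smul A, ← mul_smul, ← mul_smul, Algebra.commutes]

theorem ofProj_proj {M : Type u} [AddCommGroup M] [Module R M] [Module.Free R M]
    [Module.Finite R M] (action : A →+* Module.End R M)
    (action_algebraMap : ∀ (c : k) (m : M), action (algebraMap k A c) m = algebraMap k R c • m)
    (π : M →+ V) (hπ : R.IsReduction π) (hπ' : ∀ a m, π (action a m) = a • π m) (m : M) :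
    (ofProj action action_algebraMap π hπ hπ').proj m = π m := by
  refine (hπ.equiv_tmul 1 m).trans ?_
  rw [map_one, one_smul]

end reduction

section overMap

variable {k : Type u} [Field k] {A : Type u} [Ring A] [Algebra k A]
  {V : Type u} [AddCommGroup V] [Module A V] {R S T : CLNAlg k}

/-- The existence of a map of lifts over a morphism `θ : R ⟶ S` that is the identity on `V`. -/
def Over (θ : R ⟶ S) (L : Lift k A V R) (L' : Lift k A V S) : Prop :=
  ∃ f : L.carrier →+ L'.carrier, (∀ (r : R) m, f (r • m) = θ.toAlgHom r • f m) ∧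
    (∀ a m, f (L.action a m) = L'.action a (f m)) ∧ ∀ m, L'.proj (f m) = L.proj m

theorem Over.comp {θ : R ⟶ S} {θ' : S ⟶ T} {L : Lift k A V R} {L' : Lift k A V S}
    {L'' : Lift k A V T} (h : Over θ L L') (h' : Over θ' L' L'') :
    Over (CategoryTheory.CategoryStruct.comp θ θ') L L'' := by
  obtain ⟨f, h1, h2, h3⟩ := h
  obtain ⟨g, h4, h5, h6⟩ := h'
  exact ⟨g.comp f, fun r m => by simp [h1, h4], fun a m => by simp [h2, h5],
    fun m => by simp [h3, h6]⟩

theorem Over.trans_isomorphic {θ : R ⟶ S} {L : Lift k A V R} {L' L'' : Lift k A V S}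
    (h : Over θ L L') (h' : L'.Isomorphic L'') : Over θ L L'' := by
  obtain ⟨f, h1, h2, h3⟩ := h
  obtain ⟨g, h4, h5⟩ := isomorphic_iff.1 h'
  exact ⟨(g : L'.carrier →+ L''.carrier).comp f, fun r m => by simp [h1],
    fun a m => by simp [h2, h4], fun m => by simp [h3, h5]⟩

/-- The map from a lift to its base change, with its universal property. -/
theorem exists_toMap (θ : R ⟶ S) (L : Lift k A V R) : ∃ i : L.carrier →+ (L.map θ).carrier,
    (∀ (r : R) m, i (r • m) = θ.toAlgHom r • i m) ∧
    (∀ a m, i (L.action a m) = (L.map θ).action a (i m)) ∧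
    (∀ m, (L.map θ).proj (i m) = L.proj m) ∧
    Submodule.span S (Set.range i) = ⊤ ∧
    ∀ (N : Type u) [AddCommGroup N] [Module S N] (f : L.carrier →+ N),
      (∀ (r : R) m, f (r • m) = θ.toAlgHom r • f m) →
      ∃ g : (L.map θ).carrier →ₗ[S] N, ∀ m, g (i m) = f m := by
  letI : Algebra R S := θ.toAlgHom.toRingHom.toAlgebra
  have : IsScalarTower k R S :=
    IsScalarTower.of_algebraMap_eq fun c => (θ.toAlgHom.commutes c).symm
  have : IsLocalHom (algebraMap R S) := θ.isLocalHom
  refine ⟨(TensorProduct.mk R S L.carrier 1).toAddMonoidHom, fun r m => ?_, fun a m => rfl,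
    fun m => ?_, ?_, fun N _ _ f hf => ?_⟩
  · change (1 : S) ⊗ₜ[R] (r • m) = (θ.toAlgHom r) • ((1 : S) ⊗ₜ[R] m)
    rw [TensorProduct.smul_tmul', ← TensorProduct.smul_tmul]
    rfl
  · change L.reduction ((cancelResidue (k := k) S L.carrier S.residue_bijective)
      (1 ⊗ₜ[S] ((1 : S) ⊗ₜ[R] m))) = L.reduction (1 ⊗ₜ m)
    congr 1
    refine (congrArg (TensorProduct.congr (residueEquiv (k := k) S R S.residue_bijective).symm
      (LinearEquiv.refl R L.carrier)) (TensorProduct.AlgebraTensorModule.cancelBaseChange_tmul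
        (R := R) (A := S) (B := S) (1 : ResidueField S) m (1 : S))).trans ?_
    rw [TensorProduct.congr_tmul, one_smul]
    congr 1
    rw [LinearEquiv.symm_apply_eq]
    exact (map_one (algebraMap (ResidueField R) (ResidueField S))).symm
  · refine top_le_iff.1 fun x _ => ?_
    change S ⊗[R] L.carrier at x
    change x ∈ Submodule.span S (Set.range fun m => (1 : S) ⊗ₜ[R] m)
    induction x using TensorProduct.induction_on with
    | zero => exact zero_mem _
    | add x y hx hy => exact add_mem (hx trivial) (hy trivial)
    | tmul t m =>
      rw [show t ⊗ₜ[R] m = t • ((1 : S) ⊗ₜ[R] m) by rw [TensorProduct.smul_tmul', smul_eq_mul, mul_one]]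
      exact Submodule.smul_mem _ _ (Submodule.subset_span ⟨m, rfl⟩)
  · letI : Module R N := Module.compHom N (algebraMap R S)
    have : IsScalarTower R S N := ⟨fun r s m => by rw [Algebra.smul_def, mul_smul]; rfl⟩
    let f' : L.carrier →ₗ[R] N := { f with map_smul' := hf }
    refine ⟨LinearMap.liftBaseChange S f', fun m => ?_⟩
    refine (LinearMap.liftBaseChange_tmul ..).trans ?_
    rw [one_smul]
    rfl

theorem over_map (θ : R ⟶ S) (L : Lift k A V R) : Over θ L (L.map θ) := by
  obtain ⟨i, h1, h2, h3, -⟩ := exists_toMap θ L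
  exact ⟨i, h1, h2, h3⟩

variable [Module k V] [IsScalarTower k A V]

/-- This removes the tensor product from the definition of versality. A semilinear map out of `L`
extends to the base change by the universal property, and is then an isomorphism because it is
compatible with the reductions. All later arguments use `Over`. -/
theorem map_isomorphic_iff {θ : R ⟶ S} {L : Lift k A V R} {L' : Lift k A V S} :
    (L.map θ).Isomorphic L' ↔ Over θ L L' := by
  refine ⟨fun h => (over_map θ L).trans_isomorphic h, fun ⟨f, h1, h2, h3⟩ => ?_⟩
  obtain ⟨i, h4, h5, h6, h7, h8⟩ := exists_toMap θ L
  obtain ⟨g, hg⟩ := h8 _ f h1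
  refine isomorphic_of_hom g (fun a x => ?_) (fun x => ?_)
  · have hx : x ∈ Submodule.span S (Set.range i) := h7 ▸ Submodule.mem_top
    induction hx using Submodule.span_induction with
    | zero => simp
    | add x y _ _ hx hy => simp only [map_add, hx, hy]
    | smul s x _ hx => simp only [map_smul, hx]
    | mem x hx =>
      obtain ⟨m, rfl⟩ := hx
      rw [← h5, hg, hg, h2]
  · have hx : x ∈ Submodule.span S (Set.range i) := h7 ▸ Submodule.mem_top
    induction hx using Submodule.span_induction with
    | zero => simp
    | add x y _ _ hx hy => simp only [map_add, hx, hy]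
    | smul s x _ hx => rw [map_smul, proj_smul, proj_smul, hx]
    | mem x hx =>
      obtain ⟨m, rfl⟩ := hx
      rw [h6, hg, h3]

theorem Over.isomorphic {θ : R ⟶ S} {L : Lift k A V R} {L' L'' : Lift k A V S}
    (h : Over θ L L') (h' : Over θ L L'') : L'.Isomorphic L'' :=
  (map_isomorphic_iff.2 h).symm.trans (map_isomorphic_iff.2 h')

end overMap

end Lift

/-! ### Tangent vectors and endomorphisms of complete local algebras. -/

namespace CLNAlg

variable {k : Type u} [Field k]

theorem aug_dualNumber (x : dualNumber k) : (dualNumber k).aug x = (show DualNumber k from x).fst := by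
  change DualNumber k at x
  have h : (dualNumber k).aug (DualNumber.eps : DualNumber k) = 0 := by
    have := congrArg (dualNumber k).aug (DualNumber.eps_mul_eps (R := k))
    have h2 := (map_mul (dualNumber k).aug (DualNumber.eps : DualNumber k)
      (DualNumber.eps : DualNumber k)).symm.trans (this.trans (map_zero _))
    exact mul_self_eq_zero.1 h2
  have h2 : x = algebraMap k (DualNumber k) x.fst + x.snd • (DualNumber.eps : DualNumber k) := by
    ext <;> simp [TrivSqZeroExt.algebraMap_eq_inl]
  calc (dualNumber k).aug x = (dualNumber k).aug
        (algebraMap k (dualNumber k) x.fst + x.snd • (show dualNumber k from DualNumber.eps)) :=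
          congrArg _ h2
    _ = x.fst := by rw [map_add, map_smul, aug_algebraMap]; simp [h]

/-- The tangent vector given by a linear form that vanishes on `1` and on `m ^ 2`. -/
theorem exists_toDualNumber (R : CLNAlg k) (l : R →ₗ[k] k) (h1 : l 1 = 0)
    (h2 : ∀ x ∈ maximalIdeal R ^ 2, l x = 0) :
    ∃ τ : R ⟶ dualNumber k, ∀ r, (show DualNumber k from τ.toAlgHom r).snd = l r := by
  let φ : R →ₗ[k] DualNumber k :=
    { toFun := fun r => TrivSqZeroExt.inl (R.aug r) + TrivSqZeroExt.inr (l r)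
      map_add' := fun r s => by ext <;> simp
      map_smul' := fun c r => by ext <;> simp }
  -- The product of `r - aug r` and `s - aug s` lies in `m ^ 2`, where `l` vanishes; expanding it
  -- gives the Leibniz rule.
  have hl : ∀ r s, l (r * s) = R.aug r * l s + R.aug s * l r := by
    intro r s
    have h3 : l ((r - algebraMap k R (R.aug r)) * (s - algebraMap k R (R.aug s))) = 0 :=
      h2 _ (by rw [pow_two]; exact Ideal.mul_mem_mul (R.sub_aug_mem r) (R.sub_aug_mem s))
    have h4 : (r - algebraMap k R (R.aug r)) * (s - algebraMap k R (R.aug s)) =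
        r * s - R.aug r • s - R.aug s • r + (R.aug r * R.aug s) • (1 : R) := by
      simp only [Algebra.smul_def, map_mul]
      ring
    rw [h4, map_add, map_sub, map_sub, map_smul, map_smul, map_smul, h1, smul_zero] at h3
    simp only [smul_eq_mul] at h3
    linear_combination h3
  let ψ : R →ₐ[k] DualNumber k := AlgHom.ofLinearMap φ
    (by ext <;> simp [φ, h1]) (fun r s => by ext <;> simp [φ, hl, mul_comm])
  have hψ1 : ∀ r, (ψ r).fst = R.aug r := fun r =>
    show (TrivSqZeroExt.inl (R.aug r) + TrivSqZeroExt.inr (l r) : DualNumber k).fst = _ by simp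
  have hψ2 : ∀ r, (ψ r).snd = l r := fun r =>
    show (TrivSqZeroExt.inl (R.aug r) + TrivSqZeroExt.inr (l r) : DualNumber k).snd = _ by simp
  exact ⟨homOfAug (S := dualNumber k) ψ fun r => (aug_dualNumber _).trans (hψ1 r), hψ2⟩

/-- An endomorphism of an object of `Ĉ` that induces the identity on tangent vectors is
bijective. -/
theorem bijective_of_tangent {R : CLNAlg k} (φ : R ⟶ R)
    (h : ∀ τ : R ⟶ dualNumber k, φ ≫ τ = τ) : Function.Bijective φ.toAlgHom := by
  have h1 : ∀ r : R, r - φ.toAlgHom r ∈ maximalIdeal R ^ 2 := by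
    intro r
    by_contra hr
    -- The line `k · 1` is added so that the separating linear form also vanishes at `1`, as a
    -- tangent vector requires. It does not absorb `r - φ r`, whose augmentation is zero.
    have hr' : r - φ.toAlgHom r ∉ Submodule.span k {(1 : R)} ⊔
        (maximalIdeal R ^ 2).restrictScalars k := by
      intro hr'
      obtain ⟨y, hy, z, hz, hyz⟩ := Submodule.mem_sup.1 hr'
      obtain ⟨c, rfl⟩ := Submodule.mem_span_singleton.1 hy
      have hz' : R.aug z = 0 := R.aug_eq_zero_iff.2 (Ideal.pow_le_self two_ne_zero hz)
      have := congrArg R.aug hyz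
      rw [map_add, hz', map_sub, aug_hom, sub_self, add_zero, map_smul, map_one, smul_eq_mul,
        mul_one] at this
      rw [this, zero_smul, zero_add] at hyz
      exact hr (hyz ▸ hz)
    obtain ⟨l, hl, hl'⟩ := Submodule.exists_le_ker_of_notMem hr'
    obtain ⟨τ, hτ⟩ := exists_toDualNumber R l
      (hl' (Submodule.mem_sup_left (Submodule.mem_span_singleton_self 1)))
      (fun x hx => hl' (Submodule.mem_sup_right hx))
    apply hl
    rw [map_sub, ← hτ, ← hτ, ← comp_toAlgHom_apply, h, sub_self]
  -- Being the identity modulo `m ^ 2`, the map `φ` induces the identity on the associated graded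
  -- ring.
  have h2 : ∀ n, ∀ x ∈ maximalIdeal R ^ n, x - φ.toAlgHom x ∈ maximalIdeal R ^ (n + 1) := by
    intro n
    induction n with
    | zero => exact fun x _ => Ideal.pow_le_pow_right (by norm_num) (h1 x)
    | succ n ih =>
      intro x hx
      rw [pow_succ] at hx
      induction hx using Submodule.mul_induction_on' with
      | mem_mul_mem y hy z hz =>
        rw [show y * z - φ.toAlgHom (y * z) = (y - φ.toAlgHom y) * z +
          φ.toAlgHom y * (z - φ.toAlgHom z) by rw [map_mul]; ring]
        refine add_mem ?_ ?_
        · rw [pow_succ]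
          exact Ideal.mul_mem_mul (ih y hy) hz
        · rw [show n + 1 + 1 = n + 2 from rfl, pow_add]
          exact Ideal.mul_mem_mul (hom_mem_pow φ n hy) (h1 z)
      | add x _ y _ hx hy =>
        rw [map_add, add_sub_add_comm]
        exact add_mem hx hy
  refine ⟨(injective_iff_map_eq_zero _).2 fun x hx => ?_, fun y => ?_⟩
  · refine (IsHausdorff.haus (I := maximalIdeal R) (M := R) inferInstance) x fun n => ?_
    rw [smul_eq_mul, Ideal.mul_top, SModEq.sub_mem, sub_zero]
    induction n with
    | zero => simp
    | succ n ih => simpa [hx] using h2 n x ih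
  -- A preimage of `y` is a fixed point of `x ↦ y + (x - φ x)`, which is contracting by `h2`.
  · obtain ⟨x, -, hx⟩ := IsAdicComplete.exists_fixedPoint (maximalIdeal R)
      (fun _ : Unit => y) (fun x i => y + (x i - φ.toAlgHom (x i)))
      (fun x _ i => by
        rw [add_sub_cancel_left]
        exact Ideal.pow_le_self two_ne_zero (h1 _))
      (fun n x z _ _ h i => by
        rw [show y + (x i - φ.toAlgHom (x i)) - (y + (z i - φ.toAlgHom (z i))) =
          x i - z i - φ.toAlgHom (x i - z i) by rw [map_sub]; ring]
        exact h2 n _ (h i))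
    refine ⟨x (), ?_⟩
    have := congrFun hx ()
    linear_combination -this

theorem isIso_of_bijective {R S : CLNAlg k} (θ : R ⟶ S) (h : Function.Bijective θ.toAlgHom) :
    Nonempty (R ≅ S) := by
  let e : R ≃ₐ[k] S := AlgEquiv.ofBijective θ.toAlgHom h
  refine ⟨⟨θ, homOfAug (e.symm : S →ₐ[k] R) fun r => ?_, hom_ext fun r => ?_,
    hom_ext fun r => ?_⟩⟩
  · rw [← aug_hom θ]
    congr 1
    exact e.apply_symm_apply r
  · exact e.symm_apply_apply r
  · exact e.apply_symm_apply r

end CLNAlg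

/-! ### Uniqueness of versal deformation rings. -/

section versal

variable {k : Type u} [Field k] {A : Type u} [Ring A] [Algebra k A]
  {V : Type u} [AddCommGroup V] [Module A V] [Module k V] [IsScalarTower k A V]

theorem isVersalDeformation_iff {R : CLNAlg k} {U : Lift k A V R} : IsVersalDeformation U ↔
    (∀ (S : CLNAlg k) (L : Lift k A V S), ∃ θ : R ⟶ S, Lift.Over θ U L) ∧
    ∀ (L : Lift k A V (CLNAlg.dualNumber k)) (θ θ' : R ⟶ CLNAlg.dualNumber k),
      Lift.Over θ U L → Lift.Over θ' U L → θ = θ' := by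
  simp only [IsVersalDeformation, Lift.map_isomorphic_iff]

/-- A versal deformation ring is unique up to isomorphism. -/
theorem IsVersalDeformationRing.unique {R R' : CLNAlg k} (h : IsVersalDeformationRing k A V R)
    (h' : IsVersalDeformationRing k A V R') : Nonempty (R ≅ R') := by
  obtain ⟨U, hU⟩ := h
  obtain ⟨U', hU'⟩ := h'
  rw [isVersalDeformation_iff] at hU hU'
  obtain ⟨θ, hθ⟩ := hU.1 R' U'
  obtain ⟨θ', hθ'⟩ := hU'.1 R U
  -- Both `(θ ≫ θ') ≫ τ` and `τ` classify the lift `U.map τ` over the dual numbers, so they agree.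
  have h1 := CLNAlg.bijective_of_tangent (θ ≫ θ') fun τ =>
    hU.2 (U.map τ) _ _ ((hθ.comp hθ').comp (Lift.over_map τ U)) (Lift.over_map τ U)
  have h2 := CLNAlg.bijective_of_tangent (θ' ≫ θ) fun τ =>
    hU'.2 (U'.map τ) _ _ ((hθ'.comp hθ).comp (Lift.over_map τ U')) (Lift.over_map τ U')
  refine CLNAlg.isIso_of_bijective θ ⟨?_, ?_⟩
  · exact Function.Injective.of_comp (f := θ'.toAlgHom) h1.1
  · exact Function.Surjective.of_comp (g := θ'.toAlgHom) h2.2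

end versal

/-! ### Power series rings and their quotients as objects of `Ĉ`. -/

theorem MvPowerSeries.ker_constantCoeff_eq_span {σ R : Type*} [CommRing R] [Finite σ] :
    RingHom.ker (MvPowerSeries.constantCoeff (σ := σ) (R := R)) =
      Ideal.span (Set.range MvPowerSeries.X) := by
  classical
  cases nonempty_fintype σ
  refine le_antisymm (fun f hf => ?_) (Ideal.span_le.2 ?_)
  · rw [RingHom.mem_ker] at hf
    -- Each nonconstant monomial is assigned one variable that divides it, and `f` is split into the
    -- parts `g j` with assigned variable `j`. The value `none` serves `d = 0`, since `σ` may be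
    -- empty.
    have hc : ∀ d : σ →₀ ℕ, ∃ j : Option σ, d ≠ 0 → ∃ i, j = some i ∧ d i ≠ 0 := by
      intro d
      by_cases hd : d = 0
      · exact ⟨none, fun h => absurd hd h⟩
      · obtain ⟨i, hi⟩ := Finsupp.ne_iff.1 hd
        exact ⟨some i, fun _ => ⟨i, rfl, hi⟩⟩
    choose c hc using hc
    let g : σ → MvPowerSeries σ R := fun j d =>
      if c d = some j ∧ d ≠ 0 then MvPowerSeries.coeff d f else 0
    have hg : ∀ j d, MvPowerSeries.coeff d (g j) =
      if c d = some j ∧ d ≠ 0 then MvPowerSeries.coeff d f else 0 := fun _ _ => rfl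
    have hfg : f = ∑ j, g j := by
      ext d
      rw [map_sum]
      simp only [hg]
      by_cases hd : d = 0
      · subst hd
        simpa using hf
      · obtain ⟨i, hi, hi'⟩ := hc d hd
        simp [hi, hd]
    rw [hfg]
    refine sum_mem fun j _ => ?_
    have : (MvPowerSeries.X j : MvPowerSeries σ R) ∣ g j := by
      rw [MvPowerSeries.X_dvd_iff]
      intro d hd
      rw [hg]
      split_ifs with h
      · obtain ⟨i, hi, hi'⟩ := hc d h.2
        rw [h.1, Option.some.injEq] at hi
        exact absurd (hi ▸ hd) hi'
      · rfl
    exact Ideal.mem_of_dvd _ this (Ideal.subset_span ⟨j, rfl⟩)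
  · rintro _ ⟨j, rfl⟩
    exact MvPowerSeries.constantCoeff_X j

theorem MvPowerSeries.maximalIdeal_eq_ker {σ k : Type*} [Field k] [Finite σ] :
    maximalIdeal (MvPowerSeries σ k) = RingHom.ker (MvPowerSeries.constantCoeff) := by
  ext f
  rw [mem_maximalIdeal, mem_nonunits_iff, MvPowerSeries.isUnit_iff_constantCoeff,
    RingHom.mem_ker, isUnit_iff_ne_zero, not_not]

/-- A proper quotient of a complete Noetherian local ring is complete. -/
theorem IsAdicComplete.quotient {R : Type*} [CommRing R] [IsLocalRing R] [IsNoetherianRing R]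
    [IsAdicComplete (maximalIdeal R) R] (I : Ideal R) [IsLocalRing (R ⧸ I)] :
    IsAdicComplete (maximalIdeal (R ⧸ I)) (R ⧸ I) where
  prec' f hf := by
    have hm : maximalIdeal (R ⧸ I) = (maximalIdeal R).map (Ideal.Quotient.mk I) := by
      have hs : Function.Surjective (Ideal.Quotient.mk I) := Ideal.Quotient.mk_surjective
      have : IsLocalHom (Ideal.Quotient.mk I) := hs.isLocalHom _
      refine le_antisymm (fun x hx => ?_) ?_
      · obtain ⟨x, rfl⟩ := hs x
        refine Ideal.mem_map_of_mem _ ?_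
        rw [mem_maximalIdeal, mem_nonunits_iff] at hx ⊢
        exact fun h => hx (h.map _)
      · exact Ideal.map_le_iff_le_comap.2 fun x hx => by
          rw [Ideal.mem_comap, mem_maximalIdeal, mem_nonunits_iff]
          exact fun h => hx (isUnit_of_map_unit (Ideal.Quotient.mk I) x h)
    -- A Cauchy sequence in the quotient lifts term by term to a Cauchy sequence in `R`, because
    -- consecutive differences lie in the image of `m ^ n`. The image of the limit is then the limit
    -- sought.
    have hstep : ∀ n (x : R), Ideal.Quotient.mk I x = f n →
        ∃ y, Ideal.Quotient.mk I y = f (n + 1) ∧ y - x ∈ maximalIdeal R ^ n := by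
      intro n x hx
      have h := (hf (Nat.le_succ n)).symm
      rw [smul_eq_mul, Ideal.mul_top, SModEq.sub_mem, hm, ← Ideal.map_pow,
        Ideal.mem_map_iff_of_surjective _ Ideal.Quotient.mk_surjective] at h
      obtain ⟨z, hz, hz'⟩ := h
      exact ⟨x + z, by rw [map_add, hx, hz', add_sub_cancel], by simpa using hz⟩
    obtain ⟨x0, hx0⟩ := Ideal.Quotient.mk_surjective (I := I) (f 0)
    choose! next hn1 hn2 using hstep
    let g : ℕ → R := fun n => Nat.rec x0 (fun n x => next n x) n
    have hg : ∀ n, Ideal.Quotient.mk I (g n) = f n := by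
      intro n
      induction n with
      | zero => exact hx0
      | succ n ih => exact hn1 n _ ih
    have hg' : ∀ {a b : ℕ}, a ≤ b → g a ≡ g b [SMOD (maximalIdeal R ^ a • ⊤ : Submodule R R)] := by
      intro a b hab
      rw [smul_eq_mul, Ideal.mul_top]
      induction b, hab using Nat.le_induction with
      | base => exact SModEq.rfl
      | succ b hab ih =>
        refine ih.trans (SModEq.symm ?_)
        rw [SModEq.sub_mem]
        exact Ideal.pow_le_pow_right hab (hn2 b _ (hg b))
    obtain ⟨L, hL⟩ := IsPrecomplete.prec (I := maximalIdeal R) (M := R) inferInstance hg'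
    refine ⟨Ideal.Quotient.mk I L, fun n => ?_⟩
    have := hL n
    rw [smul_eq_mul, Ideal.mul_top, SModEq.sub_mem] at this ⊢
    rw [← hg, ← map_sub, hm, ← Ideal.map_pow]
    exact Ideal.mem_map_of_mem _ this

namespace CLNAlg

variable {k : Type u} [Field k]

/-- Evaluation converges for the `m`-adic topology on `S` and the discrete topology on `k`, since
the `s j` are topologically nilpotent and finite in number. -/
theorem exists_powerSeries_hom (S : CLNAlg k) {σ : Type} [Finite σ] (s : σ → S)
    (hs : ∀ j, s j ∈ maximalIdeal S) :
    ∃ φ : MvPowerSeries σ k →ₐ[k] S, ∀ j, φ (MvPowerSeries.X j) = s j := by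
  letI : WithIdeal S := ⟨maximalIdeal S⟩
  letI : UniformSpace k := ⊥
  have : DiscreteTopology k := ⟨rfl⟩
  obtain ⟨h1, h2⟩ := (IsAdic.isAdicComplete_iff (R := S) (I := maximalIdeal S) rfl).1 inferInstance
  have he : MvPowerSeries.HasEval s := by
    refine ⟨fun j => WithIdeal.isTopologicallyNilpotent_of_mem (hs j), ?_⟩
    rw [Filter.cofinite_eq_bot]
    exact Filter.tendsto_bot
  have : ContinuousSMul k S := ⟨continuous_prod_of_discrete_left.2 fun c => by
    simp only [Algebra.smul_def]
    exact continuous_const.mul continuous_id⟩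
  exact ⟨MvPowerSeries.aeval he, fun j => by
    rw [← MvPolynomial.coe_X, MvPowerSeries.aeval_coe, MvPolynomial.aeval_X]⟩

/-- Continuity of `φ` need not be assumed: the variables generate the ideal of series without
constant term algebraically, so that ideal dies in `k`. -/
theorem aug_powerSeries_hom {S : CLNAlg k} {σ : Type} [Finite σ] (φ : MvPowerSeries σ k →ₐ[k] S)
    (hφ : ∀ j, φ (MvPowerSeries.X j) ∈ maximalIdeal S) (f : MvPowerSeries σ k) :
    S.aug (φ f) = MvPowerSeries.constantCoeff f := by
  have h : Ideal.span (Set.range (MvPowerSeries.X (σ := σ) (R := k))) ≤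
      RingHom.ker (S.aug.comp φ) := by
    rw [Ideal.span_le]
    rintro _ ⟨j, rfl⟩
    exact S.aug_eq_zero_iff.2 (hφ j)
  have h2 : f - algebraMap k _ (MvPowerSeries.constantCoeff f) ∈
      RingHom.ker (MvPowerSeries.constantCoeff (σ := σ) (R := k)) := by
    rw [RingHom.mem_ker, map_sub, MvPowerSeries.algebraMap_apply]
    simp
  rw [MvPowerSeries.ker_constantCoeff_eq_span] at h2
  have h3 := h h2
  rw [RingHom.mem_ker, map_sub, AlgHom.commutes, sub_eq_zero] at h3
  exact h3

/-- The quotient of a power series ring by a proper ideal as an object of `Ĉ`. -/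
noncomputable def powerSeriesQuotient (t : ℕ) (I : Ideal (MvPowerSeries (Fin t) k))
    (hI : I ≤ RingHom.ker MvPowerSeries.constantCoeff) : CLNAlg k :=
  have : Nontrivial (MvPowerSeries (Fin t) k ⧸ I) := Ideal.Quotient.nontrivial_iff.2 fun h => by
    have : (1 : MvPowerSeries (Fin t) k) ∈ I := h ▸ Submodule.mem_top
    simpa using hI this
  have : IsLocalRing (MvPowerSeries (Fin t) k ⧸ I) :=
    IsLocalRing.of_surjective' (Ideal.Quotient.mk I) Ideal.Quotient.mk_surjective
  have : IsAdicComplete (maximalIdeal (MvPowerSeries (Fin t) k)) (MvPowerSeries (Fin t) k) := by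
    rw [MvPowerSeries.maximalIdeal_eq_ker, MvPowerSeries.ker_constantCoeff_eq_span]
    infer_instance
  have := IsAdicComplete.quotient I
  { carrier := MvPowerSeries (Fin t) k ⧸ I
    residue_bijective := by
      refine ⟨(algebraMap k _).injective, fun y => ?_⟩
      obtain ⟨x, rfl⟩ := residue_surjective y
      obtain ⟨f, rfl⟩ := Ideal.Quotient.mk_surjective x
      refine ⟨MvPowerSeries.constantCoeff f, ?_⟩
      rw [IsScalarTower.algebraMap_apply k (MvPowerSeries (Fin t) k ⧸ I),
        ResidueField.algebraMap_eq, ← sub_eq_zero, ← map_sub, residue_eq_zero_iff,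
        ← Ideal.Quotient.mk_algebraMap, ← map_sub, mem_maximalIdeal, mem_nonunits_iff]
      have : IsLocalHom (Ideal.Quotient.mk I) :=
        (Ideal.Quotient.mk_surjective (I := I)).isLocalHom _
      intro h
      have h := isUnit_of_map_unit (Ideal.Quotient.mk I) _ h
      rw [MvPowerSeries.isUnit_iff_constantCoeff, map_sub, MvPowerSeries.algebraMap_apply] at h
      simp at h }

end CLNAlg

namespace CLNAlg

variable {k : Type u} [Field k] {t : ℕ} {I : Ideal (MvPowerSeries (Fin t) k)}
  {hI : I ≤ RingHom.ker MvPowerSeries.constantCoeff}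

/-- The quotient map from the power series ring to `powerSeriesQuotient`. -/
noncomputable def powerSeriesMk (hI : I ≤ RingHom.ker MvPowerSeries.constantCoeff) :
    MvPowerSeries (Fin t) k →ₐ[k] powerSeriesQuotient t I hI :=
  Ideal.Quotient.mkₐ k I

theorem powerSeriesMk_surjective : Function.Surjective (powerSeriesMk hI) :=
  Ideal.Quotient.mk_surjective

theorem powerSeriesMk_eq_zero_iff {f : MvPowerSeries (Fin t) k} :
    powerSeriesMk hI f = 0 ↔ f ∈ I :=
  Ideal.Quotient.eq_zero_iff_mem

theorem powerSeriesMk_X_mem (j : Fin t) :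
    powerSeriesMk hI (MvPowerSeries.X j) ∈ maximalIdeal (powerSeriesQuotient t I hI) := by
  rw [mem_maximalIdeal, mem_nonunits_iff]
  intro h
  obtain ⟨g, hg⟩ := isUnit_iff_exists_inv.1 h
  obtain ⟨g, rfl⟩ := powerSeriesMk_surjective g
  rw [← map_mul, ← sub_eq_zero, ← map_one (powerSeriesMk hI), ← map_sub,
    powerSeriesMk_eq_zero_iff] at hg
  have := hI hg
  rw [RingHom.mem_ker, map_sub, map_mul, MvPowerSeries.constantCoeff_X] at this
  simp at this

theorem aug_powerSeriesMk (f : MvPowerSeries (Fin t) k) :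
    (powerSeriesQuotient t I hI).aug (powerSeriesMk hI f) = MvPowerSeries.constantCoeff f :=
  aug_powerSeries_hom _ powerSeriesMk_X_mem f

theorem exists_powerSeriesQuotient_hom {S : CLNAlg k} (φ : MvPowerSeries (Fin t) k →ₐ[k] S)
    (hφ : ∀ j, φ (MvPowerSeries.X j) ∈ maximalIdeal S) (h : ∀ f ∈ I, φ f = 0) :
    ∃ θ : powerSeriesQuotient t I hI ⟶ S, ∀ f, θ.toAlgHom (powerSeriesMk hI f) = φ f := by
  let ψ : powerSeriesQuotient t I hI →ₐ[k] S := Ideal.Quotient.liftₐ I φ h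
  have hψ : ∀ f, ψ (powerSeriesMk hI f) = φ f := fun f => Ideal.Quotient.lift_mk I _ _
  refine ⟨homOfAug ψ fun r => ?_, hψ⟩
  obtain ⟨f, rfl⟩ := powerSeriesMk_surjective r
  rw [hψ, aug_powerSeries_hom φ hφ, aug_powerSeriesMk]

theorem DualNumber.mul_of_fst_eq_zero (x y : DualNumber k) (hy : y.fst = 0) :
    x * y = x.fst • y := by
  ext <;> simp [hy]

/-- Again no continuity is involved. A series without constant term is a finite combination of the
variables, and the image of such a series has no constant part, so of each coefficient in the
combination only the constant term counts. -/
theorem powerSeriesQuotient_hom_ext {θ θ' : powerSeriesQuotient t I hI ⟶ dualNumber k}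
    (h : ∀ j, θ.toAlgHom (powerSeriesMk hI (MvPowerSeries.X j)) =
      θ'.toAlgHom (powerSeriesMk hI (MvPowerSeries.X j))) : θ = θ' := by
  refine hom_ext fun r => ?_
  obtain ⟨f, rfl⟩ := powerSeriesMk_surjective r
  have h2 : f - algebraMap k _ (MvPowerSeries.constantCoeff f) ∈
      RingHom.ker (MvPowerSeries.constantCoeff (σ := Fin t) (R := k)) := by
    rw [RingHom.mem_ker, map_sub, MvPowerSeries.algebraMap_apply]
    simp
  rw [MvPowerSeries.ker_constantCoeff_eq_span] at h2
  have key : ∀ x ∈ Ideal.span (Set.range (MvPowerSeries.X (σ := Fin t) (R := k))),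
      θ.toAlgHom (powerSeriesMk hI x) = θ'.toAlgHom (powerSeriesMk hI x) ∧
        MvPowerSeries.constantCoeff x = 0 := by
    intro x hx
    induction hx using Submodule.span_induction with
    | zero => simp
    | add x y _ _ hx hy => simp only [map_add, hx.1, hy.1, hx.2, hy.2, add_zero, and_self]
    | smul a x _ hx =>
      have h3 : ∀ θ'' : powerSeriesQuotient t I hI ⟶ dualNumber k,
          θ''.toAlgHom (powerSeriesMk hI (a • x)) =
            MvPowerSeries.constantCoeff a • θ''.toAlgHom (powerSeriesMk hI x) := by
        intro θ''
        rw [smul_eq_mul, map_mul, map_mul, ← aug_powerSeriesMk (hI := hI) a, ← aug_hom θ'',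
          aug_dualNumber]
        refine DualNumber.mul_of_fst_eq_zero _ _ ?_
        rw [← aug_dualNumber, aug_hom, aug_powerSeriesMk, hx.2]
      exact ⟨by rw [h3, h3, hx.1], by rw [smul_eq_mul, map_mul, hx.2, mul_zero]⟩
    | mem x hx =>
      obtain ⟨j, rfl⟩ := hx
      exact ⟨h j, MvPowerSeries.constantCoeff_X j⟩
  have h3 := (key _ h2).1
  rw [map_sub, map_sub, map_sub, AlgHom.commutes, AlgHom.commutes, AlgHom.commutes] at h3
  exact sub_left_injective h3

end CLNAlg

/-! ### Matrix representations and conjugation by matrices congruent to the identity. -/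

namespace Matrix

variable {ι S : Type*} [CommRing S]

/-- The matrices with entries in an ideal. -/
def EntriesIn (I : Ideal S) (M : Matrix ι ι S) : Prop := ∀ i j, M i j ∈ I

theorem EntriesIn.mul [Fintype ι] {I J : Ideal S} {M N : Matrix ι ι S} (hM : M.EntriesIn I)
    (hN : N.EntriesIn J) : (M * N).EntriesIn (I * J) := fun i j => by
  rw [Matrix.mul_apply]
  exact sum_mem fun l _ => Ideal.mul_mem_mul (hM i l) (hN l j)

theorem EntriesIn.add {I : Ideal S} {M N : Matrix ι ι S} (hM : M.EntriesIn I)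
    (hN : N.EntriesIn I) : (M + N).EntriesIn I := fun i j => add_mem (hM i j) (hN i j)

theorem EntriesIn.sub {I : Ideal S} {M N : Matrix ι ι S} (hM : M.EntriesIn I)
    (hN : N.EntriesIn I) : (M - N).EntriesIn I := fun i j => sub_mem (hM i j) (hN i j)

theorem EntriesIn.neg {I : Ideal S} {M : Matrix ι ι S} (hM : M.EntriesIn I) :
    (-M).EntriesIn I := fun i j => neg_mem (hM i j)

theorem EntriesIn.mono {I J : Ideal S} {M : Matrix ι ι S} (hM : M.EntriesIn I) (h : I ≤ J) :
    M.EntriesIn J := fun i j => h (hM i j)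

theorem entriesIn_sum_smul {I : Ideal S} {κ : Type*} [Fintype κ] {c : κ → S}
    (hc : ∀ q, c q ∈ I) (M : κ → Matrix ι ι S) : (∑ q, c q • M q).EntriesIn I := fun i j => by
  rw [Matrix.sum_apply]
  exact sum_mem fun q _ => Ideal.mul_mem_right _ _ (hc q)

end Matrix

section conjugation

open Matrix

variable {k : Type u} [Field k] {A : Type u} [Ring A] [Algebra k A]
  {ι : Type} [Fintype ι] [DecidableEq ι]

/-- If the maps `τ j` span a complement of the inner derivations in `Hom(A, M_n(k))`, then every
matrix representation that lifts `ρ₀` is conjugate to one in the corresponding slice. -/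
theorem exists_conj_slice [Module.Finite k A] (S : CLNAlg k) (ρ₀ : A →ₐ[k] Matrix ι ι k)
    (ρ : A →ₐ[k] Matrix ι ι S) (hρ : ∀ a i j, S.aug (ρ a i j) = ρ₀ a i j)
    {J : Type} [Fintype J] (τ : J → A →ₗ[k] Matrix ι ι k)
    (hτ : ∀ D : A →ₗ[k] Matrix ι ι k, ∃ (e : Matrix ι ι k) (s : J → k),
      ∀ a, D a = ρ₀ a * e - e * ρ₀ a - ∑ j, s j • τ j a) :
    ∃ (g : Matrix ι ι S) (s : J → S), (∀ j, s j ∈ maximalIdeal S) ∧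
      (g - 1).EntriesIn (maximalIdeal S) ∧
      ∀ a, ρ a * g = g * ((ρ₀ a).map (algebraMap k S) +
        ∑ j, s j • (τ j a).map (algebraMap k S)) := by
  classical
  let φ : Matrix ι ι k →ₐ[k] Matrix ι ι S := (Algebra.ofId k S).mapMatrix
  have hφ : ∀ M, φ M = M.map (algebraMap k S) := fun M => rfl
  let β := Module.finBasis k A
  -- The maps `E q` form a basis of `Hom_k(A, M_n(k))`. Decomposing each of them as an inner part
  -- plus a combination of the `τ j` gives coordinates `c` that encode a matrix `ec c` and
  -- parameters `sc c` simultaneously.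
  let E : (Fin (Module.finrank k A) × ι × ι) → A →ₗ[k] Matrix ι ι k := fun q =>
    (β.coord q.1).smulRight (Matrix.single q.2.1 q.2.2 1)
  have hE : ∀ q a, E q a = β.repr a q.1 • Matrix.single q.2.1 q.2.2 1 := fun q a => rfl
  choose e s hes using fun q => hτ (E q)
  let ec : ((Fin (Module.finrank k A) × ι × ι) → S) → Matrix ι ι S := fun c =>
    ∑ q, c q • φ (e q)
  let sc : ((Fin (Module.finrank k A) × ι × ι) → S) → J → S := fun c j =>
    ∑ q, c q * algebraMap k S (s q j)
  let T : ((Fin (Module.finrank k A) × ι × ι) → S) → A → Matrix ι ι S := fun c a =>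
    ∑ j, sc c j • φ (τ j a)
  let δ : A → Matrix ι ι S := fun a => ρ a - φ (ρ₀ a)
  have hδ : ∀ a, (δ a).EntriesIn (maximalIdeal S) := by
    intro a i j
    rw [← S.aug_eq_zero_iff]
    change S.aug (ρ a i j - algebraMap k S (ρ₀ a i j)) = 0
    rw [map_sub, hρ, CLNAlg.aug_algebraMap, sub_self]
  -- With `g = 1 + e` and `ρ = ρ₀ + δ`, the equation `ρ g = g (ρ₀ + T)` reads `ρ₀ e - e ρ₀ - T = N`,
  -- where `N = -(δ + δ e - e T)`.
  let N : ((Fin (Module.finrank k A) × ι × ι) → S) → A → Matrix ι ι S := fun c a =>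
    -(δ a + δ a * ec c - ec c * T c a)
  have hec : ∀ c (K : Ideal S), (∀ q, c q ∈ K) → (ec c).EntriesIn K := fun c K hc =>
    entriesIn_sum_smul hc _
  have hsc : ∀ c (K : Ideal S), (∀ q, c q ∈ K) → ∀ j, sc c j ∈ K := fun c K hc j =>
    sum_mem fun q _ => Ideal.mul_mem_right _ _ (hc q)
  have hT : ∀ c (K : Ideal S), (∀ q, c q ∈ K) → ∀ a, (T c a).EntriesIn K := fun c K hc a =>
    entriesIn_sum_smul (hsc c K hc) _
  have hecsub : ∀ c c', ec c - ec c' = ec (c - c') := by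
    intro c c'
    simp only [ec, ← Finset.sum_sub_distrib, Pi.sub_apply, sub_smul]
  have hscsub : ∀ c c' j, sc c j - sc c' j = sc (c - c') j := by
    intro c c' j
    simp only [sc, ← Finset.sum_sub_distrib, Pi.sub_apply, sub_mul]
  have hTsub : ∀ c c' a, T c a - T c' a = T (c - c') a := by
    intro c c' a
    simp only [T, ← Finset.sum_sub_distrib, ← sub_smul, hscsub]
  -- The left side of that equation is `∑ c_q E_q`, so the equation says that `c` lists the
  -- coordinates of `N c`. The right side contracts, because `δ`, `e` and `T` all have entries in
  -- `m`.
  obtain ⟨c, hc0, hc⟩ := IsAdicComplete.exists_fixedPoint (maximalIdeal S)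
    (fun _ : Fin (Module.finrank k A) × ι × ι => (0 : S))
    (fun c q => N c (β q.1) q.2.1 q.2.2)
    (fun c hc q => by
      simp only [sub_zero] at hc ⊢
      refine EntriesIn.neg (((hδ _).add ?_).sub ?_) _ _
      · exact ((hδ _).mul (hec c _ hc)).mono Ideal.mul_le_left
      · exact ((hec c _ hc).mul (hT c _ hc _)).mono Ideal.mul_le_left)
    (fun n c c' hc hc' hcc q => by
      simp only [sub_zero] at hc hc'
      have h : N c (β q.1) - N c' (β q.1) =
          -(δ (β q.1) * (ec c - ec c') - ((ec c - ec c') * T c (β q.1) +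
            ec c' * (T c (β q.1) - T c' (β q.1)))) := by
        simp only [N]
        noncomm_ring
      change (N c (β q.1) - N c' (β q.1)) q.2.1 q.2.2 ∈ _
      rw [h, hecsub, hTsub]
      have e1 : maximalIdeal S * maximalIdeal S ^ n ≤ maximalIdeal S ^ (n + 1) := by
        rw [pow_succ']
      have e2 : maximalIdeal S ^ n * maximalIdeal S ≤ maximalIdeal S ^ (n + 1) := by
        rw [pow_succ]
      refine EntriesIn.neg (EntriesIn.sub ?_ (EntriesIn.add ?_ ?_)) _ _
      · exact ((hδ _).mul (hec _ _ hcc)).mono e1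
      · exact ((hec _ _ hcc).mul (hT c _ hc _)).mono e2
      · exact ((hec c' _ hc').mul (hT _ _ hcc _)).mono e1)
  simp only [sub_zero] at hc0
  refine ⟨1 + ec c, sc c, hsc c _ hc0, by rw [add_sub_cancel_left]; exact hec c _ hc0, ?_⟩
  let Lhs : A →ₗ[k] Matrix ι ι S := LinearMap.mulRight k (1 + ec c) ∘ₗ ρ.toLinearMap
  let Rhs : A →ₗ[k] Matrix ι ι S := LinearMap.mulLeft k (1 + ec c) ∘ₗ
    (φ.toLinearMap ∘ₗ ρ₀.toLinearMap + ∑ j, sc c j • (φ.toLinearMap ∘ₗ τ j))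
  have hR : ∀ a, Rhs a = (1 + ec c) * (φ (ρ₀ a) + T c a) := by
    intro a
    simp [Rhs, T]
  suffices h : Lhs = Rhs from fun a => (LinearMap.congr_fun h a).trans (hR a)
  refine β.ext fun l => ?_
  rw [hR]
  change ρ (β l) * (1 + ec c) = _
  have h1 : ρ (β l) = φ (ρ₀ (β l)) + δ (β l) := (add_sub_cancel _ _).symm
  have h2 : φ (ρ₀ (β l)) * ec c - ec c * φ (ρ₀ (β l)) - T c (β l) = N c (β l) := by
    have h3 : φ (ρ₀ (β l)) * ec c - ec c * φ (ρ₀ (β l)) - T c (β l) =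
        ∑ q, c q • φ (E q (β l)) := by
      have h4 : T c (β l) = ∑ q, c q • ∑ j, algebraMap k S (s q j) • φ (τ j (β l)) := by
        simp only [T, sc, Finset.sum_smul, Finset.smul_sum, smul_smul]
        exact Finset.sum_comm
      rw [h4]
      simp only [ec, Finset.mul_sum, Finset.sum_mul, ← Finset.sum_sub_distrib, hes, map_sub,
        map_mul, map_sum, map_smul, mul_smul_comm, smul_mul_assoc, ← smul_sub, algebraMap_smul]
    rw [h3]
    ext i j
    rw [Matrix.sum_apply]
    -- At `β l` and in the entry `(i, j)`, only the basis map with index `(l, i, j)` contributes.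
    rw [Finset.sum_eq_single (l, i, j)]
    · have := congrFun hc (l, i, j)
      simp only at this
      rw [this, hE]
      simp [hφ]
    · rintro ⟨l', i', j'⟩ - hne
      rw [hE]
      simp only [Module.Basis.repr_self, Matrix.smul_apply, hφ, Matrix.map_apply, smul_eq_mul]
      by_cases hl : l = l'
      · subst hl
        have h0 : Matrix.single i' j' (1 : k) i j = 0 := by
          rw [Matrix.single_apply]
          refine if_neg ?_
          rintro ⟨rfl, rfl⟩
          exact hne rfl
        simp [h0]
      · rw [Finsupp.single_eq_of_ne (Ne.symm hl)]
        simp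
    · simp
  rw [h1]
  have h5 : φ (ρ₀ (β l)) * ec c = N c (β l) + ec c * φ (ρ₀ (β l)) + T c (β l) := by
    rw [← h2]; abel
  rw [mul_add, mul_add, add_mul, add_mul, mul_one, h5]
  simp only [N]
  noncomm_ring

end conjugation

section matrixLift

open Matrix

variable {k : Type u} [Field k] {A : Type u} [Ring A] [Algebra k A]
  {V : Type u} [AddCommGroup V] [Module A V] [Module k V] [IsScalarTower k A V]
  {ι : Type} [Fintype ι]

/-- The reduction map from `ι → S` to a vector space with a basis. -/
noncomputable def piProj (S : CLNAlg k) (b : Module.Basis ι k V) : (ι → S) →+ V where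
  toFun x := ∑ i, S.aug (x i) • b i
  map_zero' := by simp
  map_add' x y := by simp [add_smul, Finset.sum_add_distrib]

theorem piProj_apply (S : CLNAlg k) (b : Module.Basis ι k V) (x : ι → S) :
    piProj S b x = ∑ i, S.aug (x i) • b i := rfl

variable [DecidableEq ι]

/-- The matrix representation of an `A`-module given by a `k`-basis. -/
noncomputable def matRep (A : Type u) [Ring A] [Algebra k A] [Module A V] [IsScalarTower k A V]
    (b : Module.Basis ι k V) : A →ₐ[k] Matrix ι ι k :=
  ((LinearMap.toMatrixAlgEquiv b : (V →ₗ[k] V) →ₐ[k] Matrix ι ι k)).comp (Algebra.lsmul k k V)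

theorem smul_basis_eq (b : Module.Basis ι k V) (a : A) (j : ι) :
    a • b j = ∑ i, matRep A b a i j • b i := by
  rw [← b.sum_repr (a • b j)]
  refine Finset.sum_congr rfl fun i _ => ?_
  rw [matRep]
  simp [LinearMap.toMatrixAlgEquiv_apply]

theorem piProj_eq_iff (S : CLNAlg k) (b : Module.Basis ι k V) (x y : ι → S) :
    piProj S b x = piProj S b y ↔ ∀ i, S.aug (x i) = S.aug (y i) := by
  rw [piProj_apply, piProj_apply]
  refine ⟨fun h i => ?_, fun h => by simp only [h]⟩
  have := congrArg (fun v => b.repr v i) h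
  simpa [Finsupp.single_apply] using this

theorem piProj_isReduction (S : CLNAlg k) (b : Module.Basis ι k V) :
    S.IsReduction (piProj S b) where
  map_smul r x := by
    simp [piProj_apply, Finset.smul_sum, smul_smul]
  surjective v := ⟨fun i => algebraMap k S (b.repr v i), by simp [piProj_apply, b.sum_repr]⟩
  mem_of_eq_zero x hx := by
    rw [← map_zero (piProj S b), piProj_eq_iff] at hx
    rw [← (Pi.basisFun S ι).sum_repr x]
    refine sum_mem fun i _ => Submodule.smul_mem_smul ?_ trivial
    rw [Pi.basisFun_repr, ← S.aug_eq_zero_iff, hx]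
    simp

theorem piProj_mulVec (S : CLNAlg k) (b : Module.Basis ι k V) (ρ : A →ₐ[k] Matrix ι ι S)
    (hρ : ∀ a i j, S.aug (ρ a i j) = matRep A b a i j) (a : A) (x : ι → S) :
    piProj S b (ρ a *ᵥ x) = a • piProj S b x := by
  rw [piProj_apply, piProj_apply, Finset.smul_sum]
  simp only [smul_comm a, smul_basis_eq b a, Finset.smul_sum, Matrix.mulVec, dotProduct, map_sum,
    map_mul, hρ, Finset.sum_smul, smul_smul, mul_comm]
  exact Finset.sum_comm

/-- The lift given by a representation by matrices. -/
noncomputable abbrev Lift.ofMatrix (S : CLNAlg k) (b : Module.Basis ι k V)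
    (ρ : A →ₐ[k] Matrix ι ι S)
    (hρ : ∀ a i j, S.aug (ρ a i j) = matRep A b a i j) : Lift k A V S :=
  Lift.ofProj (M := ι → S) ((Matrix.toLinAlgEquiv' : Matrix ι ι S ≃ₐ[S] _).toRingHom.comp
    (ρ : A →+* Matrix ι ι S))
    (fun c m => by
      change ρ (algebraMap k A c) *ᵥ m = _
      rw [AlgHom.commutes, IsScalarTower.algebraMap_apply k S, Algebra.algebraMap_eq_smul_one,
        Matrix.smul_mulVec, Matrix.one_mulVec])
    (piProj S b) (piProj_isReduction S b) (fun a m => piProj_mulVec S b ρ hρ a m)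

theorem Lift.ofMatrix_proj (S : CLNAlg k) (b : Module.Basis ι k V)
    (ρ : A →ₐ[k] Matrix ι ι S)
    (hρ : ∀ a i j, S.aug (ρ a i j) = matRep A b a i j) (x : ι → S) :
    (Lift.ofMatrix S b ρ hρ).proj x = piProj S b x :=
  Lift.ofProj_proj ..

/-- Preimages of the basis `b` form a basis of the lift by Nakayama and freeness; in this basis the
action is given by matrices that reduce to those of `V`. -/
theorem Lift.exists_ofMatrix_isomorphic {S : CLNAlg k} (b : Module.Basis ι k V)
    (L : Lift k A V S) : ∃ (ρ : A →ₐ[k] Matrix ι ι S)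
      (hρ : ∀ a i j, S.aug (ρ a i j) = matRep A b a i j),
      (Lift.ofMatrix S b ρ hρ).Isomorphic L := by
  choose e he using fun i => L.proj_surjective (b i)
  let g₀ : (ι → S) →ₗ[S] L.carrier := Fintype.linearCombination S e
  have hg₀ : ∀ x, L.proj (g₀ x) = piProj S b x := by
    intro x
    simp only [g₀, Fintype.linearCombination_apply, map_sum, L.proj_smul, he, piProj_apply]
  let g : (ι → S) ≃ₗ[S] L.carrier := LinearEquiv.ofBijective g₀
    ((piProj_isReduction S b).bijective_of_comp L.isReduction g₀ hg₀)
  have hg : ∀ x, L.proj (g x) = piProj S b x := hg₀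
  let ρ₀ : A →+* Matrix ι ι S := (Matrix.toLinAlgEquiv' : Matrix ι ι S ≃ₐ[S] _).symm.toRingHom.comp
    (g.symm.conjRingEquiv.toRingHom.comp L.action)
  have h1 : ∀ a x, g (ρ₀ a *ᵥ x) = L.action a (g x) := by
    intro a x
    rw [← Matrix.toLin'_apply]
    change g (Matrix.toLinAlgEquiv' (Matrix.toLinAlgEquiv'.symm _) x) = _
    rw [AlgEquiv.apply_symm_apply]
    change g (g.symm _) = _
    rw [g.apply_symm_apply]
    rfl
  let ρ : A →ₐ[k] Matrix ι ι S := { ρ₀ with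
    commutes' := fun c => by
      change ρ₀ (algebraMap k A c) = _
      refine Matrix.ext_of_mulVec_single fun i => g.injective ?_
      have h2 : algebraMap k (Matrix ι ι S) c = algebraMap k S c • 1 := by
        rw [IsScalarTower.algebraMap_apply k S, Algebra.algebraMap_eq_smul_one]
      rw [h1, L.action_algebraMap, h2, Matrix.smul_mulVec, Matrix.one_mulVec, map_smul] }
  have hρ : ∀ a i j, S.aug (ρ a i j) = matRep A b a i j := by
    intro a i j
    have h2 : L.proj (g (ρ a *ᵥ Pi.single j 1)) = L.proj (L.action a (g (Pi.single j 1))) :=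
      congrArg _ (h1 a _)
    rw [L.proj_action, hg, hg] at h2
    have h3 : piProj S b (Pi.single j 1) = b j := by
      rw [piProj_apply, Finset.sum_eq_single j]
      · simp
      · intro i _ hi; simp [hi]
      · simp
    rw [h3, smul_basis_eq, piProj_apply] at h2
    have := congrArg (fun v => b.repr v i) h2
    simpa [Finsupp.single_apply] using this
  exact ⟨ρ, hρ, Lift.isomorphic_of_hom (L := Lift.ofMatrix S b ρ hρ) (g : (ι → S) →ₗ[S] L.carrier)
    (fun a x => h1 a x) fun x => (hg x).trans (Lift.ofMatrix_proj S b ρ hρ x).symm⟩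

variable {R S : CLNAlg k} {b : Module.Basis ι k V} {ρ : A →ₐ[k] Matrix ι ι R}
  {hρ : ∀ a i j, R.aug (ρ a i j) = matRep A b a i j} {ρ' : A →ₐ[k] Matrix ι ι S}
  {hρ' : ∀ a i j, S.aug (ρ' a i j) = matRep A b a i j}

theorem aug_mulVec_of_sub_one (g : Matrix ι ι S) (hg : (g - 1).EntriesIn (maximalIdeal S))
    (x : ι → S) (i : ι) : S.aug ((g *ᵥ x) i) = S.aug (x i) := by
  rw [← sub_eq_zero, ← map_sub, S.aug_eq_zero_iff]
  have : (g *ᵥ x) i - x i = ((g - 1) *ᵥ x) i := by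
    rw [Matrix.sub_mulVec, Matrix.one_mulVec, Pi.sub_apply]
  rw [this]
  exact sum_mem fun j _ => Ideal.mul_mem_right _ _ (hg i j)

/-- Compatibility with the reductions is exactly the condition `g ≡ 1` modulo `m`. Classifying lifts
thus becomes a question about conjugation by such matrices. -/
theorem Lift.over_ofMatrix_iff (θ : R ⟶ S) :
    Lift.Over θ (Lift.ofMatrix R b ρ hρ) (Lift.ofMatrix S b ρ' hρ') ↔
    ∃ g : Matrix ι ι S, (g - 1).EntriesIn (maximalIdeal S) ∧
      ∀ a, g * (ρ a).map θ.toAlgHom = ρ' a * g := by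
  constructor
  · rintro ⟨f, h1, h2, h3⟩
    change (ι → R) →+ (ι → S) at f
    change ∀ (r : R) (m : ι → R), f (r • m) = θ.toAlgHom r • f m at h1
    change ∀ (a : A) (m : ι → R), f (ρ a *ᵥ m) = ρ' a *ᵥ f m at h2
    have h3' : ∀ m : ι → R, piProj S b (f m) = piProj R b m := fun m =>
      (Lift.ofMatrix_proj S b ρ' hρ' (f m)).symm.trans
        ((h3 m).trans (Lift.ofMatrix_proj R b ρ hρ m))
    let g : Matrix ι ι S := Matrix.of fun i j => f (Pi.single j 1) i
    have hg : ∀ x, f x = g *ᵥ (θ.toAlgHom ∘ x) := by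
      intro x
      ext i
      conv_lhs => rw [← (Pi.basisFun R ι).sum_repr x]
      simp only [map_sum, h1, Finset.sum_apply, Pi.smul_apply, Pi.basisFun_repr,
        Pi.basisFun_apply, smul_eq_mul, Matrix.mulVec, dotProduct, g, Matrix.of_apply,
        Function.comp_apply, mul_comm]
    refine ⟨g, fun i j => ?_, fun a => ?_⟩
    · have h4 : piProj S b (f (Pi.single j 1)) = piProj S b (Pi.single j 1) := by
        rw [h3']
        simp only [piProj_apply]
        refine Finset.sum_congr rfl fun l _ => ?_
        by_cases hl : l = j
        · subst hl; simp
        · simp [hl]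
      rw [piProj_eq_iff] at h4
      rw [← S.aug_eq_zero_iff, Matrix.sub_apply, map_sub, sub_eq_zero]
      refine (h4 i).trans ?_
      by_cases hl : i = j
      · subst hl; simp
      · simp [hl]
    · refine Matrix.ext_of_mulVec_single fun j => ?_
      have h4 := h2 a (Pi.single j 1)
      have h5 : (θ.toAlgHom ∘ (Pi.single j 1 : ι → R)) = Pi.single j 1 := by
        ext l
        by_cases hl : l = j
        · subst hl; simp
        · simp [hl]
      rw [hg, hg, h5] at h4
      rw [← Matrix.mulVec_mulVec, ← Matrix.mulVec_mulVec, ← h4]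
      congr 1
      ext l
      simp
  · rintro ⟨g, hg, h⟩
    let f : (ι → R) →+ (ι → S) :=
      { toFun := fun x => g *ᵥ (θ.toAlgHom ∘ x)
        map_zero' := by
          have : (θ.toAlgHom ∘ (0 : ι → R)) = 0 := by ext; simp
          rw [this, Matrix.mulVec_zero]
        map_add' := fun x y => by
          have : (θ.toAlgHom ∘ (x + y)) = θ.toAlgHom ∘ x + θ.toAlgHom ∘ y := by ext; simp
          rw [this, Matrix.mulVec_add] }
    refine ⟨f, fun r (x : ι → R) => ?_, fun a (x : ι → R) => ?_, fun (x : ι → R) => ?_⟩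
    · change g *ᵥ (θ.toAlgHom ∘ (r • x)) = θ.toAlgHom r • (g *ᵥ (θ.toAlgHom ∘ x))
      rw [← Matrix.mulVec_smul]
      congr 1
      ext; simp
    · change g *ᵥ (θ.toAlgHom ∘ (ρ a *ᵥ x)) = ρ' a *ᵥ (g *ᵥ (θ.toAlgHom ∘ x))
      rw [Matrix.mulVec_mulVec, ← h, ← Matrix.mulVec_mulVec]
      congr 1
      ext i
      simp [Matrix.mulVec, dotProduct]
    · refine (Lift.ofMatrix_proj S b ρ' hρ' (f x)).trans
        (Eq.trans ?_ (Lift.ofMatrix_proj R b ρ hρ x).symm)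
      have h4 : ∀ i, S.aug (f x i) = R.aug (x i) := fun i =>
        (aug_mulVec_of_sub_one g hg _ i).trans (CLNAlg.aug_hom θ (x i))
      simp only [piProj_apply, h4]

end matrixLift

/-! ### The linear slice transverse to conjugation and the equations of a representation. -/

section slice

open Matrix

variable {k : Type u} [Field k] {A : Type u} [Ring A] [Algebra k A]
  {ι : Type} [Fintype ι] [DecidableEq ι] (ρ₀ : A →ₐ[k] Matrix ι ι k)
  {J : Type} [Fintype J] (τ : J → A →ₗ[k] Matrix ι ι k)
  {S : Type u} [CommRing S] [Algebra k S] {S' : Type u} [CommRing S'] [Algebra k S']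

/-- The linear map `ρ₀ + ∑ s_j τ_j` over a `k`-algebra `S`. -/
noncomputable def sliceMap (s : J → S) : A →ₗ[k] Matrix ι ι S :=
  ((Algebra.ofId k S).mapMatrix : Matrix ι ι k →ₐ[k] Matrix ι ι S).toLinearMap ∘ₗ ρ₀.toLinearMap +
    ∑ j, s j • (((Algebra.ofId k S).mapMatrix : Matrix ι ι k →ₐ[k] Matrix ι ι S).toLinearMap ∘ₗ τ j)

theorem sliceMap_apply (s : J → S) (a : A) : sliceMap ρ₀ τ s a =
    (ρ₀ a).map (algebraMap k S) + ∑ j, s j • (τ j a).map (algebraMap k S) := by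
  rw [sliceMap, LinearMap.add_apply, LinearMap.sum_apply]
  rfl

theorem sliceMap_apply_apply (s : J → S) (a : A) (i j : ι) : sliceMap ρ₀ τ s a i j =
    algebraMap k S (ρ₀ a i j) + ∑ l, s l * algebraMap k S (τ l a i j) := by
  rw [sliceMap_apply, Matrix.add_apply, Matrix.sum_apply]
  rfl

theorem sliceMap_map (h : S →ₐ[k] S') (s : J → S) (a : A) :
    (sliceMap ρ₀ τ s a).map h = sliceMap ρ₀ τ (fun j => h (s j)) a := by
  ext i j
  rw [Matrix.map_apply, sliceMap_apply_apply, sliceMap_apply_apply]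
  simp

theorem sliceMap_map_eq_mapMatrix (h : S →ₐ[k] S') (s : J → S) (a : A) :
    h.mapMatrix (sliceMap ρ₀ τ s a) = sliceMap ρ₀ τ (fun j => h (s j)) a :=
  sliceMap_map ρ₀ τ h s a

/-- The generic map `ρ₀ + ∑ X_j τ_j` over a power series ring. -/
noncomputable abbrev genericSlice {t : ℕ} (τ : Fin t → A →ₗ[k] Matrix ι ι k) :
    A →ₗ[k] Matrix ι ι (MvPowerSeries (Fin t) k) :=
  sliceMap ρ₀ τ MvPowerSeries.X

/-- The ideal of relations that make the generic `ρ₀ + ∑ X_j τ_j` a representation. -/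
noncomputable def sliceIdeal {t : ℕ} (τ : Fin t → A →ₗ[k] Matrix ι ι k) :
    Ideal (MvPowerSeries (Fin t) k) :=
  Ideal.span ({x | ∃ a b i j, x = (genericSlice ρ₀ τ (a * b) -
      genericSlice ρ₀ τ a * genericSlice ρ₀ τ b) i j} ∪
    {x | ∃ i j, x = (genericSlice ρ₀ τ 1 - 1) i j})

/-- Universal property of the ideal: its generators are the entries of the defects of
multiplicativity and unitality of the generic map, and `h` carries the generic map to the slice map
with parameters `h (X_j)`. -/
theorem sliceIdeal_le_ker_iff {t : ℕ} (τ : Fin t → A →ₗ[k] Matrix ι ι k)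
    (h : MvPowerSeries (Fin t) k →ₐ[k] S) :
    (∀ f ∈ sliceIdeal ρ₀ τ, h f = 0) ↔
    (∀ a b, sliceMap ρ₀ τ (fun j => h (MvPowerSeries.X j)) (a * b) =
      sliceMap ρ₀ τ (fun j => h (MvPowerSeries.X j)) a *
        sliceMap ρ₀ τ (fun j => h (MvPowerSeries.X j)) b) ∧
    sliceMap ρ₀ τ (fun j => h (MvPowerSeries.X j)) 1 = 1 := by
  have h1 : ∀ a b, h.mapMatrix (genericSlice ρ₀ τ (a * b) -
      genericSlice ρ₀ τ a * genericSlice ρ₀ τ b) =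
      sliceMap ρ₀ τ (fun j => h (MvPowerSeries.X j)) (a * b) -
      sliceMap ρ₀ τ (fun j => h (MvPowerSeries.X j)) a *
        sliceMap ρ₀ τ (fun j => h (MvPowerSeries.X j)) b := by
    intro a b
    rw [map_sub, map_mul h.mapMatrix, sliceMap_map_eq_mapMatrix, sliceMap_map_eq_mapMatrix,
      sliceMap_map_eq_mapMatrix]
  have h2 : h.mapMatrix (genericSlice ρ₀ τ 1 - 1) =
      sliceMap ρ₀ τ (fun j => h (MvPowerSeries.X j)) 1 - 1 := by
    rw [map_sub, map_one h.mapMatrix, sliceMap_map_eq_mapMatrix]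
  have h0 : (∀ f ∈ sliceIdeal ρ₀ τ, h f = 0) ↔ sliceIdeal ρ₀ τ ≤ RingHom.ker h := Iff.rfl
  rw [h0, sliceIdeal, Ideal.span_le]
  constructor
  · refine fun hI => ⟨fun a b => ?_, ?_⟩
    · rw [← sub_eq_zero, ← h1]
      ext i j
      exact hI (Or.inl ⟨a, b, i, j, rfl⟩)
    · rw [← sub_eq_zero, ← h2]
      ext i j
      exact hI (Or.inr ⟨i, j, rfl⟩)
  · rintro ⟨h3, h4⟩ x (⟨a, b, i, j, rfl⟩ | ⟨i, j, rfl⟩)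
    · have := h1 a b
      rw [h3, sub_self] at this
      exact congrFun (congrFun this i) j
    · rw [h4, sub_self] at h2
      exact congrFun (congrFun h2 i) j

theorem sliceMap_zero (a : A) : sliceMap ρ₀ τ (0 : J → k) a = ρ₀ a := by
  ext i j
  rw [sliceMap_apply_apply]
  simp

/-- The constant coefficient as a homomorphism of algebras. -/
noncomputable def MvPowerSeries.constantCoeffAlgHom (σ k : Type*) [CommRing k] :
    MvPowerSeries σ k →ₐ[k] k :=
  { MvPowerSeries.constantCoeff with
    commutes' := fun c => by simp [MvPowerSeries.algebraMap_apply] }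

theorem sliceIdeal_le {t : ℕ} (τ : Fin t → A →ₗ[k] Matrix ι ι k) :
    sliceIdeal ρ₀ τ ≤ RingHom.ker MvPowerSeries.constantCoeff := by
  refine (sliceIdeal_le_ker_iff ρ₀ τ (MvPowerSeries.constantCoeffAlgHom (Fin t) k)).2 ?_
  have : (fun j => MvPowerSeries.constantCoeffAlgHom (Fin t) k (MvPowerSeries.X j)) = 0 :=
    funext fun j => MvPowerSeries.constantCoeff_X j
  rw [this]
  simp only [sliceMap_zero, map_mul, map_one, implies_true, and_self]

/-- A basis of a complement of the range of a linear map. -/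
theorem LinearMap.exists_complement_range {K E H : Type*} [Field K] [AddCommGroup E] [Module K E]
    [AddCommGroup H] [Module K H] [Module.Finite K H] (f : E →ₗ[K] H) :
    ∃ (t : ℕ) (τ : Fin t → H), (∀ x : H, ∃ (e : E) (s : Fin t → K), x = f e - ∑ j, s j • τ j) ∧
      ∀ (e : E) (s : Fin t → K), ∑ j, s j • τ j = f e → s = 0 := by
  obtain ⟨T, hT⟩ := (LinearMap.range f).exists_isCompl
  let β := Module.finBasis K T
  refine ⟨_, fun j => (β j : H), fun x => ?_, fun e s h => ?_⟩
  · obtain ⟨_, ⟨e, rfl⟩, y, hy, hxy⟩ := Submodule.mem_sup.1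
      (hT.sup_eq_top ▸ Submodule.mem_top : x ∈ LinearMap.range f ⊔ T)
    refine ⟨e, fun j => - β.repr ⟨y, hy⟩ j, ?_⟩
    have h1 := congrArg (Subtype.val) (β.sum_repr ⟨y, hy⟩)
    simp only [Submodule.coe_sum, Submodule.coe_smul] at h1
    rw [← hxy]
    simp only [neg_smul, Finset.sum_neg_distrib, h1, sub_neg_eq_add]
  · have h1 : ((∑ j, s j • β j : T) : H) = f e := by
      rw [← h]
      simp
    have h2 : ((∑ j, s j • β j : T) : H) = 0 :=
      (Submodule.disjoint_def.1 hT.disjoint) _ (h1 ▸ ⟨e, rfl⟩) (Subtype.prop _)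
    have h3 : ∑ j, s j • β j = 0 := Subtype.ext h2
    exact funext (Fintype.linearIndependent_iff.1 β.linearIndependent s h3)

/-- A complement of the inner derivations, given by a basis. -/
theorem exists_complement_inner [Module.Finite k A] :
    ∃ (t : ℕ) (τ : Fin t → A →ₗ[k] Matrix ι ι k),
    (∀ D : A →ₗ[k] Matrix ι ι k, ∃ (e : Matrix ι ι k) (s : Fin t → k),
      ∀ a, D a = ρ₀ a * e - e * ρ₀ a - ∑ j, s j • τ j a) ∧
    ∀ (e : Matrix ι ι k) (s : Fin t → k),
      (∀ a, ∑ j, s j • τ j a = ρ₀ a * e - e * ρ₀ a) → s = 0 := by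
  let inn : Matrix ι ι k →ₗ[k] (A →ₗ[k] Matrix ι ι k) :=
    { toFun := fun e => LinearMap.mulRight k e ∘ₗ ρ₀.toLinearMap -
        LinearMap.mulLeft k e ∘ₗ ρ₀.toLinearMap
      map_add' := fun e e' => by ext1 a; simp [mul_add, add_mul]; abel
      map_smul' := fun c e => by ext1 a; simp [smul_sub] }
  have hinn : ∀ e a, inn e a = ρ₀ a * e - e * ρ₀ a := fun e a => rfl
  obtain ⟨t, τ, h1, h2⟩ := inn.exists_complement_range
  refine ⟨t, τ, fun D => ?_, fun e s h => h2 e s (LinearMap.ext fun a => ?_)⟩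
  · obtain ⟨e, s, h⟩ := h1 D
    refine ⟨e, s, fun a => ?_⟩
    rw [h]
    simp [hinn]
  · rw [hinn, ← h]
    simp

theorem DualNumber.snd_matrix_mul {k n : Type*} [Field k] [Fintype n] (M N : Matrix n n (DualNumber k))
    (i j : n) :
    ((M * N) i j).snd = ((M.map TrivSqZeroExt.fst) * (N.map TrivSqZeroExt.snd) +
      (M.map TrivSqZeroExt.snd) * (N.map TrivSqZeroExt.fst)) i j := by
  rw [Matrix.add_apply, Matrix.mul_apply, Matrix.mul_apply, Matrix.mul_apply,
    TrivSqZeroExt.snd_sum, ← Finset.sum_add_distrib]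
  refine Finset.sum_congr rfl fun l _ => ?_
  simp [mul_comm]

theorem sliceMap_dualNumber_fst (s : J → DualNumber k) (hs : ∀ j, (s j).fst = 0) (a : A) :
    (sliceMap ρ₀ τ s a).map TrivSqZeroExt.fst = ρ₀ a := by
  ext i j
  rw [Matrix.map_apply, sliceMap_apply_apply]
  simp [TrivSqZeroExt.fst_sum, hs, TrivSqZeroExt.algebraMap_eq_inl]

theorem sliceMap_dualNumber_snd (s : J → DualNumber k) (a : A) :
    (sliceMap ρ₀ τ s a).map TrivSqZeroExt.snd = ∑ j, (s j).snd • τ j a := by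
  ext i j
  rw [Matrix.map_apply, sliceMap_apply_apply, Matrix.sum_apply]
  simp [TrivSqZeroExt.snd_sum, TrivSqZeroExt.algebraMap_eq_inl, mul_comm]

end slice

/-! ### Existence of versal deformation rings. -/

section existence

open Matrix

variable (k : Type u) [Field k] (A : Type u) [Ring A] [Algebra k A] [Module.Finite k A]
  (V : Type u) [AddCommGroup V] [Module A V] [Module k V] [IsScalarTower k A V]

/-- Every finite dimensional module over a finite dimensional algebra has a versal deformation
ring. -/
theorem exists_isVersalDeformationRing [Module.Finite k V] :
    ∃ R : CLNAlg k, IsVersalDeformationRing k A V R := by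
  let b := Module.finBasis k V
  let ρ₀ := matRep A b
  -- The complement is taken in all linear maps `A → M_n(k)` and not only among derivations. The
  -- parameters in excess of `Ext¹(V, V)` are removed by the linear terms of the relations in
  -- `sliceIdeal`.
  obtain ⟨t, τ, hτ, hτ'⟩ := exists_complement_inner ρ₀
  have hI := sliceIdeal_le ρ₀ τ
  let R := CLNAlg.powerSeriesQuotient t (sliceIdeal ρ₀ τ) hI
  let mk := CLNAlg.powerSeriesMk hI
  let X : Fin t → R := fun j => mk (MvPowerSeries.X j)
  have hX := (sliceIdeal_le_ker_iff ρ₀ τ mk).1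
    fun f hf => CLNAlg.powerSeriesMk_eq_zero_iff.2 hf
  let ρ : A →ₐ[k] Matrix _ _ R := AlgHom.ofLinearMap (sliceMap ρ₀ τ X) hX.2 hX.1
  have hρ' : ∀ a, ρ a = sliceMap ρ₀ τ X a := fun a => rfl
  have hXm : ∀ j, R.aug (X j) = 0 := fun j =>
    R.aug_eq_zero_iff.2 (CLNAlg.powerSeriesMk_X_mem j)
  have hρ : ∀ a i j, R.aug (ρ a i j) = matRep A b a i j := by
    intro a i j
    rw [hρ', sliceMap_apply_apply]
    simp [hXm, ρ₀]
  have hmap : ∀ {S : CLNAlg k} (θ : R ⟶ S) a, (ρ a).map θ.toAlgHom =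
      sliceMap ρ₀ τ (fun j => θ.toAlgHom (X j)) a := fun θ a => sliceMap_map ρ₀ τ θ.toAlgHom X a
  refine ⟨R, Lift.ofMatrix R b ρ hρ, isVersalDeformation_iff.2 ⟨fun S L => ?_, fun L θ θ' h h' => ?_⟩⟩
  · obtain ⟨ρ', hρ'', hL⟩ := L.exists_ofMatrix_isomorphic b
    obtain ⟨g, s, hs, hg, hgs⟩ := exists_conj_slice S ρ₀ ρ' hρ'' τ hτ
    simp only [← sliceMap_apply] at hgs
    obtain ⟨φ, hφ⟩ := S.exists_powerSeries_hom s hs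
    -- The matrix `g` reduces to the identity, so its determinant is not in the maximal ideal.
    have hgu : IsUnit g := by
      rw [Matrix.isUnit_iff_isUnit_det]
      by_contra hd
      have h1 : S.aug g.det = 0 := S.aug_eq_zero_iff.2 hd
      have h2 : S.aug.mapMatrix g = 1 := by
        ext i j
        have h3 := S.aug_eq_zero_iff.2 (hg i j)
        rw [Matrix.sub_apply, map_sub, sub_eq_zero] at h3
        refine h3.trans ?_
        by_cases hij : i = j
        · subst hij; simp
        · simp [hij]
      rw [AlgHom.map_det, h2, Matrix.det_one] at h1
      exact one_ne_zero h1
    have hφX : (fun j => φ (MvPowerSeries.X j)) = s := funext hφ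
    -- At the parameters `s` the slice map is the conjugate of `ρ'` by the invertible `g`, hence
    -- itself a representation.
    have hker : ∀ f ∈ sliceIdeal ρ₀ τ, φ f = 0 := by
      rw [sliceIdeal_le_ker_iff, hφX]
      refine ⟨fun a c => hgu.mul_left_cancel ?_, hgu.mul_left_cancel ?_⟩
      · rw [← hgs, map_mul, mul_assoc, hgs, ← mul_assoc, hgs, mul_assoc]
      · rw [← hgs, map_one, one_mul, mul_one]
    obtain ⟨θ, hθ⟩ := CLNAlg.exists_powerSeriesQuotient_hom (hI := hI) φ
      (fun j => by rw [hφ]; exact hs j) hker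
    refine ⟨θ, Lift.Over.trans_isomorphic ((Lift.over_ofMatrix_iff θ).2 ⟨g, hg, fun a => ?_⟩) hL⟩
    have h4 : (fun j => θ.toAlgHom (X j)) = s := funext fun j => (hθ _).trans (hφ j)
    rw [hmap, h4, hgs]
  · let ρ' : A →ₐ[k] Matrix _ _ (CLNAlg.dualNumber k) := θ.toAlgHom.mapMatrix.comp ρ
    have hρ'' : ∀ a i j, (CLNAlg.dualNumber k).aug (ρ' a i j) = matRep A b a i j := fun a i j =>
      (CLNAlg.aug_hom θ _).trans (hρ a i j)
    have h1 : Lift.Over θ (Lift.ofMatrix R b ρ hρ)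
        (Lift.ofMatrix (CLNAlg.dualNumber k) b ρ' hρ'') :=
      (Lift.over_ofMatrix_iff θ).2 ⟨1, fun i j => by simp, fun a => by
        rw [one_mul, mul_one]; rfl⟩
    obtain ⟨g, hg, hgρ⟩ := (Lift.over_ofMatrix_iff θ').1 (h'.trans_isomorphic (h.isomorphic h1))
    have h2 : ∀ a, g * sliceMap ρ₀ τ (fun j => θ'.toAlgHom (X j)) a =
        sliceMap ρ₀ τ (fun j => θ.toAlgHom (X j)) a * g := by
      intro a
      rw [← hmap, ← hmap]
      exact hgρ a
    have hfst : ∀ (θ'' : R ⟶ CLNAlg.dualNumber k) j,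
        (show DualNumber k from θ''.toAlgHom (X j)).fst = 0 := fun θ'' j => by
      rw [← CLNAlg.aug_dualNumber, CLNAlg.aug_hom, hXm]
    let s : Fin t → DualNumber k := fun j => θ.toAlgHom (X j)
    let s' : Fin t → DualNumber k := fun j => θ'.toAlgHom (X j)
    let G : Matrix _ _ (DualNumber k) := g
    have hG : G.map TrivSqZeroExt.fst = 1 := by
      ext i j
      have h3 := (CLNAlg.dualNumber k).aug_eq_zero_iff.2 (hg i j)
      rw [Matrix.sub_apply, map_sub, sub_eq_zero, CLNAlg.aug_dualNumber] at h3
      refine h3.trans ?_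
      by_cases hij : i = j
      · subst hij; simp
      · simp [hij]
    -- Comparing `ε`-coefficients in `h2`, the combination of the `τ j` with coefficients `s' - s`
    -- is the inner derivation given by the `ε`-part of `G`. Transversality forces these
    -- coefficients to vanish.
    have h3 := hτ' (G.map TrivSqZeroExt.snd) (fun j => (s' j).snd - (s j).snd) fun a => by
      have h4 : G * sliceMap ρ₀ τ s' a = sliceMap ρ₀ τ s a * G := h2 a
      have h5 := Matrix.ext fun i j => (DualNumber.snd_matrix_mul G (sliceMap ρ₀ τ s' a) i j).symm.trans
        ((congrArg (fun M => (M i j).snd) h4).trans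
          (DualNumber.snd_matrix_mul (sliceMap ρ₀ τ s a) G i j))
      rw [hG, sliceMap_dualNumber_fst _ _ _ (hfst θ), sliceMap_dualNumber_fst _ _ _ (hfst θ'),
        sliceMap_dualNumber_snd, sliceMap_dualNumber_snd, one_mul, mul_one] at h5
      simp only [sub_smul, Finset.sum_sub_distrib]
      rw [sub_eq_sub_iff_add_eq_add, h5]
    refine CLNAlg.powerSeriesQuotient_hom_ext fun j => ?_
    exact TrivSqZeroExt.ext ((hfst θ j).trans (hfst θ' j).symm)
      (sub_eq_zero.1 (congrFun h3 j)).symm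

end existence

/-! ### Corners of modules -/

/-- The part `e Y` of a module `Y` cut out by the idempotent `e = j 1`, for a homomorphism `j` of
rings that need not preserve the unit. -/
def Corner {C A' : Type*} [Ring C] [Ring A'] (j : C →ₙ+* A') (Y : Type*) [AddCommGroup Y]
    [Module A' Y] : AddSubgroup Y where
  carrier := {y | j 1 • y = y}
  zero_mem' := smul_zero _
  add_mem' {x y} hx hy := by
    change j 1 • (x + y) = x + y
    rw [smul_add, show j 1 • x = x from hx, show j 1 • y = y from hy]
  neg_mem' {x} hx := by
    change j 1 • (-x) = -x
    rw [smul_neg, show j 1 • x = x from hx]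

namespace Corner

variable {C A' : Type*} [Ring C] [Ring A'] {j : C →ₙ+* A'} {Y Z T : Type*} [AddCommGroup Y]
  [Module A' Y] [AddCommGroup Z] [Module A' Z] [AddCommGroup T] [Module A' T]

theorem one_smul_coe (y : Corner j Y) : j 1 • (y : Y) = y := y.2

theorem smul_mem (c : C) (y : Y) : j c • y ∈ Corner j Y := by
  change j 1 • j c • y = j c • y
  rw [← mul_smul, ← map_mul, one_mul]

instance : Module C (Corner j Y) where
  smul c y := ⟨j c • (y : Y), smul_mem c _⟩
  one_smul y := Subtype.ext y.2
  mul_smul c c' y := Subtype.ext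
    (show j (c * c') • (y : Y) = j c • j c' • (y : Y) by rw [map_mul, mul_smul])
  smul_zero c := Subtype.ext (smul_zero (j c))
  smul_add c y z := Subtype.ext (smul_add (j c) (y : Y) z)
  add_smul c c' y := Subtype.ext
    (show j (c + c') • (y : Y) = j c • (y : Y) + j c' • (y : Y) by rw [map_add, add_smul])
  zero_smul y := Subtype.ext (show j 0 • (y : Y) = 0 by rw [map_zero, zero_smul])

theorem coe_smul (c : C) (y : Corner j Y) : ((c • y : Corner j Y) : Y) = j c • (y : Y) := rfl

variable (j) in
/-- The projection of a module to its corner. -/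
def part : Y →+ Corner j Y where
  toFun y := ⟨j 1 • y, smul_mem 1 y⟩
  map_zero' := Subtype.ext (smul_zero _)
  map_add' _ _ := Subtype.ext (smul_add _ _ _)

theorem coe_part (y : Y) : (part j y : Y) = j 1 • y := rfl

theorem part_coe (y : Corner j Y) : part j (y : Y) = y := Subtype.ext y.2

variable (j) in
/-- The map between corners induced by a linear map. -/
def map (g : Y →ₗ[A'] Z) : Corner j Y →ₗ[C] Corner j Z where
  toFun y := ⟨g y, by
    change j 1 • g y = g y
    rw [← map_smul, one_smul_coe]⟩
  map_add' _ _ := Subtype.ext (map_add g _ _)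
  map_smul' c y := Subtype.ext (map_smul g (j c) (y : Y))

theorem map_part (g : Y →ₗ[A'] Z) (y : Y) : map j g (part j y) = part j (g y) :=
  Subtype.ext (map_smul g _ _)

theorem exact_map {g : Y →ₗ[A'] Z} {h : Z →ₗ[A'] T} (H : Function.Exact g h) :
    Function.Exact (map j g) (map j h) := by
  refine fun z => ⟨fun hz => ?_, fun ⟨y, hy⟩ => Subtype.ext ?_⟩
  · obtain ⟨y, hy⟩ := (H (z : Z)).1 (congrArg Subtype.val hz)
    exact ⟨part j y, by rw [map_part, hy, part_coe]⟩
  · exact (H (z : Z)).2 ⟨y, congrArg Subtype.val hy⟩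

end Corner

/-! ### Modules over triangular matrix rings -/

section

variable {A B C : Type u} [Ring A] [Ring C] [AddCommGroup B] [Module A B] [Module Cᵐᵒᵖ B]

namespace TriModHom

variable {V V' W W' : Type u} [AddCommGroup V] [Module A V] [AddCommGroup W] [Module C W]
  [AddCommGroup V'] [Module A V'] [AddCommGroup W'] [Module C W']

instance : Zero (TriModHom A B C V W) := ⟨⟨0, fun _ _ _ => (smul_zero _).symm, fun _ _ _ => rfl⟩⟩

/-- Composition with a homomorphism of the target. -/
def postcomp (f : TriModHom A B C V W) (g : V →ₗ[A] V') : TriModHom A B C V' W where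
  toFun := AddMonoidHom.mk' (fun b => (g : V →+ V').comp (f.toFun b))
    fun b b' => AddMonoidHom.ext fun w => by simp
  map_smul a b w := by
    change g (f.toFun (a • b) w) = a • g (f.toFun b w)
    rw [f.map_smul, _root_.map_smul]
  balanced b c w := congrArg g (f.balanced b c w)

/-- Composition with a homomorphism of the source. -/
def precomp (f : TriModHom A B C V W) (g : W' →ₗ[C] W) : TriModHom A B C V W' where
  toFun := AddMonoidHom.mk' (fun b => (f.toFun b).comp (g : W' →+ W))
    fun b b' => AddMonoidHom.ext fun w => by simp
  map_smul a b w := f.map_smul a b (g w)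
  balanced b c w := (f.balanced b c (g w)).trans (by
    rw [← _root_.map_smul]
    rfl)

theorem postcomp_apply (f : TriModHom A B C V W) (g : V →ₗ[A] V') (b : B) (w : W) :
    (f.postcomp g).toFun b w = g (f.toFun b w) := rfl

theorem precomp_apply (f : TriModHom A B C V W) (g : W' →ₗ[C] W) (b : B) (w : W') :
    (f.precomp g).toFun b w = f.toFun b (g w) := rfl

end TriModHom

/-- The left `C`-module `Hom_A(B, N)`. -/
def HomMod (A B C N : Type u) [Ring A] [Ring C] [AddCommGroup B] [Module A B] [Module Cᵐᵒᵖ B]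
    [AddCommGroup N] [Module A N] : Type u :=
  B →ₗ[A] N

namespace HomMod

variable {N N' W : Type u} [AddCommGroup N] [Module A N] [AddCommGroup N'] [Module A N']
  [AddCommGroup W] [Module C W]

instance : AddCommGroup (HomMod A B C N) := inferInstanceAs (AddCommGroup (B →ₗ[A] N))

/-- A linear map as an element of `Hom_A(B, N)`. -/
def of (φ : B →ₗ[A] N) : HomMod A B C N := φ

/-- An element of `Hom_A(B, N)` as a linear map. -/
def hom (φ : HomMod A B C N) : B →ₗ[A] N := φ

theorem ext {φ ψ : HomMod A B C N} (h : ∀ b, φ.hom b = ψ.hom b) : φ = ψ := LinearMap.ext h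

variable [SMulCommClass A Cᵐᵒᵖ B]

instance : Module C (HomMod A B C N) where
  smul c φ := of
    { toFun := fun b => φ.hom (MulOpposite.op c • b)
      map_add' := fun b b' => by rw [smul_add, map_add]
      map_smul' := fun a b => by rw [← smul_comm, map_smul, RingHom.id_apply] }
  one_smul φ := ext fun b => congrArg φ.hom (one_smul _ b)
  mul_smul c c' φ := ext fun b => congrArg φ.hom (mul_smul (MulOpposite.op c') (MulOpposite.op c) b)
  smul_zero c := rfl
  smul_add _ _ _ := rfl
  add_smul c c' φ := ext fun b => (congrArg φ.hom
    (add_smul (MulOpposite.op c) (MulOpposite.op c') b)).trans (map_add _ _ _)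
  zero_smul φ := ext fun b => (congrArg φ.hom (zero_smul Cᵐᵒᵖ b)).trans (map_zero _)

/-- The evaluation pairing. -/
def eval : TriModHom A B C N (HomMod A B C N) where
  toFun := AddMonoidHom.mk' (fun b => AddMonoidHom.mk' (fun φ : HomMod A B C N => φ.hom b)
    fun _ _ => rfl) fun b b' => AddMonoidHom.ext fun φ => map_add φ.hom b b'
  map_smul a b φ := map_smul φ.hom a b
  balanced _ _ _ := rfl

/-- The homomorphism `W → Hom_A(B, N)` adjoint to `B ⊗_C W → N`. -/
def curry (D : TriModHom A B C N W) : W →ₗ[C] HomMod A B C N where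
  toFun w := of
    { toFun := fun b => D.toFun b w
      map_add' := fun b b' => by rw [map_add, AddMonoidHom.add_apply]
      map_smul' := fun a b => D.map_smul a b w }
  map_add' w w' := ext fun b => map_add (D.toFun b) w w'
  map_smul' c w := ext fun b => (D.balanced b c w).symm

/-- Composition with a homomorphism, on `Hom_A(B, -)`. -/
def map (g : N →ₗ[A] N') : HomMod A B C N →ₗ[C] HomMod A B C N' where
  toFun φ := of (g ∘ₗ φ.hom)
  map_add' _ _ := ext fun _ => map_add g _ _
  map_smul' _ _ := rfl

theorem map_surjective [Module.Projective A B] (g : N →ₗ[A] N') (hg : Function.Surjective g) :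
    Function.Surjective (map g : HomMod A B C N →ₗ[C] HomMod A B C N') := fun φ =>
  let ⟨ψ, hψ⟩ := Module.projective_lifting_property g φ.hom hg
  ⟨of ψ, hψ⟩

end HomMod

/-- If `B` and `W` are projective, then homomorphisms from `B ⊗_C W` lift along surjections. -/
theorem TriModHom.exists_lift [SMulCommClass A Cᵐᵒᵖ B] [Module.Projective A B]
    {N N' W : Type u} [AddCommGroup N] [Module A N] [AddCommGroup N'] [Module A N']
    [AddCommGroup W] [Module C W] [Module.Projective C W] (g : N →ₗ[A] N')
    (hg : Function.Surjective g) (D : TriModHom A B C N' W) :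
    ∃ D' : TriModHom A B C N W, ∀ b w, g (D'.toFun b w) = D.toFun b w := by
  obtain ⟨ψ, hψ⟩ := Module.projective_lifting_property (HomMod.map g) (HomMod.curry D)
    (HomMod.map_surjective g hg)
  exact ⟨HomMod.eval.precomp ψ, fun b w =>
    congrArg (fun φ => HomMod.hom φ b) (LinearMap.congr_fun hψ w)⟩

namespace TriMat

variable [SMulCommClass A Cᵐᵒᵖ B]

variable (A B C) in
/-- The embedding of the upper left corner. -/
def upper : A →ₙ+* TriMat A B C where
  toFun a := ⟨a, 0, 0⟩
  map_mul' _ _ := by ext <;> simp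
  map_zero' := rfl
  map_add' _ _ := by ext <;> simp

variable (A B C) in
/-- The embedding of the lower right corner. -/
def lower : C →ₙ+* TriMat A B C where
  toFun c := ⟨0, 0, c⟩
  map_mul' _ _ := by ext <;> simp
  map_zero' := rfl
  map_add' _ _ := by ext <;> simp

theorem upper_apply (a : A) : upper A B C a = ⟨a, 0, 0⟩ := rfl

theorem lower_apply (c : C) : lower A B C c = ⟨0, 0, c⟩ := rfl

variable (Y : Type u) [AddCommGroup Y] [Module (TriMat A B C) Y]

/-- The structure map `B ⊗_C e₂ Y → e₁ Y` of a module `Y` over a triangular matrix ring. -/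
def offDiag : TriModHom A B C (Corner (upper A B C) Y) (Corner (lower A B C) Y) where
  toFun := AddMonoidHom.mk' (fun b => AddMonoidHom.mk'
      (fun y => (⟨(⟨0, b, 0⟩ : TriMat A B C) • (y : Y), by
        change (⟨1, 0, 0⟩ : TriMat A B C) • _ = _
        rw [← mul_smul]
        congr 1
        ext <;> simp⟩ : Corner (upper A B C) Y))
      fun y z => Subtype.ext (smul_add _ _ _))
    fun b b' => AddMonoidHom.ext fun y => Subtype.ext (by
      change (⟨0, b + b', 0⟩ : TriMat A B C) • (y : Y) =
        (⟨0, b, 0⟩ : TriMat A B C) • (y : Y) + (⟨0, b', 0⟩ : TriMat A B C) • (y : Y)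
      rw [← add_smul]
      congr 1
      ext <;> simp)
  map_smul a b y := Subtype.ext (by
    change (⟨0, a • b, 0⟩ : TriMat A B C) • (y : Y) =
      (⟨a, 0, 0⟩ : TriMat A B C) • (⟨0, b, 0⟩ : TriMat A B C) • (y : Y)
    rw [← mul_smul]
    congr 1
    ext <;> simp)
  balanced b c y := Subtype.ext (by
    change (⟨0, MulOpposite.op c • b, 0⟩ : TriMat A B C) • (y : Y) =
      (⟨0, b, 0⟩ : TriMat A B C) • (⟨0, 0, c⟩ : TriMat A B C) • (y : Y)
    rw [← mul_smul]
    congr 1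
    ext <;> simp)

variable {Y}

theorem coe_offDiag (b : B) (y : Corner (lower A B C) Y) :
    ((offDiag Y).toFun b y : Y) = (⟨0, b, 0⟩ : TriMat A B C) • (y : Y) := rfl

theorem map_offDiag {Z : Type u} [AddCommGroup Z] [Module (TriMat A B C) Z]
    (g : Y →ₗ[TriMat A B C] Z) (b : B) (y : Corner (lower A B C) Y) :
    Corner.map _ g ((offDiag Y).toFun b y) = (offDiag Z).toFun b (Corner.map _ g y) :=
  Subtype.ext (map_smul g _ _)

theorem part_upper_smul (x : TriMat A B C) (y : Y) :
    Corner.part (upper A B C) (x • y) = x.a • Corner.part (upper A B C) y +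
      (offDiag Y).toFun x.b (Corner.part (lower A B C) y) := Subtype.ext (by
  change (⟨1, 0, 0⟩ : TriMat A B C) • x • y = (⟨x.a, 0, 0⟩ : TriMat A B C) •
    (⟨1, 0, 0⟩ : TriMat A B C) • y + (⟨0, x.b, 0⟩ : TriMat A B C) • (⟨0, 0, 1⟩ : TriMat A B C) • y
  rw [← mul_smul, ← mul_smul, ← mul_smul, ← add_smul]
  congr 1
  ext <;> simp)

theorem part_lower_smul (x : TriMat A B C) (y : Y) :
    Corner.part (lower A B C) (x • y) = x.c • Corner.part (lower A B C) y := Subtype.ext (by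
  change (⟨0, 0, 1⟩ : TriMat A B C) • x • y = (⟨0, 0, x.c⟩ : TriMat A B C) •
    (⟨0, 0, 1⟩ : TriMat A B C) • y
  rw [← mul_smul, ← mul_smul]
  congr 1
  ext <;> simp)

theorem part_lower_upper (y : Corner (upper A B C) Y) : Corner.part (lower A B C) (y : Y) = 0 :=
  Subtype.ext (by
    rw [Corner.coe_part, ← Corner.one_smul_coe y, ← mul_smul]
    refine (congrArg (· • (y : Y)) (?_ : _ = (0 : TriMat A B C))).trans (zero_smul _ _)
    ext <;> simp [upper_apply, lower_apply])

theorem part_upper_lower (y : Corner (lower A B C) Y) : Corner.part (upper A B C) (y : Y) = 0 :=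
  Subtype.ext (by
    rw [Corner.coe_part, ← Corner.one_smul_coe y, ← mul_smul]
    refine (congrArg (· • (y : Y)) (?_ : _ = (0 : TriMat A B C))).trans (zero_smul _ _)
    ext <;> simp [upper_apply, lower_apply])

end TriMat

namespace TriMod

open TriMat

variable [SMulCommClass A Cᵐᵒᵖ B]
variable {V V' W W' : Type u} [AddCommGroup V] [Module A V] [AddCommGroup W] [Module C W]
  [AddCommGroup V'] [Module A V'] [AddCommGroup W'] [Module C W']
  {Y : Type u} [AddCommGroup Y] [Module (TriMat A B C) Y]

/-- The homomorphism to `TriMod D` given by compatible maps on the corners. -/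
def lift (D : TriModHom A B C V W) (g₁ : Corner (upper A B C) Y →ₗ[A] V)
    (g₂ : Corner (lower A B C) Y →ₗ[C] W)
    (h : ∀ b y, g₁ ((offDiag Y).toFun b y) = D.toFun b (g₂ y)) :
    Y →ₗ[TriMat A B C] TriMod D where
  toFun y := ((g₁ (Corner.part _ y), g₂ (Corner.part _ y)) : V × W)
  map_add' y z := Prod.ext
    (show g₁ (Corner.part _ (y + z)) = g₁ (Corner.part _ y) + g₁ (Corner.part _ z) by
      rw [map_add, map_add])
    (show g₂ (Corner.part _ (y + z)) = g₂ (Corner.part _ y) + g₂ (Corner.part _ z) by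
      rw [map_add, map_add])
  map_smul' x y := Prod.ext
    (show g₁ (Corner.part _ (x • y)) = x.a • g₁ (Corner.part _ y) +
        D.toFun x.b (g₂ (Corner.part _ y)) by
      rw [part_upper_smul, map_add, map_smul, h])
    (show g₂ (Corner.part _ (x • y)) = x.c • g₂ (Corner.part _ y) by
      rw [part_lower_smul, map_smul])

/-- The first component of a homomorphism to `TriMod D`. -/
def fst {D : TriModHom A B C V W} (q : Y →ₗ[TriMat A B C] TriMod D) :
    Corner (upper A B C) Y →ₗ[A] V where
  toFun y := (q y).1
  map_add' y z := congrArg Prod.fst (map_add q (y : Y) z)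
  map_smul' a y := (congrArg Prod.fst (map_smul q (upper A B C a) (y : Y))).trans
    (show a • (q y).1 + D.toFun 0 (q y).2 = a • (q y).1 by simp)

/-- The second component of a homomorphism to `TriMod D`. -/
def snd {D : TriModHom A B C V W} (q : Y →ₗ[TriMat A B C] TriMod D) :
    Corner (lower A B C) Y →ₗ[C] W where
  toFun y := (q y).2
  map_add' y z := congrArg Prod.snd (map_add q (y : Y) z)
  map_smul' a y := congrArg Prod.snd (map_smul q (lower A B C a) (y : Y))

theorem fst_offDiag {D : TriModHom A B C V W} (q : Y →ₗ[TriMat A B C] TriMod D) (b : B)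
    (y : Corner (lower A B C) Y) : fst q ((offDiag Y).toFun b y) = D.toFun b (snd q y) :=
  (congrArg Prod.fst (map_smul q (⟨0, b, 0⟩ : TriMat A B C) (y : Y))).trans
    (show (0 : A) • (q y).1 + D.toFun b (q y).2 = D.toFun b (q y).2 by simp)

theorem fst_part {D : TriModHom A B C V W} (q : Y →ₗ[TriMat A B C] TriMod D) (y : Y) :
    fst q (Corner.part _ y) = (q y).1 :=
  (congrArg Prod.fst (map_smul q (upper A B C 1) y)).trans
    (show (1 : A) • (q y).1 + D.toFun 0 (q y).2 = (q y).1 by simp)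

theorem snd_part {D : TriModHom A B C V W} (q : Y →ₗ[TriMat A B C] TriMod D) (y : Y) :
    snd q (Corner.part _ y) = (q y).2 :=
  (congrArg Prod.snd (map_smul q (lower A B C 1) y)).trans (one_smul C _)

theorem fst_surjective {D : TriModHom A B C V W} {q : Y →ₗ[TriMat A B C] TriMod D}
    (hq : Function.Surjective q) : Function.Surjective (fst q) := fun v =>
  let ⟨y, hy⟩ := hq ((v, 0) : V × W)
  ⟨Corner.part _ y, by rw [fst_part, hy]⟩

theorem snd_surjective {D : TriModHom A B C V W} {q : Y →ₗ[TriMat A B C] TriMod D}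
    (hq : Function.Surjective q) : Function.Surjective (snd q) := fun w =>
  let ⟨y, hy⟩ := hq ((0, w) : V × W)
  ⟨Corner.part _ y, by rw [snd_part, hy]⟩

theorem exact_fst {D : TriModHom A B C V W} {Z : Type u} [AddCommGroup Z] [Module (TriMat A B C) Z]
    {d : Z →ₗ[TriMat A B C] Y} {q : Y →ₗ[TriMat A B C] TriMod D} (h : Function.Exact d q) :
    Function.Exact (Corner.map (upper A B C) d) (fst q) := by
  refine fun y => ⟨fun hy => ?_, ?_⟩
  · obtain ⟨z, hz⟩ := (h (y : Y)).1 (Prod.ext hy (by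
      rw [← snd_part q, part_lower_upper, map_zero]
      rfl))
    exact ⟨Corner.part _ z, by rw [Corner.map_part, hz, Corner.part_coe]⟩
  · rintro ⟨z, rfl⟩
    exact congrArg Prod.fst (h.apply_apply_eq_zero (z : Z))

theorem exact_snd {D : TriModHom A B C V W} {Z : Type u} [AddCommGroup Z] [Module (TriMat A B C) Z]
    {d : Z →ₗ[TriMat A B C] Y} {q : Y →ₗ[TriMat A B C] TriMod D} (h : Function.Exact d q) :
    Function.Exact (Corner.map (lower A B C) d) (snd q) := by
  refine fun y => ⟨fun hy => ?_, ?_⟩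
  · obtain ⟨z, hz⟩ := (h (y : Y)).1 (Prod.ext (by
      rw [← fst_part q, part_upper_lower, map_zero]
      rfl) hy)
    exact ⟨Corner.part _ z, by rw [Corner.map_part, hz, Corner.part_coe]⟩
  · rintro ⟨z, rfl⟩
    exact congrArg Prod.snd (h.apply_apply_eq_zero (z : Z))

/-- The lifting property of a projective module over a triangular matrix ring, in terms of its
corners. -/
theorem exists_lift [Module.Projective (TriMat A B C) Y] (D : TriModHom A B C V W)
    (D' : TriModHom A B C V' W') (g : V →ₗ[A] V') (h : W →ₗ[C] W') (hg : Function.Surjective g)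
    (hh : Function.Surjective h) (hD : ∀ b w, g (D.toFun b w) = D'.toFun b (h w))
    (r₁ : Corner (upper A B C) Y →ₗ[A] V') (r₂ : Corner (lower A B C) Y →ₗ[C] W')
    (hr : ∀ b y, r₁ ((offDiag Y).toFun b y) = D'.toFun b (r₂ y)) :
    ∃ (q₁ : Corner (upper A B C) Y →ₗ[A] V) (q₂ : Corner (lower A B C) Y →ₗ[C] W),
      (∀ b y, q₁ ((offDiag Y).toFun b y) = D.toFun b (q₂ y)) ∧ (∀ y, g (q₁ y) = r₁ y) ∧
      ∀ y, h (q₂ y) = r₂ y := by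
  let π : TriMod D →ₗ[TriMat A B C] TriMod D' :=
    { toFun := fun p => ((g p.1, h p.2) : V' × W')
      map_add' := fun p q => Prod.ext (map_add g p.1 q.1) (map_add h p.2 q.2)
      map_smul' := fun x p => Prod.ext
        (show g (x.a • p.1 + D.toFun x.b p.2) = x.a • g p.1 + D'.toFun x.b (h p.2) by
          rw [map_add, map_smul, hD])
        (map_smul h x.c p.2) }
  have hπ : Function.Surjective π := fun p => by
    obtain ⟨v, hv⟩ := hg p.1
    obtain ⟨w, hw⟩ := hh p.2
    exact ⟨((v, w) : V × W), Prod.ext hv hw⟩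
  obtain ⟨q, hq⟩ := Module.projective_lifting_property π (lift D' r₁ r₂ hr) hπ
  refine ⟨fst q, snd q, fst_offDiag q, fun y => ?_, fun y => ?_⟩
  · refine (congrArg Prod.fst (LinearMap.congr_fun hq (y : Y))).trans ?_
    exact congrArg r₁ (Corner.part_coe y)
  · refine (congrArg Prod.snd (LinearMap.congr_fun hq (y : Y))).trans ?_
    exact congrArg r₂ (Corner.part_coe y)

/-- A homomorphism `B ⊗_C e₂ Y → H` extends to `e₁ Y` if `Y` is projective. -/
theorem exists_extension [Module.Projective (TriMat A B C) Y]
    (D : TriModHom A B C V (Corner (lower A B C) Y)) :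
    ∃ h : Corner (upper A B C) Y →ₗ[A] V, ∀ b y, h ((offDiag Y).toFun b y) = D.toFun b y := by
  -- The map `(0, id)` from `Y` to the module with corners `0` and `e₂Y` is lifted along `(V, e₂Y)_D
  -- → (0, e₂Y)`; the upper component of the lift is the extension.
  obtain ⟨q₁, q₂, h1, -, h2⟩ := exists_lift D (0 : TriModHom A B C PUnit.{u + 1} _) 0 LinearMap.id
    (fun _ => ⟨0, rfl⟩) Function.surjective_id (fun _ _ => rfl) 0 LinearMap.id (fun _ _ => rfl)
  exact ⟨q₁, fun b y => (h1 b y).trans (congrArg _ (h2 y))⟩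

end TriMod

section

open TriMat

variable [SMulCommClass A Cᵐᵒᵖ B] (Y : Type u) [AddCommGroup Y] [Module (TriMat A B C) Y]

/-- A `C`-module `W` is a triangular module with upper corner zero, so lifting problems for `e₂Y`
are lifting problems for `Y`. -/
theorem TriMat.projective_corner_lower [Module.Projective (TriMat A B C) Y] :
    Module.Projective C (Corner (lower A B C) Y) := by
  refine Module.Projective.of_lifting_property'' fun g hg => ?_
  obtain ⟨-, q₂, -, -, h2⟩ := TriMod.exists_lift (Y := Y) (0 : TriModHom A B C PUnit.{u + 1} _)
    (0 : TriModHom A B C PUnit.{u + 1} _) 0 g (fun _ => ⟨0, rfl⟩) hg (fun _ _ => rfl) 0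
    LinearMap.id (fun _ _ => rfl)
  exact ⟨q₂, LinearMap.ext h2⟩

/-- The functor `Y ↦ e₁Y` has the right adjoint `N ↦ (N, Hom_A(B, N))` with the evaluation map. It
preserves surjections because `B` is projective over `A`, so its left adjoint preserves projectives.
-/
theorem TriMat.projective_corner_upper [Module.Projective A B]
    [Module.Projective (TriMat A B C) Y] : Module.Projective A (Corner (upper A B C) Y) := by
  refine Module.Projective.of_lifting_property'' fun g hg => ?_
  obtain ⟨q₁, -, -, h1, -⟩ := TriMod.exists_lift (Y := Y)
    (HomMod.eval : TriModHom A B C _ _) HomMod.eval g (HomMod.map g) hg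
    (HomMod.map_surjective g hg) (fun _ _ => rfl) LinearMap.id (HomMod.curry (offDiag Y))
    (fun _ _ => rfl)
  exact ⟨q₁, LinearMap.ext h1⟩

/-- The upper row of the triangular matrix ring is `A ⊕ B` as an `A`-module. -/
theorem TriMat.finite_corner_upper [Module.Finite A B] [Module.Finite (TriMat A B C) Y] :
    Module.Finite A (Corner (upper A B C) Y) := by
  obtain ⟨n, π, hπ⟩ := Module.Finite.exists_fin' (TriMat A B C) Y
  let g : (Fin n → A × B) →ₗ[A] Corner (upper A B C) Y :=
    { toFun := fun x => Corner.part _ (π fun i => ⟨(x i).1, (x i).2, 0⟩)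
      map_add' := fun x y => by
        rw [← map_add, ← map_add]
        congr 2
        funext i
        ext <;> simp
      map_smul' := fun a x => by
        have : (fun i => (⟨a • (x i).1, a • (x i).2, 0⟩ : TriMat A B C)) =
            (⟨a, 0, 0⟩ : TriMat A B C) • fun i => (⟨(x i).1, (x i).2, 0⟩ : TriMat A B C) := by
          funext i
          ext <;> simp
        refine (congrArg (fun z => Corner.part _ (π z)) this).trans ?_
        rw [map_smul, part_upper_smul, map_zero, AddMonoidHom.zero_apply, add_zero]
        rfl }
  refine Module.Finite.of_surjective g fun y => ?_
  obtain ⟨x, hx⟩ := hπ (y : Y)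
  refine ⟨fun i => ((x i).a, (x i).b), Subtype.ext ?_⟩
  change upper A B C 1 • π _ = (y : Y)
  rw [← Corner.one_smul_coe y, ← hx, ← map_smul, ← map_smul]
  congr 1
  funext i
  ext <;> simp [upper_apply]

end

end

/-! ### Exact complexes of projectives over a ring of finite global dimension -/

section globalDim

variable {C : Type u} [Ring C] {Q : ℤ → Type u} [∀ i, AddCommGroup (Q i)] [∀ i, Module C (Q i)]
  {d : ∀ i, Q i →ₗ[C] Q (i + 1)}

/-- Dimension shifting: `0 → ker d_i → Q_i → ker d_{i+1} → 0` is exact, so each kernel is a syzygy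
of arbitrarily high order of kernels further to the right. -/
theorem HasFiniteGlobalDim.projective_ker (hC : HasFiniteGlobalDim C)
    (hQ : ∀ i, Module.Projective C (Q i)) (hd : ∀ i, Function.Exact (d i) (d (i + 1))) (i : ℤ) :
    Module.Projective C (LinearMap.ker (d i)) := by
  obtain ⟨N, hN⟩ := hC
  -- The bound says projective dimension at most `N - n`. It improves by one at each step, for all
  -- `i` together, and `n ≤ N` keeps the subtraction honest.
  have key : ∀ n, n ≤ N → ∀ i,
      HasProjectiveDimensionLT (ModuleCat.of C (LinearMap.ker (d i))) (N - n + 1) := by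
    intro n hn
    induction n with
    | zero => exact fun i => hN _
    | succ n ih =>
      intro i
      let π : Q i →ₗ[C] LinearMap.ker (d (i + 1)) :=
        (d i).codRestrict _ fun x => (hd i).apply_apply_eq_zero x
      have hπ : Function.Surjective π := fun y =>
        let ⟨x, hx⟩ := (hd i (y : Q (i + 1))).1 y.2
        ⟨x, Subtype.ext hx⟩
      have hexact : Function.Exact (LinearMap.ker (d i)).subtype π := fun x =>
        ⟨fun hx => ⟨⟨x, congrArg Subtype.val hx⟩, rfl⟩, fun ⟨y, hy⟩ => Subtype.ext (hy ▸ y.2)⟩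
      let S : ShortComplex (ModuleCat.{u} C) := ShortComplex.mk
        (ModuleCat.ofHom (LinearMap.ker (d i)).subtype) (ModuleCat.ofHom π)
        (ModuleCat.hom_ext (LinearMap.ext fun x => hexact.apply_apply_eq_zero x))
      have hS : S.ShortExact := ModuleCat.shortComplex_shortExact S hexact
        (Submodule.injective_subtype _) hπ
      refine hS.hasProjectiveDimensionLT_X₁ _ ?_ ?_
      · have h1 : HasProjectiveDimensionLT S.X₂ 1 :=
          projective_iff_hasProjectiveDimensionLT_one.1
            ((IsProjective.iff_projective (Q i)).1 (hQ i))
        exact hasProjectiveDimensionLT_of_ge S.X₂ 1 _ (by omega)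
      · have := ih (by omega) (i + 1)
        rwa [show N - n + 1 = N - (n + 1) + 1 + 1 by omega] at this
  have := key N le_rfl i
  rw [Nat.sub_self, zero_add] at this
  exact (IsProjective.iff_projective _).2 (projective_iff_hasProjectiveDimensionLT_one.2 this)

/-- All kernels being projective, the complex splits. So `α`, which vanishes on boundaries, factors
through `d (i + 1)` onto a direct summand of the next term. -/
theorem HasFiniteGlobalDim.exists_extension (hC : HasFiniteGlobalDim C)
    (hQ : ∀ i, Module.Projective C (Q i)) (hd : ∀ i, Function.Exact (d i) (d (i + 1))) (i : ℤ)
    {H : Type*} [AddCommGroup H] [Module C H] (α : Q (i + 1) →ₗ[C] H)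
    (hα : ∀ x, α (d i x) = 0) :
    ∃ ψ : Q (i + 1 + 1) →ₗ[C] H, ∀ x, ψ (d (i + 1) x) = α x := by
  have hproj := hC.projective_ker hQ hd
  have hcod : ∀ i, ∃ π : Q i →ₗ[C] LinearMap.ker (d (i + 1)), Function.Surjective π ∧
      ∀ x, (π x : Q (i + 1)) = d i x := fun i =>
    ⟨(d i).codRestrict _ fun x => (hd i).apply_apply_eq_zero x, fun y =>
      let ⟨x, hx⟩ := (hd i (y : Q (i + 1))).1 y.2
      ⟨x, Subtype.ext hx⟩, fun _ => rfl⟩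
  obtain ⟨π, hπ, hπd⟩ := hcod (i + 1)
  obtain ⟨π', hπ', hπd'⟩ := hcod (i + 1 + 1)
  obtain ⟨s, hs⟩ := Module.projective_lifting_property π LinearMap.id hπ
  obtain ⟨s', hs'⟩ := Module.projective_lifting_property π' LinearMap.id hπ'
  have hs1 : ∀ z, π (s z) = z := fun z => LinearMap.congr_fun hs z
  have hs2 : ∀ z, π' (s' z) = z := fun z => LinearMap.congr_fun hs' z
  -- The projection onto the kernel of `d (i + 1 + 1)` that comes from the section `s'`; on the
  -- image of `d (i + 1)` it is the identity.
  let r : Q (i + 1 + 1) →ₗ[C] LinearMap.ker (d (i + 1 + 1)) :=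
    (LinearMap.id - s' ∘ₗ π').codRestrict _ fun x => by
      rw [LinearMap.mem_ker, ← hπd']
      simp [hs2]
  have hr : ∀ z, r (d (i + 1) z) = π z := fun z => Subtype.ext (by
    change d (i + 1) z - s' (π' (d (i + 1) z)) = π z
    have : π' (d (i + 1) z) = 0 := Subtype.ext (by
      rw [hπd']
      exact (hd (i + 1)).apply_apply_eq_zero z)
    rw [this, map_zero, sub_zero, hπd])
  refine ⟨α ∘ₗ s ∘ₗ r, fun x => ?_⟩
  change α (s (r (d (i + 1) x))) = α x
  rw [hr, ← sub_eq_zero, ← map_sub]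
  obtain ⟨y, hy⟩ := (hd i (s (π x) - x)).1 (by
    rw [← hπd, map_sub, hs1, sub_self]
    rfl)
  rw [← hy, hα]

end globalDim

/-! ### Gorenstein-projective modules over triangular matrix rings -/

/-- Every map `Λ → Hom(V, Λ)` satisfying the Leibniz rule is inner; in other words,
`Ext¹(V, Λ)` vanishes. -/
def DerivationsInner (A V : Type*) [Ring A] [AddCommGroup V] [Module A V] : Prop :=
  ∀ δ : A → V →+ A, (∀ a b v, δ (a + b) v = δ a v + δ b v) →
    (∀ a b v, δ (a * b) v = a * δ b v + δ a (b • v)) →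
    ∃ h : V →+ A, ∀ a v, δ a v = a * h v - h (a • v)

/-- The dual basis of a finitely generated projective module. -/
theorem Module.Projective.exists_dual_basis (A P : Type*) [Ring A] [AddCommGroup P] [Module A P]
    [Module.Finite A P] [Module.Projective A P] : ∃ (n : ℕ) (φ : Fin n → P →ₗ[A] A) (z : Fin n → P),
      ∀ y, y = ∑ j, φ j y • z j := by
  obtain ⟨n, π, hπ⟩ := Module.Finite.exists_fin' A P
  obtain ⟨s, hs⟩ := Module.projective_lifting_property π LinearMap.id hπ
  refine ⟨n, fun j => LinearMap.proj j ∘ₗ s, fun j => π (Pi.single j 1), fun y => ?_⟩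
  refine (LinearMap.congr_fun hs y).symm.trans ?_
  change π (s y) = ∑ j, s y j • π (Pi.single j 1)
  conv_lhs => rw [pi_eq_sum_univ' (s y)]
  rw [map_sum]
  refine Finset.sum_congr rfl fun j _ => ?_
  rw [← map_smul]

section

variable {A B C : Type u} [Ring A] [Ring C] [AddCommGroup B] [Module A B] [Module Cᵐᵒᵖ B]
  [SMulCommClass A Cᵐᵒᵖ B]

open TriMat

section complex

variable {P : ℤ → Type u} [∀ i, AddCommGroup (P i)] [∀ i, Module (TriMat A B C) (P i)]
  {d : ∀ i, P i →ₗ[TriMat A B C] P (i + 1)}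

/-- By adjunction `D` is a map `e₂P → Hom_A(B, H)` that kills boundaries, so it extends one step
along the contractible complex `e₂P`. The extended pairing then prolongs from `B ⊗ e₂P` to `e₁P` by
projectivity. -/
theorem TriMat.exists_extension_lower (hC : HasFiniteGlobalDim C)
    (hP : ∀ i, Module.Projective (TriMat A B C) (P i))
    (hd : ∀ i, Function.Exact (d i) (d (i + 1))) (i : ℤ)
    {H : Type u} [AddCommGroup H] [Module A H]
    (D : TriModHom A B C H (Corner (lower A B C) (P (i + 1))))
    (hD : ∀ b y, D.toFun b (Corner.map _ (d i) y) = 0) :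
    ∃ h : Corner (upper A B C) (P (i + 1 + 1)) →ₗ[A] H, ∀ b y,
      h (Corner.map _ (d (i + 1)) ((offDiag _).toFun b y)) = D.toFun b y := by
  obtain ⟨ψ, hψ⟩ := hC.exists_extension (Q := fun i => Corner (lower A B C) (P i))
    (d := fun i => Corner.map _ (d i)) (fun i => projective_corner_lower (P i))
    (fun i => Corner.exact_map (hd i)) i (HomMod.curry D) (fun y => HomMod.ext fun b => hD b y)
  obtain ⟨h, hh⟩ := TriMod.exists_extension (HomMod.eval.precomp ψ)
  refine ⟨h, fun b y => ?_⟩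
  rw [map_offDiag, hh]
  exact congrArg (fun φ => HomMod.hom φ b) (hψ y)

/-- Total acyclicity passes from the triangular ring to the upper corner. A homomorphism from `P` to
the first column of the ring is a map `e₁P → A` that kills `B · e₂P`. Therefore `φ` is first
corrected by a map `h ∘ d` agreeing with it on `B · e₂P`; this part extends trivially, and exactness
of `Hom(P, Σ)` handles the remainder `φ'`. -/
theorem TriMat.exists_extension_upper (hC : HasFiniteGlobalDim C)
    (hP : ∀ i, Module.Projective (TriMat A B C) (P i))
    (hd : ∀ i, Function.Exact (d i) (d (i + 1))) (i : ℤ)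
    (hd' : Function.Exact (fun h : P (i + 1 + 1) →ₗ[TriMat A B C] TriMat A B C => h ∘ₗ d (i + 1))
      (fun g : P (i + 1) →ₗ[TriMat A B C] TriMat A B C => g ∘ₗ d i))
    (φ : Corner (upper A B C) (P (i + 1)) →ₗ[A] A)
    (hφ : ∀ y, φ (Corner.map _ (d i) y) = 0) :
    ∃ χ : Corner (upper A B C) (P (i + 1 + 1)) →ₗ[A] A,
      ∀ y, χ (Corner.map _ (d (i + 1)) y) = φ y := by
  obtain ⟨h, hh⟩ := exists_extension_lower hC hP hd i ((offDiag _).postcomp φ) fun b y => by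
    rw [TriModHom.postcomp_apply, ← map_offDiag, hφ]
  let φ' : Corner (upper A B C) (P (i + 1)) →ₗ[A] A := φ - h ∘ₗ Corner.map _ (d (i + 1))
  have hφ' : ∀ y, φ' y = φ y - h (Corner.map _ (d (i + 1)) y) := fun _ => rfl
  have hb : ∀ b y, φ' ((offDiag _).toFun b y) = 0 := fun b y => by
    rw [hφ', hh, TriModHom.postcomp_apply, sub_self]
  let X : P (i + 1) →ₗ[TriMat A B C] TriMat A B C :=
    { toFun := fun y => ⟨φ' (Corner.part _ y), 0, 0⟩
      map_add' := fun y z => by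
        rw [map_add, map_add]
        ext <;> simp
      map_smul' := fun x y => by
        rw [part_upper_smul, map_add, hb, map_smul]
        ext <;> simp }
  have hX : X ∘ₗ d i = 0 := LinearMap.ext fun y => by
    change (⟨φ' (Corner.part _ (d i y)), 0, 0⟩ : TriMat A B C) = 0
    rw [← Corner.map_part, hφ', hφ, (Corner.exact_map (hd i)).apply_apply_eq_zero, map_zero,
      sub_zero]
    rfl
  obtain ⟨X', hX'⟩ := (hd' X).1 hX
  let χ : Corner (upper A B C) (P (i + 1 + 1)) →ₗ[A] A :=
    { toFun := fun y => (X' y).a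
      map_add' := fun y z => congrArg TriMat.a (map_add X' (y : P (i + 1 + 1)) z)
      map_smul' := fun a y =>
        congrArg TriMat.a (map_smul X' (upper A B C a) (y : P (i + 1 + 1))) }
  refine ⟨χ + h, fun y => ?_⟩
  have h1 : χ (Corner.map _ (d (i + 1)) y) = φ' y := by
    refine (congrArg TriMat.a (LinearMap.congr_fun hX' (y : P (i + 1)))).trans ?_
    exact congrArg φ' (Corner.part_coe y)
  rw [LinearMap.add_apply, h1, hφ', sub_add_cancel]

/-- This computes `Ext¹(V, A) = 0` from the complex `e₁P`. Pulled back along `p` to a projective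
module, `δ` becomes inner through an additive map `η`. The composite `η ∘ d` is `A`-linear and kills
boundaries, so it equals `χ ∘ d`, and `χ - η` descends to `V`. -/
theorem TriMat.derivationsInner_of_exact [Module.Projective A B] [Module.Finite A B]
    (hC : HasFiniteGlobalDim C)
    (hP : ∀ i, Module.Projective (TriMat A B C) (P i))
    (hP' : ∀ i, Module.Finite (TriMat A B C) (P i))
    (hd : ∀ i, Function.Exact (d i) (d (i + 1))) (i : ℤ)
    (hd' : Function.Exact (fun h : P (i + 1 + 1) →ₗ[TriMat A B C] TriMat A B C => h ∘ₗ d (i + 1))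
      (fun g : P (i + 1) →ₗ[TriMat A B C] TriMat A B C => g ∘ₗ d i))
    {V : Type u} [AddCommGroup V] [Module A V]
    (p : Corner (upper A B C) (P (i + 1 + 1)) →ₗ[A] V) (hp : Function.Surjective p)
    (hdp : Function.Exact (Corner.map _ (d (i + 1))) p) : DerivationsInner A V := by
  intro δ hδ hδ'
  have hδ0 : ∀ v, δ 0 v = 0 := fun v => by simpa using hδ 0 0 v
  let δ' (v : V) : A →+ A := ⟨⟨fun a => δ a v, hδ0 v⟩, fun a b => hδ a b v⟩
  have := finite_corner_upper (A := A) (B := B) (C := C) (P (i + 1 + 1))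
  have := projective_corner_upper (A := A) (B := B) (C := C) (P (i + 1 + 1))
  obtain ⟨n, φ, z, hz⟩ := Module.Projective.exists_dual_basis A
    (Corner (upper A B C) (P (i + 1 + 1)))
  -- The sum applies `δ` to the dual basis coefficients; the Leibniz rule turns the failure of `η`
  -- to be linear into `δ a (p y)`.
  let η : Corner (upper A B C) (P (i + 1 + 1)) →+ A :=
    ∑ j, (δ' (p (z j))).comp (φ j : Corner (upper A B C) (P (i + 1 + 1)) →+ A)
  have hη' : ∀ y, η y = ∑ j, δ (φ j y) (p (z j)) := fun y => by
    rw [AddMonoidHom.finsetSum_apply]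
    rfl
  have hη : ∀ a y, η (a • y) = a * η y + δ a (p y) := fun a y => by
    have h1 : δ a (p y) = ∑ j, δ a (φ j y • p (z j)) := by
      conv_lhs => rw [hz y, map_sum, map_sum]
      exact Finset.sum_congr rfl fun j _ => congrArg _ (map_smul p _ _)
    rw [h1, hη', hη', Finset.mul_sum, ← Finset.sum_add_distrib]
    refine Finset.sum_congr rfl fun j _ => ?_
    rw [map_smul, smul_eq_mul, hδ']
  obtain ⟨χ, hχ⟩ := exists_extension_upper hC hP hd i hd'
    { toFun := fun y => η (Corner.map _ (d (i + 1)) y)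
      map_add' := fun y z => by rw [map_add, map_add]
      map_smul' := fun a y => by
        rw [map_smul, hη, hdp.apply_apply_eq_zero, map_zero, add_zero]
        rfl }
    (fun y => (congrArg η ((Corner.exact_map (hd i)).apply_apply_eq_zero y)).trans (map_zero η))
  let g : Corner (upper A B C) (P (i + 1 + 1)) →+ A := (χ : _ →+ A) - η
  have hg' : ∀ y, g y = χ y - η y := fun _ => rfl
  have hg : ∀ y z, p y = p z → g y = g z := fun y z hyz => by
    obtain ⟨x, hx⟩ := (hdp (y - z)).1 (by rw [map_sub, hyz, sub_self])
    rw [← sub_eq_zero, ← map_sub, ← hx, hg', hχ]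
    exact sub_self _
  choose s hs using hp
  refine ⟨⟨⟨fun v => g (s v), ?_⟩, fun v w => ?_⟩, fun a v => ?_⟩
  · rw [hg (s 0) 0 (by rw [hs, map_zero]), map_zero]
  · change g (s (v + w)) = g (s v) + g (s w)
    rw [← map_add]
    exact hg _ _ (by rw [hs, map_add, hs, hs])
  · change δ a v = a * g (s v) - g (s (a • v))
    rw [hg (s (a • v)) (a • s v) (by rw [hs, map_smul, hs]), hg', hg', hη, map_smul, hs,
      smul_eq_mul, mul_sub]
    abel

end complex

/-- The properties of Gorenstein-projective modules over triangular matrix rings on which the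
comparison of deformations depends. -/
theorem IsGorensteinProjective.triMod [Module.Projective A B] [Module.Finite A B]
    (hC : HasFiniteGlobalDim C) {V W : Type u} [AddCommGroup V] [Module A V] [AddCommGroup W]
    [Module C W] {f : TriModHom A B C V W} (hf : IsGorensteinProjective (TriMat A B C) (TriMod f)) :
    Module.Projective C W ∧ DerivationsInner A V ∧
    ∀ D : TriModHom A B C V W, ∃ (n : ℕ) (φ : Fin n → V →ₗ[A] A) (v : Fin n → V),
      ∀ b w, D.toFun b w = ∑ j, φ j (f.toFun b w) • v j := by
  obtain ⟨P, d, hfin, hproj, hd, hd', ⟨e⟩⟩ := hf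
  generalize (0 : ℤ) = i at e
  -- The extension lemmas need one more term to the left of the presentation of `V`.
  obtain ⟨i, rfl⟩ : ∃ j, i = j + 1 := ⟨i - 1, by omega⟩
  let p : P (i + 1 + 1) →ₗ[TriMat A B C] TriMod f :=
    e.toLinearMap ∘ₗ (LinearMap.range (d (i + 1))).mkQ
  have hp : Function.Surjective p :=
    e.surjective.comp (Submodule.mkQ_surjective _)
  have hdp : Function.Exact (d (i + 1)) p := fun y => by
    change e _ = 0 ↔ _
    rw [e.map_eq_zero_iff]
    exact Submodule.Quotient.mk_eq_zero _
  have hp1 := TriMod.fst_surjective hp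
  have hp2 := TriMod.snd_surjective hp
  have hdp1 := TriMod.exact_fst hdp
  have hdp2 := TriMod.exact_snd hdp
  refine ⟨?_, derivationsInner_of_exact hC hproj hfin hd i (hd' i) (TriMod.fst p) hp1 hdp1,
    fun D => ?_⟩
  -- In the lower corner, the cokernel `W` of one differential is the image of the next, which is
  -- the kernel of the one after it.
  · have h1 := hC.projective_ker (Q := fun i => Corner (lower A B C) (P i))
      (d := fun i => Corner.map _ (d i)) (fun i => projective_corner_lower (P i))
      (fun i => Corner.exact_map (hd i)) (i + 1 + 1 + 1)
    have hcod : ∀ y, Corner.map (lower A B C) (d (i + 1 + 1)) y ∈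
        LinearMap.ker (Corner.map (lower A B C) (d (i + 1 + 1 + 1))) := fun y =>
      (Corner.exact_map (hd (i + 1 + 1))).apply_apply_eq_zero y
    let π := (Corner.map (lower A B C) (d (i + 1 + 1))).codRestrict _ hcod
    have hπ : Function.Surjective π := fun y =>
      let ⟨x, hx⟩ := (Corner.exact_map (j := lower A B C) (hd (i + 1 + 1)) y.1).1 y.2
      ⟨x, Subtype.ext hx⟩
    have hker : LinearMap.ker (TriMod.snd p) = LinearMap.ker π := by
      rw [LinearMap.exact_iff.1 hdp2, LinearMap.ker_codRestrict]
      exact (LinearMap.exact_iff.1 (Corner.exact_map (hd (i + 1)))).symm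
    exact Module.Projective.of_equiv ((π.quotKerEquivOfSurjective hπ).symm.trans
      ((Submodule.quotEquivOfEq _ _ hker.symm).trans
        ((TriMod.snd p).quotKerEquivOfSurjective hp2)))
  -- The pullback of `D` to `B ⊗ e₂P` extends to a map `h` on the next term of `e₁P`. A dual basis
  -- of that term expands `h`; its coordinate functions composed with the differential kill
  -- boundaries, so they descend to `V`, and the vectors are the `h (z j)`.
  · obtain ⟨h, hh⟩ := exists_extension_lower hC hproj hd (i + 1) (D.precomp (TriMod.snd p))
      fun b y => by rw [TriModHom.precomp_apply, hdp2.apply_apply_eq_zero, map_zero]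
    have := finite_corner_upper (A := A) (B := B) (C := C) (P (i + 1 + 1 + 1))
    have := projective_corner_upper (A := A) (B := B) (C := C) (P (i + 1 + 1 + 1))
    obtain ⟨n, φ, z, hz⟩ := Module.Projective.exists_dual_basis A
      (Corner (upper A B C) (P (i + 1 + 1 + 1)))
    have hφ : ∀ j, ∃ φ' : V →ₗ[A] A, ∀ y, φ' (TriMod.fst p y) =
        φ j (Corner.map _ (d (i + 1 + 1)) y) := fun j => by
      let ψ := φ j ∘ₗ Corner.map (upper A B C) (d (i + 1 + 1))
      have hψ : LinearMap.ker (TriMod.fst p) ≤ LinearMap.ker ψ := fun y hy => by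
        obtain ⟨x, rfl⟩ := (hdp1 y).1 hy
        change φ j _ = 0
        rw [(Corner.exact_map (hd (i + 1))).apply_apply_eq_zero, map_zero]
      refine ⟨(LinearMap.ker (TriMod.fst p)).liftQ ψ hψ ∘ₗ
        ((TriMod.fst p).quotKerEquivOfSurjective hp1).symm.toLinearMap, fun y => ?_⟩
      change (LinearMap.ker (TriMod.fst p)).liftQ ψ hψ
        (((TriMod.fst p).quotKerEquivOfSurjective hp1).symm (TriMod.fst p y)) = _
      rw [← (TriMod.fst p).quotKerEquivOfSurjective_apply_mk hp1 y, LinearEquiv.symm_apply_apply]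
      rfl
    choose φ' hφ' using hφ
    refine ⟨n, φ', fun j => h (z j), fun b w => ?_⟩
    obtain ⟨y, rfl⟩ := hp2 w
    refine (hh b y).symm.trans ?_
    rw [hz (Corner.map _ (d (i + 1 + 1)) ((offDiag _).toFun b y)), map_sum]
    refine Finset.sum_congr rfl fun j _ => ?_
    rw [map_smul, ← hφ', TriMod.fst_offDiag]

end

/-! ### Lifting cocycles over local rings -/

section complex

variable {S : Type*} [CommRing S]

theorem LinearMap.map_mem_smul_top {M N : Type*} [AddCommGroup M] [Module S M] [AddCommGroup N]
    [Module S N] (I : Ideal S) (f : M →ₗ[S] N) {x : M} (hx : x ∈ I • (⊤ : Submodule S M)) :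
    f x ∈ I • (⊤ : Submodule S N) :=
  Submodule.smul_top_le_comap_smul_top I f hx

/-- For a source with a finite basis, a map with values in `I N` is a combination of maps with
coefficients in `I`. Congruences between cochains can thus be checked on values. -/
theorem Module.Basis.mem_smul_top {R M N ι : Type*} [CommRing R] [AddCommGroup M] [Module R M]
    [AddCommGroup N] [Module R N] [Module S N] [SMulCommClass R S N] [Finite ι]
    (b : Module.Basis ι R M) (I : Ideal S) (φ : M →ₗ[R] N)
    (h : ∀ i, φ (b i) ∈ I • (⊤ : Submodule S N)) : φ ∈ I • (⊤ : Submodule S (M →ₗ[R] N)) := by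
  classical
  have := Fintype.ofFinite ι
  have h1 : φ = ∑ i, (b.constr S).toLinearMap (LinearMap.single S (fun _ => N) i (φ (b i))) := by
    rw [← map_sum]
    change φ = b.constr S (∑ i, Pi.single i (φ (b i)))
    rw [Finset.univ_sum_single]
    exact (b.constr_self S φ).symm
  rw [h1]
  exact Submodule.sum_mem _ fun i _ =>
    LinearMap.map_mem_smul_top I ((b.constr S).toLinearMap ∘ₗ LinearMap.single S (fun _ => N) i) (h i)

variable [IsLocalRing S]

theorem IsLocalRing.exists_one_tmul_eq {M : Type*} [AddCommGroup M] [Module S M]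
    (t : ResidueField S ⊗[S] M) : ∃ x : M, (1 : ResidueField S) ⊗ₜ[S] x = t := by
  induction t using TensorProduct.induction_on with
  | zero => exact ⟨0, TensorProduct.tmul_zero _ _⟩
  | add t t' h h' =>
    obtain ⟨x, rfl⟩ := h
    obtain ⟨x', rfl⟩ := h'
    exact ⟨x + x', TensorProduct.tmul_add _ _ _⟩
  | tmul r x =>
    obtain ⟨r, rfl⟩ := residue_surjective r
    refine ⟨r • x, ?_⟩
    rw [← TensorProduct.smul_tmul, Algebra.smul_def, mul_one]
    rfl

theorem IsLocalRing.one_tmul_eq_zero_iff {M : Type*} [AddCommGroup M] [Module S M] {x : M} :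
    (1 : ResidueField S) ⊗ₜ[S] x = 0 ↔ x ∈ maximalIdeal S • (⊤ : Submodule S M) := by
  rw [← Submodule.Quotient.mk_eq_zero, ← TensorProduct.quotTensorEquivQuotSMul_mk_one_tmul]
  exact (TensorProduct.quotTensorEquivQuotSMul M (maximalIdeal S)).map_eq_zero_iff.symm

/-- If the reduction of a complex `C₀ → C₁ → C₂` is exact at `C₁`, then cocycles of the reduction
of `C₀` lift to cocycles of `C₀`. -/
theorem IsLocalRing.exists_cocycle {C₀ C₁ C₂ : Type*} [AddCommGroup C₀] [Module S C₀]
    [AddCommGroup C₁] [Module S C₁] [AddCommGroup C₂] [Module S C₂] [Module.Finite S C₁]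
    [Module.Finite S C₂] [Module.Free S C₂] (d₀ : C₀ →ₗ[S] C₁) (d₁ : C₁ →ₗ[S] C₂)
    (hd : ∀ x, d₁ (d₀ x) = 0)
    (hex : ∀ y, d₁ y ∈ maximalIdeal S • (⊤ : Submodule S C₂) →
      ∃ x, y - d₀ x ∈ maximalIdeal S • (⊤ : Submodule S C₁)) (x : C₀)
    (hx : d₀ x ∈ maximalIdeal S • (⊤ : Submodule S C₁)) :
    ∃ x', x - x' ∈ maximalIdeal S • (⊤ : Submodule S C₀) ∧ d₀ x' = 0 := by
  let l : (C₁ ⧸ LinearMap.range d₀) →ₗ[S] C₂ := (LinearMap.range d₀).liftQ d₁ (by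
    rintro _ ⟨x, rfl⟩
    exact hd x)
  have hl : ∀ y, l (Submodule.Quotient.mk y) = d₁ y := fun y => Submodule.liftQ_apply _ _ _
  -- Exactness of the reduction at `C₁` says that `C₁ / im d₀ → C₂` is injective modulo `m`. As `C₂`
  -- is free, this map is a split injection, so `C₁ / im d₀` is projective and `im d₀` is a direct
  -- summand of `C₁`.
  have hinj : Function.Injective (l.lTensor (ResidueField S)) := by
    rw [injective_iff_map_eq_zero]
    intro t ht
    obtain ⟨q, rfl⟩ := exists_one_tmul_eq t
    obtain ⟨y, rfl⟩ := Submodule.Quotient.mk_surjective _ q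
    rw [LinearMap.lTensor_tmul, hl] at ht
    obtain ⟨x, hx⟩ := hex y (one_tmul_eq_zero_iff.1 ht)
    have hy := LinearMap.map_mem_smul_top _ (LinearMap.range d₀).mkQ hx
    rw [map_sub, Submodule.mkQ_apply, Submodule.mkQ_apply,
      (Submodule.Quotient.mk_eq_zero (LinearMap.range d₀) (x := d₀ x)).2 ⟨x, rfl⟩, sub_zero] at hy
    exact one_tmul_eq_zero_iff.2 hy
  obtain ⟨l', hl'⟩ := (IsLocalRing.split_injective_iff_lTensor_residueField_injective l).2 hinj
  have : Module.Projective S (C₁ ⧸ LinearMap.range d₀) := Module.Projective.of_split l l' hl'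
  obtain ⟨s, hs⟩ := Module.projective_lifting_property (LinearMap.range d₀).mkQ LinearMap.id
    (Submodule.mkQ_surjective _)
  let r : C₁ →ₗ[S] LinearMap.range d₀ := (LinearMap.id - s ∘ₗ (LinearMap.range d₀).mkQ).codRestrict _
    fun y => by
      rw [← Submodule.Quotient.mk_eq_zero]
      change (LinearMap.range d₀).mkQ (y - s ((LinearMap.range d₀).mkQ y)) = 0
      rw [map_sub, sub_eq_zero]
      exact (LinearMap.congr_fun hs _).symm
  -- The retraction `r` shows that `d₀ x` lies in `m · im d₀ = d₀ (m C₀)`, so an element of `m C₀`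
  -- corrects `x`.
  have hr := LinearMap.map_mem_smul_top _ r hx
  have hr' : r (d₀ x) = d₀.rangeRestrict x := Subtype.ext (by
    change d₀ x - s ((LinearMap.range d₀).mkQ (d₀ x)) = d₀ x
    rw [Submodule.mkQ_apply,
      (Submodule.Quotient.mk_eq_zero (LinearMap.range d₀) (x := d₀ x)).2 ⟨x, rfl⟩, map_zero,
      sub_zero])
  have htop : (⊤ : Submodule S (LinearMap.range d₀)) = Submodule.map d₀.rangeRestrict ⊤ := by
    rw [← LinearMap.range_eq_map, LinearMap.range_eq_top.2 d₀.surjective_rangeRestrict]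
  rw [hr', htop, ← Submodule.map_smul''] at hr
  obtain ⟨z, hz, hz'⟩ := hr
  refine ⟨x - z, by rwa [sub_sub_cancel], ?_⟩
  rw [map_sub, sub_eq_zero]
  exact (congrArg Subtype.val hz').symm

end complex

/-- The lifting of central elements of a bimodule over an algebra `A`, if derivations of the
reduction are inner. -/
theorem IsLocalRing.exists_central_lift {k S A C : Type*} [Field k] [CommRing S] [Algebra k S]
    [IsLocalRing S] [Ring A] [Algebra k A] [Module.Finite k A] [AddCommGroup C] [Module S C]
    [Module.Finite S C] [Module.Free S C] [Module k C] [IsScalarTower k S C]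
    (l r : A →ₗ[k] Module.End S C) (hl : ∀ a b x, l (a * b) x = l a (l b x))
    (hr : ∀ a b x, r (a * b) x = r b (r a x)) (hlr : ∀ a b x, l a (r b x) = r b (l a x))
    (h : ∀ δ : A →ₗ[k] C,
      (∀ a b, δ (a * b) - l a (δ b) - r b (δ a) ∈ maximalIdeal S • (⊤ : Submodule S C)) →
      ∃ x, ∀ a, δ a - (l a x - r a x) ∈ maximalIdeal S • (⊤ : Submodule S C)) (x : C)
    (hx : ∀ a, l a x - r a x ∈ maximalIdeal S • (⊤ : Submodule S C)) :
    ∃ x', x - x' ∈ maximalIdeal S • (⊤ : Submodule S C) ∧ ∀ a, l a x' = r a x' := by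
  let b := Module.finBasis k A
  have : Module.Finite S (A →ₗ[k] C) := Module.Finite.equiv (b.constr S)
  have : Module.Free S (A →ₗ[k] C) := Module.Free.of_equiv (b.constr S)
  have : Module.Finite S (A →ₗ[k] A →ₗ[k] C) := Module.Finite.equiv (b.constr S)
  have : Module.Free S (A →ₗ[k] A →ₗ[k] C) := Module.Free.of_equiv (b.constr S)
  -- The beginning of the Hochschild complex of the bimodule `C`; its terms are finite free over `S`
  -- because `A` is finite dimensional.
  let d₀ : C →ₗ[S] A →ₗ[k] C :=
    { toFun := fun x =>
        { toFun := fun a => l a x - r a x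
          map_add' := fun a a' => by
            rw [map_add, map_add, LinearMap.add_apply, LinearMap.add_apply]
            abel
          map_smul' := fun c a => by
            rw [map_smul, map_smul, LinearMap.smul_apply, LinearMap.smul_apply, ← smul_sub]
            rfl }
      map_add' := fun x y => LinearMap.ext fun a => by
        change l a (x + y) - r a (x + y) = (l a x - r a x) + (l a y - r a y)
        rw [map_add, map_add]
        abel
      map_smul' := fun s x => LinearMap.ext fun a => by
        change l a (s • x) - r a (s • x) = s • (l a x - r a x)
        rw [map_smul, map_smul, smul_sub] }
  have hlk : ∀ a (c : k) (x : C), l a (c • x) = c • l a x := fun a c x => by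
    rw [← algebraMap_smul S, map_smul, algebraMap_smul]
  have hrk : ∀ a (c : k) (x : C), r a (c • x) = c • r a x := fun a c x => by
    rw [← algebraMap_smul S, map_smul, algebraMap_smul]
  let d₁ : (A →ₗ[k] C) →ₗ[S] A →ₗ[k] A →ₗ[k] C :=
    { toFun := fun δ => LinearMap.mk₂ k (fun a b => δ (a * b) - l a (δ b) - r b (δ a))
        (fun a a' b => by
          rw [add_mul, map_add, map_add, map_add, LinearMap.add_apply, map_add]
          abel)
        (fun c a b => by
          rw [smul_mul_assoc, map_smul, map_smul, map_smul, LinearMap.smul_apply, hrk, smul_sub,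
            smul_sub])
        (fun a b b' => by
          rw [mul_add, map_add, map_add, map_add, map_add, LinearMap.add_apply]
          abel)
        (fun c a b => by
          rw [mul_smul_comm, map_smul, map_smul, hlk, map_smul r, LinearMap.smul_apply, smul_sub,
            smul_sub])
      map_add' := fun δ δ' => LinearMap.ext₂ fun a b => by
        change (δ (a * b) + δ' (a * b)) - l a (δ b + δ' b) - r b (δ a + δ' a) =
          (δ (a * b) - l a (δ b) - r b (δ a)) + (δ' (a * b) - l a (δ' b) - r b (δ' a))
        rw [map_add, map_add]
        abel
      map_smul' := fun s δ => LinearMap.ext₂ fun a b => by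
        change s • δ (a * b) - l a (s • δ b) - r b (s • δ a) =
          s • (δ (a * b) - l a (δ b) - r b (δ a))
        rw [map_smul, map_smul, smul_sub, smul_sub] }
  obtain ⟨x', hx', hx''⟩ := IsLocalRing.exists_cocycle d₀ d₁ (fun x => LinearMap.ext₂ fun a b => by
      change (l (a * b) x - r (a * b) x) - l a (l b x - r b x) - r b (l a x - r a x) = 0
      rw [map_sub, map_sub, hl, hr, hlr]
      abel) (fun δ hδ => by
      obtain ⟨x, hx⟩ := h δ fun a b => by
        have h1 := LinearMap.map_mem_smul_top (maximalIdeal S) (LinearMap.applyₗ' S a :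
          (A →ₗ[k] A →ₗ[k] C) →ₗ[S] A →ₗ[k] C) hδ
        exact LinearMap.map_mem_smul_top (maximalIdeal S) (LinearMap.applyₗ' S b :
          (A →ₗ[k] C) →ₗ[S] C) h1
      exact ⟨x, b.mem_smul_top _ _ fun i => hx _⟩) x (b.mem_smul_top _ _ fun i => hx _)
  exact ⟨x', hx', fun a => sub_eq_zero.1 (LinearMap.congr_fun hx'' a)⟩

/-! ### Maps between modules with reductions -/

namespace CLNAlg.IsReduction

variable {k : Type u} [Field k] {R : CLNAlg k} {M M' V V' : Type*} [AddCommGroup M]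
    [Module R M] [AddCommGroup M'] [Module R M'] [AddCommGroup V] [Module k V] [AddCommGroup V']
    [Module k V'] {π : M →+ V} {π' : M' →+ V'}

/-- Linear maps descend to the reductions. -/
theorem exists_descend (h : R.IsReduction π) (h' : R.IsReduction π') (g : M →ₗ[R] M') :
    ∃ φ : V →+ V', ∀ m, φ (π m) = π' (g m) := by
  have h0 : ∀ m m', π m = π m' → π' (g m) = π' (g m') := fun m m' hm => by
    rw [← sub_eq_zero, ← map_sub, ← map_sub, h'.eq_zero_iff]
    refine LinearMap.map_mem_smul_top _ g (h.mem_of_eq_zero _ ?_)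
    rw [map_sub, hm, sub_self]
  choose s hs using h.surjective
  refine ⟨AddMonoidHom.mk' (fun v => π' (g (s v))) fun v w => ?_, fun m => h0 _ _ (hs _)⟩
  rw [← map_add, ← map_add]
  exact h0 _ _ (by rw [hs, map_add, hs, hs])

/-- Linear maps between the reductions lift to linear maps. -/
theorem exists_linearMap [Module.Free R M] (h : R.IsReduction π) (h' : R.IsReduction π')
    (φ : V →+ V') (hφ : ∀ (c : k) v, φ (c • v) = c • φ v) :
    ∃ g : M →ₗ[R] M', ∀ m, π' (g m) = φ (π m) := by
  let b := Module.Free.chooseBasis R M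
  choose y hy using fun i => h'.surjective (φ (π (b i)))
  refine ⟨b.constr R y, fun m => ?_⟩
  induction b.mem_span m using Submodule.span_induction with
  | zero => simp
  | add x y _ _ hx hy => simp only [map_add, hx, hy]
  | smul r x _ hx => rw [_root_.map_smul, h'.map_smul, h.map_smul, hφ, hx]
  | mem x hx =>
    obtain ⟨i, rfl⟩ := hx
    rw [b.constr_basis, hy]

end CLNAlg.IsReduction

/-! ### Lifting homomorphisms to the regular module when `Ext¹` vanishes. -/

namespace Lift

variable {k : Type u} [Field k] {A : Type u} [Ring A] [Algebra k A]
  {V : Type u} [AddCommGroup V] [Module A V] {R : Type u} [CommRing R] [Algebra k R]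
  [IsLocalRing R]

instance actionModule (L : Lift k A V R) : Module A L.carrier := Module.compHom L.carrier L.action

instance (L : Lift k A V R) : SMulCommClass A R L.carrier :=
  ⟨fun a r m => map_smul (L.action a) r m⟩

theorem algebraMap_smul_eq (L : Lift k A V R) (c : k) (m : L.carrier) :
    algebraMap k A c • m = algebraMap k R c • m := L.action_algebraMap c m

end Lift

section

variable {k : Type u} [Field k] {A : Type u} [Ring A] [Algebra k A] [Module.Finite k A]
  {V V' : Type u} [AddCommGroup V] [Module A V] [Module k V] [IsScalarTower k A V] {R : CLNAlg k}

/-- Homomorphisms to the regular module lift to homomorphisms between lifts, provided that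
derivations are inner. -/
theorem DerivationsInner.exists_lift (hV : DerivationsInner A V) (L : Lift k A V R)
    (Y : Lift k A A R) (φ : V →ₗ[A] A) : ∃ g : L.carrier →ₗ[R] Y.carrier,
      (∀ (a : A) m, g (a • m) = a • g m) ∧ ∀ m, Y.proj (g m) = φ (L.proj m) := by
  have hLr := L.isReduction
  have hYr := Y.isReduction
  letI : Module k (L.carrier →ₗ[R] Y.carrier) := Module.compHom _ (algebraMap k R)
  have : IsScalarTower k R (L.carrier →ₗ[R] Y.carrier) :=
    ⟨fun c r g => by rw [Algebra.smul_def, mul_smul]; rfl⟩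
  -- The reduction of the bimodule `Hom_R(L, Y)` is `Hom_k(V, A)`; its central elements are the
  -- `A`-linear maps.
  have hmem : ∀ g : L.carrier →ₗ[R] Y.carrier,
      g ∈ maximalIdeal R • (⊤ : Submodule R (L.carrier →ₗ[R] Y.carrier)) ↔
        ∀ m, Y.proj (g m) = 0 := fun g => by
    refine ⟨fun hg m => hYr.eq_zero_iff.2
      (LinearMap.map_mem_smul_top (maximalIdeal R) (LinearMap.applyₗ' R m) hg), fun hg => ?_⟩
    exact (Module.Free.chooseBasis R L.carrier).mem_smul_top _ _ fun i => hYr.mem_of_eq_zero _ (hg _)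
  let l : A →ₗ[k] Module.End R (L.carrier →ₗ[R] Y.carrier) :=
    { toFun := fun a => LinearMap.compRight R (Y.action a)
      map_add' := fun a b => by
        ext g m
        change Y.action (a + b) (g m) = Y.action a (g m) + Y.action b (g m)
        rw [map_add, LinearMap.add_apply]
      map_smul' := fun c a => by
        ext g m
        change Y.action (c • a) (g m) = algebraMap k R c • Y.action a (g m)
        rw [Algebra.smul_def, map_mul]
        exact Y.action_algebraMap c _ }
  let r : A →ₗ[k] Module.End R (L.carrier →ₗ[R] Y.carrier) :=
    { toFun := fun a => LinearMap.lcomp R Y.carrier (L.action a)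
      map_add' := fun a b => by
        ext g m
        change g (L.action (a + b) m) = g (L.action a m) + g (L.action b m)
        rw [map_add, LinearMap.add_apply, map_add]
      map_smul' := fun c a => by
        ext g m
        change g (L.action (c • a) m) = algebraMap k R c • g (L.action a m)
        rw [Algebra.smul_def, map_mul, ← map_smul g]
        exact congrArg g (L.action_algebraMap c _) }
  have hlv : ∀ a g m, l a g m = a • g m := fun _ _ _ => rfl
  have hrv : ∀ a g m, r a g m = g (a • m) := fun _ _ _ => rfl
  have hY : ∀ (a : A) y, Y.proj (a • y) = a * Y.proj y := Y.proj_action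
  have hL : ∀ (a : A) m, L.proj (a • m) = a • L.proj m := L.proj_action
  obtain ⟨g, hg⟩ := hLr.exists_linearMap hYr (φ : V →+ A)
    (fun c v => by
      change φ (c • v) = c • φ v
      rw [← algebraMap_smul A, map_smul, algebraMap_smul])
  replace hg : ∀ m, Y.proj (g m) = φ (L.proj m) := hg
  obtain ⟨g', hg', hgc⟩ := IsLocalRing.exists_central_lift (k := k) l r
    (fun a b g => LinearMap.ext fun m => by simp only [hlv, mul_smul])
    (fun a b g => LinearMap.ext fun m => by simp only [hrv, mul_smul])
    (fun a b g => LinearMap.ext fun m => by simp only [hlv, hrv])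
    (fun δ hδ => by
      choose δ' hδ' using fun a => hLr.exists_descend hYr (δ a)
      obtain ⟨h, hh⟩ := hV δ'
        (fun a b v => by
          obtain ⟨m, rfl⟩ := hLr.surjective v
          rw [hδ', hδ', hδ', map_add, LinearMap.add_apply, map_add])
        (fun a b v => by
          obtain ⟨m, rfl⟩ := hLr.surjective v
          have := (hmem _).1 (hδ a b) m
          rw [← hL, hδ', hδ', hδ', ← hY, ← map_add, ← sub_eq_zero, ← map_sub, ← this]
          congr 1
          rw [LinearMap.sub_apply, LinearMap.sub_apply, hlv, hrv]
          abel)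
      -- The primitive `h` is only additive a priori. Since `δ'` vanishes on the scalars of `A`, the
      -- formula for `δ'` shows that `h` commutes with them, so it lifts to an `R`-linear map.
      have hh1 : ∀ v, δ' 1 v = 0 := fun v => by rw [hh, one_mul, one_smul, sub_self]
      obtain ⟨x, hx⟩ := hLr.exists_linearMap hYr h fun c v => by
        have : δ' (algebraMap k A c) v = 0 := by
          obtain ⟨m, rfl⟩ := hLr.surjective v
          rw [hδ', Algebra.algebraMap_eq_smul_one, map_smul]
          change Y.proj (algebraMap k R c • δ 1 m) = 0
          rw [hYr.map_smul, ← hδ', hh1, smul_zero]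
        rw [hh, sub_eq_zero, algebraMap_smul] at this
        rw [← this, Algebra.smul_def]
      refine ⟨x, fun a => (hmem _).2 fun m => ?_⟩
      rw [LinearMap.sub_apply, LinearMap.sub_apply, hlv, hrv, map_sub, map_sub, hY, hx, hx,
        ← hδ', hh, hL, sub_self])
    g (fun a => (hmem _).2 fun m => by
      rw [LinearMap.sub_apply, hlv, hrv, map_sub, hY, hg, hg, hL, map_smul, smul_eq_mul, sub_self])
  refine ⟨g', fun a m => (LinearMap.congr_fun (hgc a) m).symm, fun m => ?_⟩
  rw [← hg, ← sub_eq_zero, ← neg_eq_zero, ← map_sub, ← map_neg, neg_sub]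
  exact (hmem _).1 hg' m

end

/-- The lift `R ⊗[k] X` of a module, with its universal property. -/
theorem Lift.exists_trivial (k : Type u) [Field k] (A : Type u) [Ring A] [Algebra k A] (X : Type u)
    [AddCommGroup X] [Module A X] [Module k X] [IsScalarTower k A X] [Module.Finite k X]
    (R : CLNAlg k) : ∃ (T : Lift k A X R) (ι : X →ₗ[A] T.carrier), (∀ x, T.proj (ι x) = x) ∧
      Submodule.span R (Set.range ι) = ⊤ ∧ ∀ (N : Type u) [AddCommGroup N] [Module R N]
        (σ : X →+ N), (∀ (c : k) x, σ (c • x) = algebraMap k R c • σ x) →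
        ∃ g : T.carrier →ₗ[R] N, ∀ x, g (ι x) = σ x := by
  let π : R ⊗[k] X →ₗ[k] X := (TensorProduct.lid k X).toLinearMap ∘ₗ R.aug.toLinearMap.rTensor X
  have hπ0 : ∀ (r : R) (x : X), π (r ⊗ₜ x) = R.aug r • x := fun r x => rfl
  have hπ : R.IsReduction (π : R ⊗[k] X →+ X) :=
    { map_smul := fun r t => by
        change π (r • t) = R.aug r • π t
        induction t using TensorProduct.induction_on with
        | zero => simp
        | add x y hx hy => simp only [smul_add, map_add, hx, hy]
        | tmul s x =>
          rw [TensorProduct.smul_tmul', hπ0, hπ0, smul_eq_mul, map_mul, mul_smul]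
      surjective := fun x => ⟨1 ⊗ₜ x, (hπ0 1 x).trans (by rw [map_one, one_smul])⟩
      mem_of_eq_zero := fun t ht => by
        have key : ∀ t, t - 1 ⊗ₜ π t ∈ maximalIdeal R • (⊤ : Submodule R (R ⊗[k] X)) := by
          intro t
          induction t using TensorProduct.induction_on with
          | zero => simp
          | add x y hx hy =>
            rw [map_add, TensorProduct.tmul_add, add_sub_add_comm]
            exact add_mem hx hy
          | tmul s x =>
            have : s ⊗ₜ[k] x - 1 ⊗ₜ[k] π (s ⊗ₜ x) =
                (s - algebraMap k R (R.aug s)) • ((1 : R) ⊗ₜ[k] x) := by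
              rw [hπ0, TensorProduct.smul_tmul', smul_eq_mul, mul_one, TensorProduct.sub_tmul,
                ← TensorProduct.smul_tmul, Algebra.algebraMap_eq_smul_one]
            rw [this]
            exact Submodule.smul_mem_smul (R.sub_aug_mem s) trivial
        have := key t
        rwa [show π t = 0 from ht, TensorProduct.tmul_zero, sub_zero] at this }
  let act : A →+* Module.End R (R ⊗[k] X) :=
    ((Module.End.baseChangeHom k R X : _ →ₐ[k] _) : _ →+* _).comp
      ((Algebra.lsmul k k X : A →ₐ[k] Module.End k X) : A →+* Module.End k X)
  have hact : ∀ (a : A) (r : R) (x : X), act a (r ⊗ₜ x) = r ⊗ₜ (a • x) := fun a r x => rfl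
  let T : Lift k A X R := Lift.ofProj act (fun c t => by
    induction t using TensorProduct.induction_on with
    | zero => simp
    | add x y hx hy => simp only [smul_add, map_add, hx, hy]
    | tmul s x =>
      rw [hact, algebraMap_smul, TensorProduct.tmul_smul]
      exact (algebraMap_smul R c _).symm) (π : R ⊗[k] X →+ X) hπ fun a t => by
    change π (act a t) = a • π t
    induction t using TensorProduct.induction_on with
    | zero => simp
    | add x y hx hy => simp only [smul_add, map_add, hx, hy]
    | tmul s x =>
      rw [hact, hπ0, hπ0, ← algebraMap_smul A, ← algebraMap_smul A, ← mul_smul, ← mul_smul,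
        Algebra.commutes]
  letI : Module A T.carrier := T.actionModule
  let ι : X →ₗ[A] T.carrier :=
    { toFun := fun x => (1 : R) ⊗ₜ[k] x
      map_add' := TensorProduct.tmul_add _
      map_smul' := fun a x => (hact a 1 x).symm }
  refine ⟨T, ι, fun x => (Lift.ofProj_proj _ _ _ _ _ _).trans ((hπ0 1 x).trans (by
    rw [map_one, one_smul])), ?_, fun N _ _ σ hσ => ?_⟩
  · refine top_le_iff.1 fun t _ => ?_
    change R ⊗[k] X at t
    change t ∈ Submodule.span R (Set.range fun x => (1 : R) ⊗ₜ[k] x)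
    induction t using TensorProduct.induction_on with
    | zero => exact zero_mem _
    | add x y hx hy => exact add_mem (hx trivial) (hy trivial)
    | tmul s x =>
      rw [show s ⊗ₜ[k] x = s • ((1 : R) ⊗ₜ[k] x) by
        rw [TensorProduct.smul_tmul', smul_eq_mul, mul_one]]
      exact Submodule.smul_mem _ _ (Submodule.subset_span ⟨x, rfl⟩)
  · letI : Module k N := Module.compHom N (algebraMap k R)
    have : IsScalarTower k R N := ⟨fun c r n => by rw [Algebra.smul_def, mul_smul]; rfl⟩
    exact ⟨LinearMap.liftBaseChange R { σ with map_smul' := hσ }, fun x =>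
      (LinearMap.liftBaseChange_tmul ..).trans (one_smul _ _)⟩

/-! ### Homomorphisms `B ⊗_C W → N` over local rings and their orbits under automorphisms. -/

section

variable {A B C : Type u} [Ring A] [Ring C] [AddCommGroup B] [Module A B] [Module Cᵐᵒᵖ B]

namespace TriModHom

variable {N W S : Type u} [AddCommGroup N] [Module A N] [AddCommGroup W] [Module C W]
  [CommRing S] [Module S N] [SMulCommClass A S N]

variable (A B C N W S) in
/-- The homomorphisms `B ⊗_C W → N` as a module of functions, over a ring that acts on `N`. -/
def submodule : Submodule S (B → W → N) where
  carrier := {t | ∃ D : TriModHom A B C N W, ∀ b w, D.toFun b w = t b w}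
  zero_mem' := ⟨0, fun _ _ => rfl⟩
  add_mem' := by
    rintro _ _ ⟨D, hD⟩ ⟨D', hD'⟩
    refine ⟨⟨D.toFun + D'.toFun, fun a b w => ?_, fun b c w => ?_⟩, fun b w => ?_⟩
    · simp only [AddMonoidHom.add_apply, D.map_smul, D'.map_smul, smul_add]
    · simp only [AddMonoidHom.add_apply, D.balanced, D'.balanced]
    · simp only [AddMonoidHom.add_apply, hD, hD', Pi.add_apply]
  smul_mem' := by
    rintro s _ ⟨D, hD⟩
    exact ⟨⟨AddMonoidHom.mk' (fun b => s • D.toFun b) fun b b' => by rw [map_add, smul_add],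
      fun a b w => (congrArg (s • ·) (D.map_smul a b w)).trans (smul_comm _ _ _).symm,
      fun b c w => congrArg (s • ·) (D.balanced b c w)⟩, fun b w => congrArg (s • ·) (hD b w)⟩

theorem mem_submodule (D : TriModHom A B C N W) :
    (fun b w => D.toFun b w) ∈ submodule A B C N W S := ⟨D, fun _ _ => rfl⟩

/-- A homomorphism is determined by its values on pairs of generators, so this is a submodule of a
finite power of `N`. Finite generation is what Nakayama needs. -/
theorem fg_submodule [Module.Finite A B] [Module.Finite C W] [IsNoetherianRing S]
    [Module.Finite S N] : (submodule A B C N W S).FG := by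
  obtain ⟨p, b, hb⟩ := Module.Finite.exists_fin (R := A) (M := B)
  obtain ⟨q, w, hw⟩ := Module.Finite.exists_fin (R := C) (M := W)
  let g : submodule A B C N W S →ₗ[S] (Fin p → Fin q → N) :=
    { toFun := fun t i j => (t : B → W → N) (b i) (w j)
      map_add' := fun _ _ => rfl
      map_smul' := fun _ _ => rfl }
  have hg : Function.Injective g := by
    rw [injective_iff_map_eq_zero]
    rintro ⟨t, D, hD⟩ ht
    have h0 : ∀ i j, D.toFun (b i) (w j) = 0 := fun i j =>
      (hD _ _).trans (congrFun (congrFun ht i) j)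
    have h1 : ∀ x j, D.toFun x (w j) = 0 := fun x j => by
      have hx : x ∈ Submodule.span A (Set.range b) := hb ▸ Submodule.mem_top
      induction hx using Submodule.span_induction with
      | zero => simp
      | add x y _ _ hx hy => rw [map_add, AddMonoidHom.add_apply, hx, hy, add_zero]
      | smul a x _ hx => rw [D.map_smul, hx, smul_zero]
      | mem x hx =>
        obtain ⟨i, rfl⟩ := hx
        exact h0 i j
    have h2 : ∀ x y, D.toFun x y = 0 := fun x y => by
      have hy : y ∈ Submodule.span C (Set.range w) := hw ▸ Submodule.mem_top
      induction hy using Submodule.span_induction generalizing x with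
      | zero => simp
      | add y z _ _ hy hz => rw [map_add, hy, hz, add_zero]
      | smul c y _ hy => rw [← D.balanced, hy]
      | mem y hy =>
        obtain ⟨j, rfl⟩ := hy
        exact h1 x j
    exact Subtype.ext (funext fun x => funext fun y => (hD x y).symm.trans (h2 x y))
  have := Module.Finite.of_injective g hg
  exact Module.Finite.iff_fg.1 this

/-- Homomorphisms with values in `I N` are combinations of homomorphisms with coefficients in
`I`. -/
theorem mem_smul_submodule [SMulCommClass A Cᵐᵒᵖ B] [Module.Projective A B] [Module.Projective C W]
    [IsNoetherianRing S] (I : Ideal S) (D : TriModHom A B C N W)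
    (hD : ∀ b w, D.toFun b w ∈ I • (⊤ : Submodule S N)) :
    (fun b w => D.toFun b w) ∈ I • submodule A B C N W S := by
  obtain ⟨q, r, hr⟩ := Submodule.fg_iff_exists_fin_generating_family.1 (IsNoetherian.noetherian I)
  -- For generators `r i` of `I`, this map has image `I N`. Lifting `D` through it, by projectivity
  -- of `B` and `W`, gives the coefficient homomorphisms.
  let π : (Fin q → N) →ₗ[A] N :=
    { toFun := fun x => ∑ i, r i • x i
      map_add' := fun x y => by simp [Finset.sum_add_distrib]
      map_smul' := fun a x => by simp [Finset.smul_sum, smul_comm a] }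
  have hπ : ∀ x ∈ I • (⊤ : Submodule S N), x ∈ LinearMap.range π := fun x hx => by
    induction hx using Submodule.smul_induction_on' with
    | smul s hs n _ =>
      rw [← hr] at hs
      obtain ⟨c, rfl⟩ := (Submodule.mem_span_range_iff_exists_fun S).1 hs
      refine ⟨fun i => c i • n, ?_⟩
      change ∑ i, r i • c i • n = _
      rw [Finset.sum_smul]
      exact Finset.sum_congr rfl fun i _ => by rw [← mul_smul, mul_comm, smul_eq_mul]
    | add x _ y _ hx hy => exact add_mem hx hy
  let D₀ : TriModHom A B C (LinearMap.range π) W :=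
    { toFun := AddMonoidHom.mk' (fun b => AddMonoidHom.mk'
          (fun w => (⟨D.toFun b w, hπ _ (hD b w)⟩ : LinearMap.range π))
          fun w w' => Subtype.ext (map_add (D.toFun b) w w'))
        fun b b' => AddMonoidHom.ext fun w => Subtype.ext
          (DFunLike.congr_fun (map_add D.toFun b b') w)
      map_smul := fun a b w => Subtype.ext (D.map_smul a b w)
      balanced := fun b c w => Subtype.ext (D.balanced b c w) }
  obtain ⟨D₁, hD₁⟩ := exists_lift π.rangeRestrict π.surjective_rangeRestrict D₀
  have h1 : (fun b w => D.toFun b w) =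
      ∑ i, r i • fun b w => (D₁.postcomp (LinearMap.proj i)).toFun b w := by
    funext b w
    rw [Finset.sum_apply, Finset.sum_apply]
    exact (congrArg Subtype.val (hD₁ b w)).symm
  rw [h1]
  exact Submodule.sum_mem _ fun i _ => Submodule.smul_mem_smul
    (hr ▸ Submodule.subset_span ⟨i, rfl⟩) (mem_submodule _)

end TriModHom

variable {k : Type u} [Field k] [Algebra k A] [Module.Finite k A] [SMulCommClass A Cᵐᵒᵖ B]
  [Module.Projective A B] [Module.Finite A B]
  {V W : Type u} [AddCommGroup V] [Module A V] [AddCommGroup W] [Module C W]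
  [Module k V] [IsScalarTower k A V] [Module.Projective C W] [Module.Finite C W]
  {f : TriModHom A B C V W}

/-- Under the conditions satisfied by Gorenstein-projective modules, two liftings of
`f : B ⊗_C W → V` to a lift of `V` differ by an automorphism of the lift. -/
theorem DerivationsInner.exists_endomorphism (hV : DerivationsInner A V)
    (hf : ∀ D : TriModHom A B C V W, ∃ (n : ℕ) (φ : Fin n → V →ₗ[A] A) (v : Fin n → V),
      ∀ b w, D.toFun b w = ∑ j, φ j (f.toFun b w) • v j) {S : CLNAlg k} (L : Lift k A V S)
    (F F' : TriModHom A B C L.carrier W) (hF : ∀ b w, L.proj (F.toFun b w) = f.toFun b w)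
    (hF' : ∀ b w, L.proj (F'.toFun b w) = f.toFun b w) :
    ∃ u : L.carrier →ₗ[S] L.carrier, (∀ (a : A) m, u (a • m) = a • u m) ∧
      (∀ m, L.proj (u m) = L.proj m) ∧ ∀ b w, u (F.toFun b w) = F'.toFun b w := by
  have hLA : ∀ (a : A) m, L.proj (a • m) = a • L.proj m := L.proj_action
  let π : L.carrier →ₗ[A] V := { L.proj with map_smul' := hLA }
  let E : Submodule S (L.carrier →ₗ[S] L.carrier) :=
    { carrier := {g | ∀ (a : A) m, g (a • m) = a • g m}
      zero_mem' := fun a m => (smul_zero a).symm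
      add_mem' := fun {g h} hg hh a m => by
        rw [LinearMap.add_apply, LinearMap.add_apply, hg, hh, smul_add]
      smul_mem' := fun s g hg a m => by
        rw [LinearMap.smul_apply, LinearMap.smul_apply, hg, smul_comm a s] }
  let ev : (L.carrier →ₗ[S] L.carrier) →ₗ[S] B → W → L.carrier :=
    { toFun := fun g b w => g (F.toFun b w)
      map_add' := fun _ _ => rfl
      map_smul' := fun _ _ => rfl }
  let T := TriModHom.submodule A B C L.carrier W S
  have hproj : ∀ D : TriModHom A B C L.carrier W, (∀ b w, L.proj (D.toFun b w) = 0) →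
      (fun b w => D.toFun b w) ∈ maximalIdeal S • T := fun D hD =>
    TriModHom.mem_smul_submodule _ D fun b w => L.proj_eq_zero_iff.1 (hD b w)
  obtain ⟨Y, ι, hι, hspan, huniv⟩ := Lift.exists_trivial k A A S
  -- Modulo `m`, any `D` is `f` followed by a sum of maps `φ_j(·) v_j`. Each of these lifts to an
  -- `A`-linear endomorphism of the lift: `φ_j` lifts to `g j` with values in `Y = S ⊗ A`, and `e j`
  -- sends the generator `1` of `Y` to a lift of `v j`.
  have hle : T ≤ E.map ev ⊔ maximalIdeal S • T := by
    rintro t ⟨D, hD⟩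
    obtain ⟨n, φ, v, hφ⟩ := hf (D.postcomp π)
    choose g hg hg' using fun j => hV.exists_lift L Y (φ j)
    choose m hm using fun j => L.proj_surjective (v j)
    have hev : ∀ j, ∃ e : Y.carrier →ₗ[S] L.carrier, ∀ a : A, e (ι a) = a • m j := fun j =>
      huniv L.carrier (AddMonoidHom.mk' (fun a : A => a • m j) fun a b => add_smul a b _)
        fun c a => by
          change (c • a) • m j = algebraMap k S c • a • m j
          rw [Algebra.smul_def, mul_smul, Lift.algebraMap_smul_eq]
    choose e he using hev
    have heq : ∀ j (a : A) y, e j (a • y) = a • e j y := fun j a y => by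
      have hy : y ∈ Submodule.span S (Set.range ι) := hspan ▸ Submodule.mem_top
      induction hy using Submodule.span_induction with
      | zero => simp
      | add x y _ _ hx hy => rw [smul_add, map_add, map_add, smul_add, hx, hy]
      | smul s x _ hx => rw [smul_comm a s, map_smul, hx, (e j).map_smul s, smul_comm a s]
      | mem x hx =>
        obtain ⟨a', rfl⟩ := hx
        rw [← map_smul, he, he, smul_eq_mul, mul_smul]
    have hpe : ∀ j y, L.proj (e j y) = Y.proj y • v j := fun j y => by
      have hy : y ∈ Submodule.span S (Set.range ι) := hspan ▸ Submodule.mem_top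
      induction hy using Submodule.span_induction with
      | zero => simp
      | add x y _ _ hx hy => rw [map_add, map_add, map_add, add_smul, hx, hy]
      | smul s x _ hx => rw [map_smul, L.proj_smul, Y.proj_smul, hx, smul_assoc]
      | mem x hx =>
        obtain ⟨a', rfl⟩ := hx
        rw [he, hLA, hm, hι]
    let x : L.carrier →ₗ[S] L.carrier := ∑ j, e j ∘ₗ g j
    have hx' : ∀ m, x m = ∑ j, e j (g j m) := fun m => by
      rw [LinearMap.sum_apply]
      rfl
    have hx : x ∈ E := fun a m => by
      rw [hx', hx', Finset.smul_sum]
      exact Finset.sum_congr rfl fun j _ => by rw [hg, heq]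
    let xA : L.carrier →ₗ[A] L.carrier := { (x : L.carrier →+ L.carrier) with map_smul' := hx }
    obtain ⟨D', hD'⟩ : t - ev x ∈ T := sub_mem ⟨D, hD⟩ ⟨F.postcomp xA, fun _ _ => rfl⟩
    have h0 := hproj D' fun b w => by
      rw [hD']
      change L.proj (t b w - x (F.toFun b w)) = 0
      rw [map_sub, ← hD, hx', map_sum, sub_eq_zero]
      refine (hφ b w).trans (Finset.sum_congr rfl fun j _ => ?_)
      rw [hpe, hg', hF]
    rw [show (fun b w => D'.toFun b w) = t - ev x from funext fun b => funext fun w => hD' b w]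
      at h0
    rw [← add_sub_cancel (ev x) t]
    exact Submodule.add_mem_sup ⟨x, hx, rfl⟩ h0
  have hTE : T ≤ E.map ev := Submodule.le_of_le_smul_of_le_jacobson_bot TriModHom.fg_submodule
    (IsLocalRing.jacobson_eq_maximalIdeal ⊥ bot_ne_top).ge hle
  obtain ⟨D, hD⟩ : (fun b w => F'.toFun b w) - (fun b w => F.toFun b w) ∈ T :=
    sub_mem (TriModHom.mem_submodule F') (TriModHom.mem_submodule F)
  have hDT := hproj D fun b w => by
    rw [hD]
    change L.proj (F'.toFun b w - F.toFun b w) = 0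
    rw [map_sub, hF, hF', sub_self]
  -- The difference `F' - F` lies in `m T`, hence is the value of `ev` at an element of `m E`. An
  -- endomorphism taken merely from `E` would not keep the reduction fixed.
  have h1 := Submodule.smul_mono le_rfl hTE hDT
  rw [← Submodule.map_smul''] at h1
  obtain ⟨e, he, heD⟩ := h1
  have heE : e ∈ E := Submodule.smul_le_right he
  have hem : e ∈ maximalIdeal S • (⊤ : Submodule S (L.carrier →ₗ[S] L.carrier)) :=
    Submodule.smul_mono le_rfl le_top he
  refine ⟨LinearMap.id + e, fun a m => ?_, fun m => ?_, fun b w => ?_⟩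
  · change a • m + e (a • m) = a • (m + e m)
    rw [heE, smul_add]
  · change L.proj (m + e m) = L.proj m
    rw [map_add, add_eq_left]
    exact L.proj_eq_zero_iff.2
      (LinearMap.map_mem_smul_top (maximalIdeal S) (LinearMap.applyₗ' S m) hem)
  · have : e (F.toFun b w) = D.toFun b w := congrFun (congrFun heD b) w
    change F.toFun b w + e (F.toFun b w) = F'.toFun b w
    rw [this, hD]
    exact add_sub_cancel _ _

end

/-! ### Corners of lifts. -/

theorem Lift.exists_ofModule {k : Type u} [Field k] {A : Type u} [Ring A] [Algebra k A]
    {V : Type u} [AddCommGroup V] [Module A V] [Module k V] [IsScalarTower k A V] {R : CLNAlg k}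
    {M : Type u} [AddCommGroup M] [Module R M] [Module.Free R M] [Module.Finite R M] [Module A M]
    [SMulCommClass A R M] (hM : ∀ (c : k) (m : M), algebraMap k A c • m = algebraMap k R c • m)
    (π : M →+ V) (hπ : R.IsReduction π) (hπ' : ∀ (a : A) m, π (a • m) = a • π m) :
    ∃ (L : Lift k A V R) (e : L.carrier ≃ₗ[R] M), (∀ (a : A) m, e (a • m) = a • e m) ∧
      ∀ m, L.proj m = π (e m) :=
  ⟨Lift.ofProj (Module.toModuleEnd R M) hM π hπ hπ', LinearEquiv.refl R M, fun _ _ => rfl,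
    Lift.ofProj_proj _ _ _ _ _⟩

/-- The reduction of a lift as a linear map. -/
noncomputable def Lift.projₗ {k : Type u} [Field k] {A V : Type u} [Ring A] [Algebra k A]
    [AddCommGroup V] [Module A V] {S : CLNAlg k} (L : Lift k A V S) : L.carrier →ₗ[A] V where
  toFun := L.proj
  map_add' := map_add _
  map_smul' a m := L.proj_action a m

theorem Lift.projₗ_apply {k : Type u} [Field k] {A V : Type u} [Ring A] [Algebra k A]
    [AddCommGroup V] [Module A V] {S : CLNAlg k} (L : Lift k A V S) (m : L.carrier) : L.projₗ m = L.proj m := rfl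

namespace Corner

variable {C A' S : Type*} [Ring C] [Ring A'] [CommRing S] {j : C →ₙ+* A'} {Y : Type*}
  [AddCommGroup Y] [Module A' Y] [Module S Y] [SMulCommClass A' S Y]

instance moduleOfComm : Module S (Corner j Y) where
  smul s y := ⟨s • (y : Y), show j 1 • s • (y : Y) = s • (y : Y) by
    rw [smul_comm, one_smul_coe]⟩
  one_smul y := Subtype.ext (one_smul S (y : Y))
  mul_smul s t y := Subtype.ext (mul_smul s t (y : Y))
  smul_zero s := Subtype.ext (smul_zero s)
  smul_add s y z := Subtype.ext (smul_add s (y : Y) z)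
  add_smul s t y := Subtype.ext (add_smul s t (y : Y))
  zero_smul y := Subtype.ext (zero_smul S (y : Y))

theorem coe_smul' (s : S) (y : Corner j Y) : ((s • y : Corner j Y) : Y) = s • (y : Y) := rfl

instance : SMulCommClass C S (Corner j Y) :=
  ⟨fun c s y => Subtype.ext (smul_comm (j c) s (y : Y))⟩

variable (j S Y) in
/-- The inclusion of a corner as a linear map over a ring acting on the module. -/
def subtypeₗ : Corner j Y →ₗ[S] Y where
  toFun y := y
  map_add' _ _ := rfl
  map_smul' _ _ := rfl

variable (j S Y) in
/-- The projection to a corner as a linear map over a ring acting on the module. -/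
def partₗ : Y →ₗ[S] Corner j Y where
  toFun y := part j y
  map_add' _ _ := map_add _ _ _
  map_smul' s y := Subtype.ext (smul_comm (j 1) s y)

theorem projective_of_comm [Module.Projective S Y] : Module.Projective S (Corner j Y) :=
  Module.Projective.of_split (subtypeₗ S j Y) (partₗ S j Y) (LinearMap.ext part_coe)

theorem finite_of_comm [Module.Finite S Y] : Module.Finite S (Corner j Y) :=
  Module.Finite.of_surjective (partₗ S j Y) fun y => ⟨y, part_coe y⟩

end Corner

section

variable {A B C : Type u} [Ring A] [Ring C] [AddCommGroup B] [Module A B] [Module Cᵐᵒᵖ B]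

namespace TriMat

variable [SMulCommClass A Cᵐᵒᵖ B] {Y : Type u} [AddCommGroup Y] [Module (TriMat A B C) Y]

theorem smul_upper (x : TriMat A B C) (y : Corner (upper A B C) Y) :
    x • (y : Y) = (x.a • y : Corner (upper A B C) Y) := by
  rw [Corner.coe_smul, ← Corner.one_smul_coe y, ← mul_smul, ← mul_smul]
  congr 1
  ext <;> simp [upper_apply]

theorem smul_lower (x : TriMat A B C) (y : Corner (lower A B C) Y) :
    x • (y : Y) = ((offDiag Y).toFun x.b y : Y) + (x.c • y : Corner (lower A B C) Y) := by
  rw [Corner.coe_smul, coe_offDiag, ← Corner.one_smul_coe y, ← mul_smul, ← mul_smul, ← mul_smul,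
    ← add_smul]
  congr 1
  ext <;> simp [lower_apply]

theorem offDiag_smul {S : Type*} [CommRing S] [Module S Y] [SMulCommClass (TriMat A B C) S Y]
    (b : B) (s : S) (y : Corner (lower A B C) Y) :
    (offDiag Y).toFun b (s • y) = s • (offDiag Y).toFun b y :=
  Subtype.ext (smul_comm (⟨0, b, 0⟩ : TriMat A B C) s (y : Y))

end TriMat

namespace TriMod

variable {V W : Type u} [AddCommGroup V] [Module A V] [AddCommGroup W] [Module C W]
  (f : TriModHom A B C V W) (S : Type*) [CommRing S] [Module S V] [Module S W]

instance moduleProd : Module S (TriMod f) := inferInstanceAs (Module S (V × W))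

instance [Module.Free S V] [Module.Free S W] : Module.Free S (TriMod f) :=
  inferInstanceAs (Module.Free S (V × W))

instance [Module.Finite S V] [Module.Finite S W] : Module.Finite S (TriMod f) :=
  inferInstanceAs (Module.Finite S (V × W))

end TriMod

section

variable {k : Type u} [Field k] [Algebra k A] [Algebra k C] [Module k B] [IsScalarTower k A B]
  [IsScalarTower k Cᵐᵒᵖ B]

theorem TriModHom.map_smul_right {V W : Type u} [AddCommGroup V] [Module A V] [AddCommGroup W]
    [Module C W] [Module k W] [IsScalarTower k C W] (D : TriModHom A B C V W) (b : B) (c : k)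
    (w : W) : D.toFun b (c • w) = algebraMap k A c • D.toFun b w := by
  rw [← algebraMap_smul C c w, ← D.balanced, ← D.map_smul, algebraMap_smul]
  congr 2
  exact algebraMap_smul Cᵐᵒᵖ c b

variable [SMulCommClass A Cᵐᵒᵖ B]
  {V W : Type u} [AddCommGroup V] [Module A V] [AddCommGroup W] [Module C W]

instance [Module k V] [Module k W] [IsScalarTower k A V] [IsScalarTower k C W] (f : TriModHom A B C V W) : IsScalarTower k (TriMat A B C) (TriMod f) where
  smul_assoc c x p := Prod.ext
    (show (c • x.a) • p.1 + f.toFun (c • x.b) p.2 = c • (x.a • p.1 + f.toFun x.b p.2) by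
      rw [← algebraMap_smul A c x.b, f.map_smul, algebraMap_smul, smul_assoc, smul_add])
    (show (c • x.c) • p.2 = c • x.c • p.2 from smul_assoc _ _ _)

namespace Lift

variable {f : TriModHom A B C V W} {S S' : CLNAlg k}

open TriMat

/-- The lift `M` of `V` is the upper corner of the lift `L` of the `TriMat A B C`-module
`TriMod f`. -/
def IsCorner (L : Lift k (TriMat A B C) (TriMod f) S) (M : Lift k A V S) : Prop :=
  ∃ i : M.carrier ≃ₗ[A] Corner (upper A B C) L.carrier,
    (∀ (s : S) m, i (s • m) = s • i m) ∧ ∀ m, (L.proj (i m)).1 = M.proj m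

theorem proj_upper_snd (L : Lift k (TriMat A B C) (TriMod f) S)
    (y : Corner (upper A B C) L.carrier) : (L.proj y).2 = 0 := by
  rw [← projₗ_apply, ← TriMod.snd_part, part_lower_upper, map_zero]

theorem proj_lower_fst (L : Lift k (TriMat A B C) (TriMod f) S)
    (y : Corner (lower A B C) L.carrier) : (L.proj y).1 = 0 := by
  rw [← projₗ_apply, ← TriMod.fst_part, part_upper_lower, map_zero]

/-- A map of lifts commutes with the idempotent `e₁`, so it restricts to the upper corners. -/
theorem Over.of_isCorner {θ : S ⟶ S'} {L : Lift k (TriMat A B C) (TriMod f) S}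
    {L' : Lift k (TriMat A B C) (TriMod f) S'} {M : Lift k A V S} {M' : Lift k A V S'}
    (h : Over θ L L') (hM : IsCorner L M) (hM' : IsCorner L' M') : Over θ M M' := by
  obtain ⟨φ, h1, h2, h3⟩ := h
  obtain ⟨i, hi, hi'⟩ := hM
  obtain ⟨j, hj, hj'⟩ := hM'
  let φ' : Corner (upper A B C) L.carrier →+ Corner (upper A B C) L'.carrier :=
    { toFun := fun y => ⟨φ y, show L'.action _ (φ y) = φ y by
        rw [← h2]
        exact congrArg φ (Corner.one_smul_coe y)⟩
      map_zero' := Subtype.ext (map_zero φ)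
      map_add' := fun y z => Subtype.ext (map_add φ (y : L.carrier) z) }
  refine ⟨(j.symm : _ →+ M'.carrier).comp (φ'.comp (i : M.carrier →+ _)), fun s m => ?_,
    fun a m => ?_, fun m => ?_⟩
  · change j.symm (φ' (i (s • m))) = θ.toAlgHom s • j.symm (φ' (i m))
    rw [LinearEquiv.symm_apply_eq, hj, LinearEquiv.apply_symm_apply, hi]
    exact Subtype.ext (h1 s _)
  · change j.symm (φ' (i (a • m))) = a • j.symm (φ' (i m))
    rw [← map_smul, map_smul i]
    exact congrArg j.symm (Subtype.ext (h2 _ _))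
  · change M'.proj (j.symm (φ' (i m))) = M.proj m
    rw [← hj', LinearEquiv.apply_symm_apply, ← hi']
    exact congrArg Prod.fst (h3 (i m))

theorem IsCorner.trans_isomorphic {L : Lift k (TriMat A B C) (TriMod f) S} {M M' : Lift k A V S}
    (h : IsCorner L M) (h' : M'.Isomorphic M) : IsCorner L M' := by
  obtain ⟨i, h1, h2⟩ := h
  obtain ⟨e, h3, h4⟩ := isomorphic_iff.1 h'
  let e' : M'.carrier ≃ₗ[A] M.carrier := { (e : M'.carrier ≃+ M.carrier) with map_smul' := h3 }
  refine ⟨e'.trans i, fun s m => ?_, fun m => (h2 _).trans (h4 m)⟩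
  change i (e (s • m)) = s • i (e m)
  rw [map_smul, h1]

variable [Module k V] [Module k W] [IsScalarTower k A V] [IsScalarTower k C W]

/-- The corner is a direct summand of a finite free `S`-module, hence free over the local ring `S`,
and its reduction is the corner of the reduction. -/
theorem exists_isCorner (L : Lift k (TriMat A B C) (TriMod f) S) :
    ∃ M : Lift k A V S, IsCorner L M := by
  have := Corner.projective_of_comm (S := S) (j := upper A B C) (Y := L.carrier)
  have := Corner.finite_of_comm (S := S) (j := upper A B C) (Y := L.carrier)
  have : Module.Free S (Corner (upper A B C) L.carrier) := Module.free_of_flat_of_isLocalRing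
  have hL := L.isReduction
  obtain ⟨M, e, he, he'⟩ := exists_ofModule (k := k) (A := A) (R := S)
    (M := Corner (upper A B C) L.carrier) (V := V)
    (fun c y => Subtype.ext (by
      rw [Corner.coe_smul', ← L.algebraMap_smul_eq, smul_upper]
      rfl))
    ((TriMod.fst L.projₗ : _ →+ V))
    { map_smul := fun s y => congrArg Prod.fst (hL.map_smul s (y : L.carrier))
      surjective := TriMod.fst_surjective hL.surjective
      mem_of_eq_zero := fun y hy => by
        have := LinearMap.map_mem_smul_top _ (Corner.partₗ S (upper A B C) L.carrier)
          (hL.mem_of_eq_zero (y : L.carrier) (Prod.ext hy (L.proj_upper_snd y)))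
        rwa [show Corner.partₗ S (upper A B C) L.carrier y = y from Corner.part_coe y] at this }
    (fun a y => map_smul (TriMod.fst L.projₗ) a y)
  let e' : M.carrier ≃ₗ[A] Corner (upper A B C) L.carrier :=
    { (e : M.carrier ≃+ Corner (upper A B C) L.carrier) with map_smul' := he }
  exact ⟨M, e', fun s m => map_smul e s m, fun m => (he' m).symm⟩

end Lift

end

end

/-! ### Reconstructing a lift from its upper corner, and the comparison of versal deformations. -/

section

variable {A B C : Type u} [Ring A] [Ring C] [AddCommGroup B] [Module A B] [Module Cᵐᵒᵖ B]
  {k : Type u} [Field k] [Algebra k A] [Algebra k C] [Module k B] [IsScalarTower k A B]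
  [IsScalarTower k Cᵐᵒᵖ B]
  {V W : Type u} [AddCommGroup V] [Module A V] [AddCommGroup W] [Module C W]
  [Module k V] [Module k W] [IsScalarTower k A V] [IsScalarTower k C W]
  {f : TriModHom A B C V W} {S : CLNAlg k}

namespace TriModHom

/-- A homomorphism `B ⊗_C W → N` extends `S`-linearly to a lift of `W` generated by `W`. -/
theorem exists_extension (T : Lift k C W S) (ι : W →ₗ[C] T.carrier)
    (hspan : Submodule.span S (Set.range ι) = ⊤)
    (huniv : ∀ (N : Type u) [AddCommGroup N] [Module S N] (σ : W →+ N),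
        (∀ (c : k) x, σ (c • x) = algebraMap k S c • σ x) →
        ∃ g : T.carrier →ₗ[S] N, ∀ x, g (ι x) = σ x)
    {N : Type u} [AddCommGroup N] [Module S N] [Module A N] [SMulCommClass A S N]
    (hN : ∀ (c : k) (n : N), algebraMap k A c • n = algebraMap k S c • n)
    (F : TriModHom A B C N W) : ∃ F' : TriModHom A B C N T.carrier,
      (∀ b w, F'.toFun b (ι w) = F.toFun b w) ∧
      ∀ b (s : S) t, F'.toFun b (s • t) = s • F'.toFun b t := by
  have := SMulCommClass.symm A S N
  choose g hg using fun b => huniv N (F.toFun b) fun c w => by rw [F.map_smul_right, hN]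
  have hext : ∀ {φ ψ : T.carrier →ₗ[S] N}, (∀ w, φ (ι w) = ψ (ι w)) → φ = ψ := fun {φ ψ} h =>
    LinearMap.ext_on hspan (by
      rintro _ ⟨w, rfl⟩
      exact h w)
  refine ⟨⟨AddMonoidHom.mk' (fun b => (g b : T.carrier →+ N)) fun b b' => ?_, fun a b t => ?_,
    fun b c t => ?_⟩, hg, fun b s t => _root_.map_smul (g b) s t⟩
  · have : g (b + b') = g b + g b' := hext fun w => by
      rw [LinearMap.add_apply, hg, hg, hg, map_add, AddMonoidHom.add_apply]
    exact AddMonoidHom.ext fun t => LinearMap.congr_fun this t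
  · have : g (a • b) = a • g b := hext fun w => by
      rw [LinearMap.smul_apply, hg, hg, F.map_smul]
    exact LinearMap.congr_fun this t
  · have : g (MulOpposite.op c • b) = g b ∘ₗ T.action c := hext fun w => by
      rw [hg, F.balanced, ← hg, _root_.map_smul ι]
      rfl
    exact LinearMap.congr_fun this t

end TriModHom

variable [SMulCommClass A Cᵐᵒᵖ B]

open TriMat

namespace Lift

/-- A lift of `TriMod f` from a lift `M` of `V`, a lift `T` of `W` and a lift of `f`. -/
theorem exists_triMod (M : Lift k A V S) (T : Lift k C W S)
    (F : TriModHom A B C M.carrier T.carrier)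
    (hF : ∀ b (s : S) t, F.toFun b (s • t) = s • F.toFun b t)
    (hF' : ∀ b t, M.proj (F.toFun b t) = f.toFun b (T.proj t)) :
    ∃ (P : Lift k (TriMat A B C) (TriMod f) S) (e : P.carrier ≃ₗ[S] TriMod F),
      (∀ (x : TriMat A B C) p, e (x • p) = x • e p) ∧
      ∀ p, P.proj p = ((M.proj (e p).1, T.proj (e p).2) : V × W) := by
  have : SMulCommClass (TriMat A B C) S (TriMod F) := ⟨fun x s p => Prod.ext
    (show x.a • s • p.1 + F.toFun x.b (s • p.2) = s • (x.a • p.1 + F.toFun x.b p.2) by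
      rw [hF, smul_add, smul_comm])
    (show x.c • s • p.2 = s • x.c • p.2 from smul_comm _ _ _)⟩
  let π : TriMod F →+ TriMod f :=
    { toFun := fun p => ((M.proj p.1, T.proj p.2) : V × W)
      map_zero' := Prod.ext (map_zero M.proj) (map_zero T.proj)
      map_add' := fun p q => Prod.ext (map_add M.proj p.1 q.1) (map_add T.proj p.2 q.2) }
  have hM := M.isReduction
  have hT := T.isReduction
  refine exists_ofModule (M := TriMod F) (fun c p => ?_) π ⟨fun s p => ?_, fun p => ?_, fun p hp => ?_⟩
    fun x p => ?_
  · refine Prod.ext ?_ (T.algebraMap_smul_eq c p.2)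
    change algebraMap k A c • p.1 + F.toFun 0 p.2 = algebraMap k S c • p.1
    rw [map_zero, AddMonoidHom.zero_apply, add_zero, M.algebraMap_smul_eq]
  · exact Prod.ext (hM.map_smul s p.1) (hT.map_smul s p.2)
  · obtain ⟨m, hm⟩ := hM.surjective p.1
    obtain ⟨t, ht⟩ := hT.surjective p.2
    exact ⟨((m, t) : M.carrier × T.carrier), Prod.ext hm ht⟩
  · have h1 := LinearMap.map_mem_smul_top (maximalIdeal S)
      (LinearMap.inl S M.carrier T.carrier) (hM.mem_of_eq_zero p.1 (congrArg Prod.fst hp))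
    have h2 := LinearMap.map_mem_smul_top (maximalIdeal S)
      (LinearMap.inr S M.carrier T.carrier) (hT.mem_of_eq_zero p.2 (congrArg Prod.snd hp))
    have h3 := add_mem h1 h2
    rwa [LinearMap.inl_apply, LinearMap.inr_apply, Prod.mk_add_mk, add_zero, zero_add] at h3
  · refine Prod.ext ?_ (T.proj_action x.c p.2)
    change M.proj (x.a • p.1 + F.toFun x.b p.2) = x.a • M.proj p.1 + f.toFun x.b (T.proj p.2)
    rw [map_add, hF']
    exact congrArg (· + _) (M.proj_action x.a p.1)

/-- The heart of the comparison: a lift `M` of `V` comes from exactly one isomorphism class of lifts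
of `(V, W)_f`. Existence rests on the projectivity of `B` and `W`, uniqueness on
`DerivationsInner.exists_endomorphism`. -/
theorem exists_model [Module.Projective A B] [Module.Finite A B] [Module.Finite k A]
    [Module.Projective C W] [Module.Finite C W] [Module.Finite k W]
    (hV : DerivationsInner A V)
    (hf : ∀ D : TriModHom A B C V W, ∃ (n : ℕ) (φ : Fin n → V →ₗ[A] A) (v : Fin n → V),
      ∀ b w, D.toFun b w = ∑ j, φ j (f.toFun b w) • v j) (M : Lift k A V S) :
    ∃ P : Lift k (TriMat A B C) (TriMod f) S, IsCorner P M ∧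
      ∀ L : Lift k (TriMat A B C) (TriMod f) S, IsCorner L M → P.Isomorphic L := by
  obtain ⟨F, hF⟩ := TriModHom.exists_lift M.projₗ M.proj_surjective f
  obtain ⟨T, ι, hι, hspan, huniv⟩ := exists_trivial k C W S
  obtain ⟨G, hG, hGS⟩ := F.exists_extension T ι hspan huniv M.algebraMap_smul_eq
  have hG' : ∀ b t, M.proj (G.toFun b t) = f.toFun b (T.proj t) := fun b t => by
    have ht : t ∈ Submodule.span S (Set.range ι) := hspan ▸ Submodule.mem_top
    induction ht using Submodule.span_induction with
    | zero => simp
    | add x y _ _ hx hy => simp only [map_add, hx, hy]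
    | smul s x _ hx =>
      rw [hGS, M.proj_smul, T.proj_smul, hx, f.map_smul_right, algebraMap_smul]
    | mem x hx =>
      obtain ⟨w, rfl⟩ := hx
      rw [hG, hι]
      exact hF b w
  obtain ⟨P, e, he, hP⟩ := exists_triMod M T G hGS hG'
  refine ⟨P, ?_, fun L ⟨i, hi, hi'⟩ => ?_⟩
  · have he' : ∀ (x : TriMat A B C) p, e.symm (x • p) = x • e.symm p := fun x p => by
      rw [LinearEquiv.symm_apply_eq, he, LinearEquiv.apply_symm_apply]
    have hup : ∀ y : Corner (upper A B C) P.carrier, ((e y).2 : T.carrier) = 0 := fun y => by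
      refine (congrArg (fun z => (e z).2) (Corner.one_smul_coe y).symm).trans ?_
      rw [he]
      exact zero_smul C (e (y : P.carrier)).2
    obtain ⟨v, hv, hva, hvs, hv1, hv2⟩ : ∃ v : M.carrier → TriMod G,
        (∀ m m', v (m + m') = v m + v m') ∧ (∀ (a : A) m, v (a • m) = upper A B C a • v m) ∧
        (∀ (s : S) m, v (s • m) = s • v m) ∧ (∀ m, (v m).1 = m) ∧
        ∀ p : TriMod G, p.2 = 0 → v p.1 = p := by
      refine ⟨fun m => ((m, 0) : M.carrier × T.carrier), fun m m' => ?_, fun a m => ?_,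
        fun s m => ?_, fun m => rfl, fun p hp => Prod.ext rfl hp.symm⟩
      · exact Prod.ext rfl (add_zero (0 : T.carrier)).symm
      · refine Prod.ext ?_ (smul_zero (0 : C)).symm
        change a • m = a • m + G.toFun 0 0
        simp
      · exact Prod.ext rfl (smul_zero s).symm
    let i : M.carrier ≃ₗ[A] Corner (upper A B C) P.carrier :=
      { toFun := fun m => ⟨e.symm (v m), by
          change upper A B C 1 • e.symm _ = e.symm _
          rw [← he', ← hva, one_smul]⟩
        map_add' := fun m m' => Subtype.ext ((congrArg e.symm (hv m m')).trans (map_add e.symm _ _))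
        map_smul' := fun a m => Subtype.ext ((congrArg e.symm (hva a m)).trans (he' _ _))
        invFun := fun y => (e (y : P.carrier)).1
        left_inv := fun m => (congrArg Prod.fst (e.apply_symm_apply (v m))).trans (hv1 m)
        right_inv := fun y => Subtype.ext
          ((congrArg e.symm (hv2 _ (hup y))).trans (e.symm_apply_apply (y : P.carrier))) }
    refine ⟨i, fun s m => Subtype.ext ?_, fun m => ?_⟩
    · change e.symm (v (s • m)) = s • e.symm (v m)
      rw [← map_smul, hvs]
    · change (P.proj (e.symm (v m))).1 = M.proj m
      rw [hP, e.apply_symm_apply, hv1]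
  · let q := L.projₗ
    -- As `W` is projective, it embeds in the lower corner of `L` by a section `σ` of the reduction.
    -- The structure map of `L` restricted along `σ` is a second lifting of `f` to `M`, and `u`
    -- carries `F` to it.
    obtain ⟨σ, hσ⟩ := Module.projective_lifting_property (TriMod.snd q) LinearMap.id
      (TriMod.snd_surjective L.proj_surjective)
    replace hσ : ∀ w, TriMod.snd q (σ w) = w := fun w => LinearMap.congr_fun hσ w
    obtain ⟨u, hu, hu', huF⟩ := hV.exists_endomorphism hf M F
      (((offDiag L.carrier).precomp σ).postcomp i.symm.toLinearMap) hF fun b w => by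
        change M.proj (i.symm ((offDiag L.carrier).toFun b (σ w))) = _
        rw [← hi', LinearEquiv.apply_symm_apply]
        exact (TriMod.fst_offDiag q b (σ w)).trans (by rw [hσ])
    obtain ⟨g, hg⟩ := huniv (Corner (lower A B C) L.carrier) (σ : W →+ _) fun c w => by
      change σ (c • w) = algebraMap k S c • σ w
      rw [← algebraMap_smul C c w, map_smul]
      refine Subtype.ext ?_
      rw [Corner.coe_smul', ← L.algebraMap_smul_eq, smul_lower]
      change _ = ((offDiag L.carrier).toFun 0 (σ w) : L.carrier) + _
      rw [map_zero]
      exact (zero_add _).symm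
    have hgc : ∀ (c : C) t, g (c • t) = c • g t := fun c t => by
      have ht : t ∈ Submodule.span S (Set.range ι) := hspan ▸ Submodule.mem_top
      induction ht using Submodule.span_induction with
      | zero => simp
      | add x y _ _ hx hy => simp only [map_add, smul_add, hx, hy]
      | smul s x _ hx => rw [smul_comm c s, map_smul, hx, g.map_smul s, smul_comm c s]
      | mem x hx =>
        obtain ⟨w, rfl⟩ := hx
        rw [← map_smul, hg, hg]
        exact map_smul σ c w
    have hgp : ∀ t, (L.proj (g t)).2 = T.proj t := fun t => by
      have ht : t ∈ Submodule.span S (Set.range ι) := hspan ▸ Submodule.mem_top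
      induction ht using Submodule.span_induction with
      | zero => simp; rfl
      | add x y _ _ hx hy =>
        rw [map_add, map_add, ← hx, ← hy]
        exact congrArg Prod.snd (map_add L.proj _ _)
      | smul s x _ hx =>
        rw [map_smul, T.proj_smul, ← hx]
        exact congrArg Prod.snd (L.proj_smul s _)
      | mem x hx =>
        obtain ⟨w, rfl⟩ := hx
        rw [hg, hι]
        exact hσ w
    have hub : ∀ b t, i (u (G.toFun b t)) = (offDiag L.carrier).toFun b (g t) := fun b t => by
      have ht : t ∈ Submodule.span S (Set.range ι) := hspan ▸ Submodule.mem_top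
      induction ht using Submodule.span_induction with
      | zero => simp
      | add x y _ _ hx hy => simp only [map_add, hx, hy]
      | smul s x _ hx => rw [hGS, map_smul, hi, hx, map_smul, offDiag_smul]
      | mem x hx =>
        obtain ⟨w, rfl⟩ := hx
        rw [hG, huF, hg]
        exact i.apply_symm_apply _
    -- The comparison map is `u` on the upper corner and the extension `g` of `σ` on the lower one.
    -- `hub` makes it linear over the triangular ring, and compatibility with the reductions makes
    -- it an isomorphism.
    let h : P.carrier →ₗ[S] L.carrier :=
      { toFun := fun p => (i (u (e p).1) : L.carrier) + g (e p).2
        map_add' := fun p p' => by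
          rw [map_add]
          change ((i (u ((e p).1 + (e p').1)) : Corner _ _) : L.carrier) +
            g ((e p).2 + (e p').2) = _
          rw [map_add, map_add, map_add, AddSubgroup.coe_add, AddSubgroup.coe_add]
          abel
        map_smul' := fun s p => by
          rw [map_smul]
          change ((i (u (s • (e p).1)) : Corner _ _) : L.carrier) + g (s • (e p).2) = _
          rw [u.map_smul s, g.map_smul s, hi, Corner.coe_smul', Corner.coe_smul', ← smul_add]
          rfl }
    refine isomorphic_of_hom h (fun x p => ?_) fun p => ?_
    · change ((i (u (e (x • p)).1) : Corner _ _) : L.carrier) + g (e (x • p)).2 =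
        x • ((i (u (e p).1) : L.carrier) + g (e p).2)
      rw [he, smul_add, smul_upper, smul_lower, ← hub, ← hgc, ← i.map_smul,
        ← hu, ← add_assoc, ← AddSubgroup.coe_add, ← map_add, ← map_add]
      rfl
    · rw [hP]
      refine Prod.ext ?_ ?_
      · change (L.proj ((i (u (e p).1) : L.carrier) + g (e p).2)).1 = _
        rw [map_add]
        change (L.proj (i (u (e p).1) : L.carrier)).1 + (L.proj (g (e p).2 : L.carrier)).1 = _
        rw [hi', hu', proj_lower_fst, add_zero]
      · change (L.proj ((i (u (e p).1) : L.carrier) + g (e p).2)).2 = _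
        rw [map_add]
        change (L.proj (i (u (e p).1) : L.carrier)).2 + (L.proj (g (e p).2 : L.carrier)).2 = _
        rw [hgp, proj_upper_snd, zero_add]

/-- Taking corners preserves versal deformations. -/
theorem IsCorner.isVersalDeformation [Module.Projective A B] [Module.Finite A B] [Module.Finite k A]
    [Module.Projective C W] [Module.Finite C W] [Module.Finite k W]
    (hV : DerivationsInner A V)
    (hf : ∀ D : TriModHom A B C V W, ∃ (n : ℕ) (φ : Fin n → V →ₗ[A] A) (v : Fin n → V),
      ∀ b w, D.toFun b w = ∑ j, φ j (f.toFun b w) • v j)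
    {U : Lift k (TriMat A B C) (TriMod f) S} {M : Lift k A V S} (hM : IsCorner U M)
    (hU : IsVersalDeformation U) : IsVersalDeformation M := by
  rw [isVersalDeformation_iff] at hU ⊢
  refine ⟨fun R N => ?_, fun N θ θ' hθ hθ' => ?_⟩
  · obtain ⟨P, hP, -⟩ := exists_model hV hf N
    obtain ⟨θ, hθ⟩ := hU.1 R P
    exact ⟨θ, hθ.of_isCorner hM hP⟩
  · obtain ⟨P, -, hP⟩ := exists_model hV hf N
    -- The base change of `U` along `θ` has a corner isomorphic to `N`, hence it is isomorphic to
    -- the model `P` of `N`. So every classifying map of `N` also classifies the one lift `P`.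
    have key : ∀ θ : S ⟶ CLNAlg.dualNumber k, Over θ M N → Over θ U P := fun θ hθ => by
      obtain ⟨N', hN'⟩ := exists_isCorner (U.map θ)
      have h := ((over_map θ U).of_isCorner hM hN').isomorphic hθ
      exact (over_map θ U).trans_isomorphic (hP _ (hN'.trans_isomorphic h.symm)).symm
    exact hU.2 P θ θ' (key θ hθ) (key θ' hθ')

end Lift

end

theorem TriMat.finite (k : Type u) [Field k] (A B C : Type u) [Ring A] [Ring C] [AddCommGroup B]
    [Module A B] [Module Cᵐᵒᵖ B] [Algebra k A] [Algebra k C] [Module k B] [IsScalarTower k A B]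
    [IsScalarTower k Cᵐᵒᵖ B] [SMulCommClass A Cᵐᵒᵖ B] [Module.Finite k A] [Module.Finite k B]
    [Module.Finite k C] : Module.Finite k (TriMat A B C) :=
  Module.Finite.of_surjective
    ({ toFun := fun x => ⟨x.1, x.2.1, x.2.2⟩
       map_add' := fun _ _ => rfl
       map_smul' := fun _ _ => rfl } : A × B × C →ₗ[k] TriMat A B C)
    fun x => ⟨(x.a, x.b, x.c), rfl⟩

theorem theorem1p2 (k : Type u) [Field k]
    (Λ : Type u) [Ring Λ] [Algebra k Λ] [Module.Finite k Λ]
    (Γ : Type u) [Ring Γ] [Algebra k Γ] [Module.Finite k Γ]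
    (B : Type u) [AddCommGroup B] [Module k B] [Module.Finite k B]
    [Module Λ B] [Module Γᵐᵒᵖ B] [SMulCommClass Λ Γᵐᵒᵖ B]
    [IsScalarTower k Λ B] [IsScalarTower k Γᵐᵒᵖ B]
    (hTri : IsGorensteinAlg (TriMat Λ B Γ))
    (hB : Module.Projective Λ B)
    (hG : HasFiniteGlobalDim Γ)
    (V : Type u) [AddCommGroup V] [Module Λ V] [Module.Finite Λ V]
    (W : Type u) [AddCommGroup W] [Module Γ W] [Module.Finite Γ W]
    (f : TriModHom Λ B Γ V W)
    (hf : IsGorensteinProjective (TriMat Λ B Γ) (TriMod f)) :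
    (∃ R : CLNAlg k, IsVersalDeformationRing k (TriMat Λ B Γ) (TriMod f) R) ∧
    (∃ R : CLNAlg k, IsVersalDeformationRing k Λ V R) ∧
    ∀ R₁ R₂ : CLNAlg k,
      IsVersalDeformationRing k (TriMat Λ B Γ) (TriMod f) R₁ →
      IsVersalDeformationRing k Λ V R₂ →
      Nonempty (CategoryTheory.Iso R₁ R₂) := by
  letI : Module k V := Module.compHom V (algebraMap k Λ)
  letI : Module k W := Module.compHom W (algebraMap k Γ)
  have : IsScalarTower k Λ V := ⟨fun c a v => by rw [Algebra.smul_def, mul_smul]; rfl⟩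
  have : IsScalarTower k Γ W := ⟨fun c a w => by rw [Algebra.smul_def, mul_smul]; rfl⟩
  have : Module.Finite k V := Module.Finite.trans Λ V
  have : Module.Finite k W := Module.Finite.trans Γ W
  have : Module.Finite Λ B := Module.Finite.of_restrictScalars_finite k Λ B
  have := TriMat.finite k Λ B Γ
  obtain ⟨hW, hV, hVW⟩ := hf.triMod hG
  refine ⟨exists_isVersalDeformationRing k (TriMat Λ B Γ) (TriMod f),
    exists_isVersalDeformationRing k Λ V, fun R₁ R₂ ⟨U, hU⟩ h₂ => ?_⟩
  obtain ⟨M, hM⟩ := U.exists_isCorner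
  -- The corner of a versal deformation over `R₁` makes `R₁` a versal ring of `V` as well.
  exact IsVersalDeformationRing.unique ⟨M, hM.isVersalDeformation hV hVW hU⟩ h₂
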